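/- Let $C$ be a finite set of orientations, that is, of points on the unit circle. Assume that $C$ is closed under taking opposites, and that $C$ spans the plane in the sense that any point $q$ can be reached from any point $p$ by a directed path of at most two links whose orientations are in $C$. A segment in the plane is called $C$-oriented if it is nondegenerate and, when directed from one of its endpoints to the other, its orientation is in $C$. Let $E=(e_1,\dots,e_n)$, $n\ge 1$, be a sequence of pairwise disjoint closed $C$-oriented segments in the plane, and let $s,t$ be two (not necessarily distinct) points of the plane that lie on none of the segments. A tour of $E$ from $s$ to $t$ is a polygonal path that begins at $s$ and ends at $t$ and on which there are points $p_1\in e_1,\dots,p_n\in e_n$ that occur along the path in this order. It is $C$-oriented if the orientation of each of its (directed, nondegenerate) links is in $C$. A minimum-link $C$-oriented tour is a $C$-oriented tour with the smallest number of links among all $C$-oriented tours of $E$ from $s$ to $t$. Theorem. A minimum-link $C$-oriented tour of $E$ from $s$ to $t$ can be computed in $O(|C|^2\cdot n^2)$ time. More precisely: there are a single program for the real RAM (unit-cost exact operations $+,-,\times,/$ and comparisons on real numbers, and a random access memory with words of $O(\log(|C|\cdot n))$ bits for indices and counters) and a constant $K$ such that, for all $C$, $E$, $s$, $t$ as above,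 the program, given the list of the orientations in $C$ in any order (as coordinates of points on the unit circle), the endpoints of $e_1,\dots,e_n$ in order, and $s$ and $t$, halts after at most $K\cdot|C|^2\cdot n^2$ steps and outputs the number of links and the sequence of vertices of a minimum-link $C$-oriented tour of $E$ from $s$ to $t$. -/

import Mathlib

/-! ## A real RAM with a step count

The machine has two random access memories, `W[0], W[1], …` holding machine words (natural numbers)
and `R[0], R[1], …` holding exact real numbers.  Programs are finite structured programs over the
elementary operations: constants, direct and indirect memory access, word arithmetic, exact field
arithmetic on reals, comparisons, sequencing, branching and loops.  There is no rounding, no root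
extraction and no conversion between the two memories.  A run is only defined as long as no word
exceeds the word bound `B` (so words have `O(log B)` bits) and no division by zero occurs. -/

namespace RealRAM

/-- Memory contents. -/
structure State where
  word : ℕ → ℕ
  real : ℕ → ℝ

/-- Binary operations on words; `sub` is truncated at `0`. -/
inductive WOp where
  | add | sub | mul

def WOp.apply : WOp → ℕ → ℕ → ℕ
  | .add, x, y => x + y
  | .sub, x, y => x - y
  | .mul, x, y => x * y

/-- Binary operations on real numbers. -/
inductive ROp where
  | add | sub | mul | div

noncomputable def ROp.apply : ROp → ℝ → ℝ → ℝ
  | .add, x, y => x + y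
  | .sub, x, y => x - y
  | .mul, x, y => x * y
  | .div, x, y => x / y

/-- Word expressions: a constant, the content of the word cell at a computed address, or an
operation. -/
inductive WExp where
  | const (c : ℕ)
  | cell (a : WExp)
  | op (o : WOp) (x y : WExp)

/-- Real expressions: an integer constant, the content of the real cell at a computed address, or an
operation. -/
inductive RExp where
  | const (c : ℤ)
  | cell (a : WExp)
  | op (o : ROp) (x y : RExp)

def WExp.eval (σ : State) : WExp → ℕ
  | .const c => c
  | .cell a => σ.word (a.eval σ)
  | .op o x y => o.apply (x.eval σ) (y.eval σ)

noncomputable def RExp.eval (σ : State) : RExp → ℝ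
  | .const c => (c : ℝ)
  | .cell a => σ.real (a.eval σ)
  | .op o x y => o.apply (x.eval σ) (y.eval σ)

/-- All values occurring in the evaluation, addresses included, fit into a word. -/
def WExp.Fits (B : ℕ) (σ : State) : WExp → Prop
  | .const c => c ≤ B
  | .cell a => a.Fits B σ ∧ σ.word (a.eval σ) ≤ B
  | .op o x y => x.Fits B σ ∧ y.Fits B σ ∧ o.apply (x.eval σ) (y.eval σ) ≤ B

/-- All addresses occurring in the evaluation fit into a word, and there is no division by zero. -/
def RExp.Fits (B : ℕ) (σ : State) : RExp → Prop
  | .const _ => True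
  | .cell a => a.Fits B σ
  | .op o x y => x.Fits B σ ∧ y.Fits B σ ∧ (o = .div → y.eval σ ≠ 0)

/-- Number of elementary operations (constants, memory accesses, arithmetic) in the evaluation. -/
def WExp.cost : WExp → ℕ
  | .const _ => 1
  | .cell a => a.cost + 1
  | .op _ x y => x.cost + y.cost + 1

/-- Number of elementary operations (constants, memory accesses, arithmetic) in the evaluation. -/
def RExp.cost : RExp → ℕ
  | .const _ => 1
  | .cell a => a.cost + 1
  | .op _ x y => x.cost + y.cost + 1

/-- Tests: strict comparison of two words or of two real numbers. -/
inductive Test where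
  | wlt (x y : WExp)
  | rlt (x y : RExp)

def Test.Holds (σ : State) : Test → Prop
  | .wlt x y => x.eval σ < y.eval σ
  | .rlt x y => x.eval σ < y.eval σ

def Test.Fits (B : ℕ) (σ : State) : Test → Prop
  | .wlt x y => x.Fits B σ ∧ y.Fits B σ
  | .rlt x y => x.Fits B σ ∧ y.Fits B σ

def Test.cost : Test → ℕ
  | .wlt x y => x.cost + y.cost + 1
  | .rlt x y => x.cost + y.cost + 1

/-- Programs. -/
inductive Program where
  | skip
  | wset (a e : WExp)
  | rset (a : WExp) (e : RExp)
  | seq (P Q : Program)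
  | ite (b : Test) (P Q : Program)
  | loop (b : Test) (P : Program)

/-- `Exec B P σ T σ'`: with word bound `B`, the program `P` started in `σ` halts in `σ'` after exactly
`T` elementary steps, without word overflow and without division by zero. -/
inductive Exec (B : ℕ) : Program → State → ℕ → State → Prop where
  | skip (σ : State) : Exec B .skip σ 1 σ
  | wset (a e : WExp) (σ : State) (ha : a.Fits B σ) (he : e.Fits B σ) :
      Exec B (.wset a e) σ (a.cost + e.cost + 1)
        { σ with word := Function.update σ.word (a.eval σ) (e.eval σ) }
  | rset (a : WExp) (e : RExp) (σ : State) (ha : a.Fits B σ) (he : e.Fits B σ) :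
      Exec B (.rset a e) σ (a.cost + e.cost + 1)
        { σ with real := Function.update σ.real (a.eval σ) (e.eval σ) }
  | seq {P Q : Program} {σ σ₁ σ₂ : State} {T₁ T₂ : ℕ}
      (hP : Exec B P σ T₁ σ₁) (hQ : Exec B Q σ₁ T₂ σ₂) :
      Exec B (.seq P Q) σ (T₁ + T₂) σ₂
  | ite_true {b : Test} {P Q : Program} {σ σ₁ : State} {T : ℕ}
      (hf : b.Fits B σ) (hb : b.Holds σ) (hP : Exec B P σ T σ₁) :
      Exec B (.ite b P Q) σ (b.cost + T) σ₁
  | ite_false {b : Test} {P Q : Program} {σ σ₁ : State} {T : ℕ}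
      (hf : b.Fits B σ) (hb : ¬ b.Holds σ) (hQ : Exec B Q σ T σ₁) :
      Exec B (.ite b P Q) σ (b.cost + T) σ₁
  | loop_done {b : Test} {P : Program} {σ : State}
      (hf : b.Fits B σ) (hb : ¬ b.Holds σ) :
      Exec B (.loop b P) σ b.cost σ
  | loop_step {b : Test} {P : Program} {σ σ₁ σ₂ : State} {T₁ T₂ : ℕ}
      (hf : b.Fits B σ) (hb : b.Holds σ) (hP : Exec B P σ T₁ σ₁)
      (hL : Exec B (.loop b P) σ₁ T₂ σ₂) :
      Exec B (.loop b P) σ (b.cost + T₁ + T₂) σ₂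

end RealRAM

/-! ## Oriented segments and tours in the plane -/

namespace LinkTour

/-- The plane, as a real vector space with coordinates. -/
abbrev Plane : Type := ℝ × ℝ

/-- The directed edge from `p` to `q` is nondegenerate and has orientation `c`. -/
def HasOrientation (p q c : Plane) : Prop :=
  ∃ r : ℝ, 0 < r ∧ q - p = r • c

/-- A finite set of orientations (enumerated without repetition as points on the unit circle) that
spans the plane by directed paths of at most two links and is closed under taking opposites. -/
structure IsOrientationSet {k : ℕ} (C : Fin k → Plane) : Prop where
  unit : ∀ j, (C j).1 ^ 2 + (C j).2 ^ 2 = 1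
  injective : Function.Injective C
  spans : ∀ p q : Plane, ∃ (i j : Fin k) (α β : ℝ), 0 ≤ α ∧ 0 ≤ β ∧ q = p + α • C i + β • C j
  symmetric : ∀ j, ∃ j', C j' = -C j

/-- The closed segment with the given pair of endpoints. -/
def points (e : Plane × Plane) : Set Plane := segment ℝ e.1 e.2

/-- The polygonal path with vertices `v 0, …, v m` (that is, with the `m` links
`v 0 v 1, …, v (m-1) v m`) is a tour of the sequence `E` from `s` to `t`: it begins at `s`, ends at
`t`, and there are points `p i ∈ E i` on the path that occur along the path in the order of the
sequence.  The position of `p i` on the path is given by the index `j i` of a link containing it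
and the parameter `τ i ∈ [0, 1]` on that link. -/
def IsTour {n : ℕ} (E : Fin n → Plane × Plane) (s t : Plane) (m : ℕ) (v : ℕ → Plane) : Prop :=
  v 0 = s ∧ v m = t ∧
  ∃ (j : Fin n → ℕ) (τ : Fin n → ℝ),
    (∀ i, j i < m ∧ 0 ≤ τ i ∧ τ i ≤ 1 ∧
      AffineMap.lineMap (v (j i)) (v (j i + 1)) (τ i) ∈ points (E i)) ∧
    ∀ i i', i < i' → j i < j i' ∨ (j i = j i' ∧ τ i < τ i')

/-- Each of the `m` links of the path has an orientation in `C`. -/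
def IsOriented {k : ℕ} (C : Fin k → Plane) (m : ℕ) (v : ℕ → Plane) : Prop :=
  ∀ j < m, ∃ i, HasOrientation (v j) (v (j + 1)) (C i)

/-- A `C`-oriented tour with the minimum number of links among all `C`-oriented tours. -/
def IsMinLinkTour {k n : ℕ} (C : Fin k → Plane) (E : Fin n → Plane × Plane) (s t : Plane)
    (m : ℕ) (v : ℕ → Plane) : Prop :=
  IsTour E s t m v ∧ IsOriented C m v ∧
  ∀ (m' : ℕ) (v' : ℕ → Plane), IsTour E s t m' v' → IsOriented C m' v' → m ≤ m'

/-- The points of the input in the order in which they are stored: `s`, `t`, the orientations, and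
the two endpoints of each segment. -/
def inputPoints {k n : ℕ} (C : Fin k → Plane) (E : Fin n → Plane × Plane) (s t : Plane) :
    List Plane :=
  [s, t] ++ List.ofFn C ++ (List.ofFn E).flatMap fun e => [e.1, e.2]

/-- Initially `W[0] = k` is the number of orientations and `W[1] = n` the number of segments; point
number `i` of the input has its coordinates in `R[2i]` and `R[2i+1]`; all other cells hold `0`. -/
noncomputable def inputState {k n : ℕ} (C : Fin k → Plane) (E : Fin n → Plane × Plane)
    (s t : Plane) : RealRAM.State where
  word i := if i = 0 then k else if i = 1 then n else 0
  real i :=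
    let p := (inputPoints C E s t).getD (i / 2) (0, 0)
    if i % 2 = 0 then p.1 else p.2

/-- Vertex number `i` of the output path is read off from `R[2i]` and `R[2i+1]`. -/
def outputVertex (σ : RealRAM.State) (i : ℕ) : Plane :=
  (σ.real (2 * i), σ.real (2 * i + 1))

end LinkTour

/-!
The start `s` and the end `t` are treated as degenerate segments number `0` and `n + 1`.  Segment `i`
is parametrized by `pt i τ = org i + τ • vec i` with `1 ≤ τ ≤ 2`.

*Combinatorics.*  `Reach m i c q` says that the point `q` of segment `i` is reached by `m` links, of
which the last has orientation `c`, after visits of the earlier segments in order.  Links may be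
degenerate, and between consecutive visits only one turn is allowed.  One turn suffices: a nonnegative
combination of three vectors in the plane is a nonnegative combination of two of them, so of two turns
one can be traded for a degenerate link (`Ext.link`).  Every tour thus yields a `Reach` statement with
the same number of links (`mu_le_of_isTour`), and a path with the minimum number `mu (n + 1)` of links
has no degenerate link (`isMinLinkTour_of_pre`).  Since two links reach every point of the plane and
the segments are themselves oriented, `mu (i + 1) ≤ mu i + 2`, all points of segment `i` are reached
with `mu i + 1` links, and they are reached with all orientations with `mu i + 2` links.  So only the
numbers `mu i` and `mu i + 1` need a computation for each segment.

*Slots.*  For each segment `i`, number of links and last orientation `c`, the set of parameters of the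
reached points is stored as a union of `O(n)` intervals, the slots.  What keeps their number linear is
that a new set can always be merged with an old slot that it meets.  Points reached by a turn from slot
`g` for orientation `d` either include an endpoint of the segment, and then go to one of two slots
added for the endpoints, or meet the ray part of the slot that contains slot `g` for one more link
(`cone_cases`); a pointer to that slot is maintained.  Points reached with one link less go to the
slot of an endpoint as well, or they are already covered by a turn (`LevelHyp.subset_turn`), except
when `d` is opposite to `c`; then they go to slot `g` for `c`, which is still empty, because disjoint
segments cannot be met by rays of both orientations (`LevelHyp.absorb`, `Valid.not_above_below`).
With `|C|` choices for `d` and for `c`, `O(n)` slots and `n`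
segments this costs `O(|C|² n²)` steps.  The set reached from a slot by a turn is an interval, whose
ends are found by Fourier–Motzkin elimination (`wp_coneProg`).

*Path.*  From the end, each backtracking step searches the slots of the previous segment for a
predecessor, which exists by `Valid.predecessor`.  The quantity `3 i + a`, where `a` is the number of
links above `mu i - 1`, decreases, so there are `O(n)` steps of cost `O(|C| n)` each.

*Machine.*  The program is written in a structured language with arrays (`SP`), for which total
correctness is proved by weakest preconditions (`wp`).  It is compiled to the real RAM, and
`exec_compile` bounds the words by a power of a bound on the stored words, and the time by a constant
times a monomial in `k` and `n` that is read off the nesting of the loops.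
-/


/-! ### A structured language with tagged arrays, compiled to the real RAM -/

namespace RealRAM

/-- Memory of the structured language: `w t i` is entry `i` of word array `t`, and `r t i` is
entry `i` of real array `t`.  A scalar is entry `0` of an array. -/
structure Mem where
  w : ℕ → ℕ → ℕ
  r : ℕ → ℕ → ℝ

namespace Mem

/-- Writes `v` to entry `i` of word array `t`. -/
def setW (s : Mem) (t i v : ℕ) : Mem :=
  { s with w := fun t' i' => if t' = t ∧ i' = i then v else s.w t' i' }

/-- Writes `v` to entry `i` of real array `t`. -/
def setR (s : Mem) (t i : ℕ) (v : ℝ) : Mem :=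
  { s with r := fun t' i' => if t' = t ∧ i' = i then v else s.r t' i' }

@[simp] lemma setW_r (s : Mem) (t i v : ℕ) : (s.setW t i v).r = s.r := rfl

@[simp] lemma setR_w (s : Mem) (t i : ℕ) (v : ℝ) : (s.setR t i v).w = s.w := rfl

@[simp] lemma setW_w_self (s : Mem) (t i v : ℕ) : (s.setW t i v).w t i = v := by simp [setW]

@[simp] lemma setR_r_self (s : Mem) (t i : ℕ) (v : ℝ) : (s.setR t i v).r t i = v := by simp [setR]

lemma setW_w_same (s : Mem) (t i v i' : ℕ) :
    (s.setW t i v).w t i' = if i' = i then v else s.w t i' := by simp [setW]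

lemma setR_r_same (s : Mem) (t i : ℕ) (v : ℝ) (i' : ℕ) :
    (s.setR t i v).r t i' = if i' = i then v else s.r t i' := by simp [setR]

@[simp] lemma setW_w_of_ne (s : Mem) {t t' : ℕ} (i v : ℕ) (h : t' ≠ t) :
    (s.setW t i v).w t' = s.w t' := by funext i'; simp [setW, h]

@[simp] lemma setR_r_of_ne (s : Mem) {t t' : ℕ} (i : ℕ) (v : ℝ) (h : t' ≠ t) :
    (s.setR t i v).r t' = s.r t' := by funext i'; simp [setR, h]

end Mem

/-- Word expressions of the structured language. -/
inductive WE where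
  | const (c : ℕ)
  | get (t : ℕ) (e : WE)
  | op (o : WOp) (x y : WE)

/-- Real expressions of the structured language. -/
inductive RE where
  | const (c : ℤ)
  | get (t : ℕ) (e : WE)
  | op (o : ROp) (x y : RE)

/-- Tests of the structured language. -/
inductive TE where
  | wlt (x y : WE)
  | rlt (x y : RE)

instance (n : ℕ) : OfNat WE n := ⟨.const n⟩
instance : Add WE := ⟨.op .add⟩
instance : Sub WE := ⟨.op .sub⟩
instance : Mul WE := ⟨.op .mul⟩
instance (n : ℕ) : OfNat RE n := ⟨.const n⟩
instance : Add RE := ⟨.op .add⟩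
instance : Sub RE := ⟨.op .sub⟩
instance : Mul RE := ⟨.op .mul⟩
instance : Div RE := ⟨.op .div⟩

/-- Statements of the structured language.  `loop t bnd cf ka na body` runs `body` with the word
scalar `t` counting from `0` up to the value of `bnd`; the number of rounds is claimed to be at most
`cf * k ^ ka * n ^ na`. -/
inductive SP where
  | skip
  | wset (t : ℕ) (i e : WE)
  | rset (t : ℕ) (i : WE) (e : RE)
  | seq (P Q : SP)
  | ite (b : TE) (P Q : SP)
  | loop (t : ℕ) (bnd : WE) (cf ka na : ℕ) (P : SP)

/-- The scalar with tag `t`, as a word expression. -/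
def WE.var (t : ℕ) : WE := .get t 0

/-- The scalar with tag `t`, as a real expression. -/
def RE.var (t : ℕ) : RE := .get t 0

def WE.eval (s : Mem) : WE → ℕ
  | .const c => c
  | .get t e => s.w t (e.eval s)
  | .op o x y => o.apply (x.eval s) (y.eval s)

noncomputable def RE.eval (s : Mem) : RE → ℝ
  | .const c => (c : ℝ)
  | .get t e => s.r t (e.eval s)
  | .op o x y => o.apply (x.eval s) (y.eval s)

def TE.Holds (s : Mem) : TE → Prop
  | .wlt x y => x.eval s < y.eval s
  | .rlt x y => x.eval s < y.eval s

section Eval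
variable (s : Mem)

@[simp] lemma WE.eval_lit_0 : (0 : WE).eval s = 0 := rfl
@[simp] lemma WE.eval_lit_1 : (1 : WE).eval s = 1 := rfl
@[simp] lemma WE.eval_lit_2 : (2 : WE).eval s = 2 := rfl
@[simp] lemma WE.eval_lit_3 : (3 : WE).eval s = 3 := rfl
@[simp] lemma WE.eval_lit_4 : (4 : WE).eval s = 4 := rfl
@[simp] lemma WE.eval_lit_5 : (5 : WE).eval s = 5 := rfl
@[simp] lemma WE.eval_lit_16 : (16 : WE).eval s = 16 := rfl
@[simp] lemma RE.eval_lit_0 : (0 : RE).eval s = 0 := by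
  change ((0 : ℤ) : ℝ) = 0
  norm_num
@[simp] lemma RE.eval_lit_1 : (1 : RE).eval s = 1 := by
  change ((1 : ℤ) : ℝ) = 1
  norm_num
@[simp] lemma RE.eval_lit_2 : (2 : RE).eval s = 2 := by
  change ((2 : ℤ) : ℝ) = 2
  norm_num
@[simp] lemma WE.eval_const (n : ℕ) : (WE.const n).eval s = n := rfl
@[simp] lemma WE.eval_get (t : ℕ) (e : WE) : (WE.get t e).eval s = s.w t (e.eval s) := rfl
@[simp] lemma WE.eval_var (t : ℕ) : (WE.var t).eval s = s.w t 0 := rfl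
@[simp] lemma WE.eval_add (x y : WE) : (x + y).eval s = x.eval s + y.eval s := rfl
@[simp] lemma WE.eval_sub (x y : WE) : (x - y).eval s = x.eval s - y.eval s := rfl
@[simp] lemma WE.eval_mul (x y : WE) : (x * y).eval s = x.eval s * y.eval s := rfl
@[simp] lemma RE.eval_get (t : ℕ) (e : WE) : (RE.get t e).eval s = s.r t (e.eval s) := rfl
@[simp] lemma RE.eval_var (t : ℕ) : (RE.var t).eval s = s.r t 0 := rfl
@[simp] lemma RE.eval_add (x y : RE) : (x + y).eval s = x.eval s + y.eval s := rfl
@[simp] lemma RE.eval_sub (x y : RE) : (x - y).eval s = x.eval s - y.eval s := rfl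
@[simp] lemma RE.eval_mul (x y : RE) : (x * y).eval s = x.eval s * y.eval s := rfl
@[simp] lemma RE.eval_div (x y : RE) : (x / y).eval s = x.eval s / y.eval s := rfl
@[simp] lemma TE.holds_wlt (x y : WE) : (TE.wlt x y).Holds s ↔ x.eval s < y.eval s := Iff.rfl
@[simp] lemma TE.holds_rlt (x y : RE) : (TE.rlt x y).Holds s ↔ x.eval s < y.eval s := Iff.rfl

end Eval

/-- The parameters of a run: the sizes `k`, `n` of the input, the number `base` of real cells
reserved for real array `0` (the input and the output), and a bound `V` on all stored words. -/
structure Sizes where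
  k : ℕ
  n : ℕ
  base : ℕ
  V : ℕ

variable (Z : Sizes)

/-- No division by zero, and no access to real array `0` outside its `base` cells. -/
def RE.Safe (s : Mem) : RE → Prop
  | .const _ => True
  | .get t e => t = 0 → e.eval s < Z.base
  | .op o x y => x.Safe s ∧ y.Safe s ∧ (o = .div → y.eval s ≠ 0)

/-- Both sides can be evaluated without a fault. -/
def TE.Safe (s : Mem) : TE → Prop
  | .wlt _ _ => True
  | .rlt x y => x.Safe Z s ∧ y.Safe Z s

section Safe
variable (s : Mem)

@[simp] lemma RE.safe_lit_0 : (0 : RE).Safe Z s := trivial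
@[simp] lemma RE.safe_lit_1 : (1 : RE).Safe Z s := trivial
@[simp] lemma RE.safe_lit_2 : (2 : RE).Safe Z s := trivial
@[simp] lemma RE.safe_get (t : ℕ) (e : WE) :
    (RE.get t e).Safe Z s ↔ (t = 0 → e.eval s < Z.base) := Iff.rfl
@[simp] lemma RE.safe_var (t : ℕ) : (RE.var t).Safe Z s ↔ (t = 0 → 0 < Z.base) := Iff.rfl
@[simp] lemma RE.safe_add (x y : RE) : (x + y).Safe Z s ↔ x.Safe Z s ∧ y.Safe Z s := by
  change (_ ∧ _ ∧ _) ↔ _; simp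
@[simp] lemma RE.safe_sub (x y : RE) : (x - y).Safe Z s ↔ x.Safe Z s ∧ y.Safe Z s := by
  change (_ ∧ _ ∧ _) ↔ _; simp
@[simp] lemma RE.safe_mul (x y : RE) : (x * y).Safe Z s ↔ x.Safe Z s ∧ y.Safe Z s := by
  change (_ ∧ _ ∧ _) ↔ _; simp
@[simp] lemma RE.safe_div (x y : RE) :
    (x / y).Safe Z s ↔ x.Safe Z s ∧ y.Safe Z s ∧ y.eval s ≠ 0 := by
  change (_ ∧ _ ∧ _) ↔ _; simp
@[simp] lemma TE.safe_wlt (x y : WE) : (TE.wlt x y).Safe Z s := trivial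
@[simp] lemma TE.safe_rlt (x y : RE) : (TE.rlt x y).Safe Z s ↔ x.Safe Z s ∧ y.Safe Z s := Iff.rfl

end Safe

/-- Weakest preconditions for total correctness.  The clause for a loop asks for its number `N` of
rounds and for an invariant that fixes the counter and the bound. -/
def wp : SP → (Mem → Prop) → Mem → Prop
  | .skip, Q, s => Q s
  | .wset t i e, Q, s => e.eval s ≤ Z.V ∧ Q (s.setW t (i.eval s) (e.eval s))
  | .rset t i e, Q, s =>
      e.Safe Z s ∧ (t = 0 → i.eval s < Z.base) ∧ Q (s.setR t (i.eval s) (e.eval s))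
  | .seq P P', Q, s => wp P (wp P' Q) s
  | .ite b P P', Q, s => b.Safe Z s ∧ (b.Holds s → wp P Q s) ∧ (¬ b.Holds s → wp P' Q s)
  | .loop t bnd cf ka na P, Q, s => ∃ (N : ℕ) (I : ℕ → Mem → Prop),
      N ≤ cf * Z.k ^ ka * Z.n ^ na ∧ N ≤ Z.V ∧ I 0 (s.setW t 0 0) ∧
      (∀ i ≤ N, ∀ s', I i s' → s'.w t 0 = i ∧ bnd.eval s' = N) ∧
      (∀ i < N, ∀ s', I i s' →
        wp P (fun s'' => s''.w t 0 = i ∧ I (i + 1) (s''.setW t 0 (i + 1))) s') ∧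
      ∀ s', I N s' → Q s'

lemma wp_mono {P : SP} {Q Q' : Mem → Prop} (h : ∀ s, Q s → Q' s) :
    ∀ {s : Mem}, wp Z P Q s → wp Z P Q' s := by
  induction P generalizing Q Q' with
  | skip => exact fun hs => h _ hs
  | wset t i e => exact fun hs => ⟨hs.1, h _ hs.2⟩
  | rset t i e => exact fun hs => ⟨hs.1, hs.2.1, h _ hs.2.2⟩
  | seq P P' ih ih' => exact fun hs => ih (fun s => ih' h) hs
  | ite b P P' ih ih' =>
    exact fun hs => ⟨hs.1, fun hb => ih h (hs.2.1 hb), fun hb => ih' h (hs.2.2 hb)⟩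
  | loop t bnd cf ka na P ih =>
    rintro s ⟨N, I, h1, h2, h3, h4, h5, h6⟩
    exact ⟨N, I, h1, h2, h3, h4, h5, fun s' hs' => h _ (h6 s' hs')⟩

/-- Whether the statement may write to word array `t`. -/
def SP.writesW : SP → ℕ → Bool
  | .skip, _ => false
  | .wset t' _ _, t => t == t'
  | .rset _ _ _, _ => false
  | .seq P Q, t => P.writesW t || Q.writesW t
  | .ite _ P Q, t => P.writesW t || Q.writesW t
  | .loop t' _ _ _ _ P, t => t == t' || P.writesW t

/-- Whether the statement may write to real array `t`. -/
def SP.writesR : SP → ℕ → Bool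
  | .skip, _ => false
  | .wset _ _ _, _ => false
  | .rset t' _ _, t => t == t'
  | .seq P Q, t => P.writesR t || Q.writesR t
  | .ite _ P Q, t => P.writesR t || Q.writesR t
  | .loop _ _ _ _ _ P, t => P.writesR t

/-- The two memories agree outside the arrays to which `P` may write. -/
def Frame (P : SP) (s s' : Mem) : Prop :=
  (∀ t, P.writesW t = false → s'.w t = s.w t) ∧ (∀ t, P.writesR t = false → s'.r t = s.r t)

lemma Frame.w {P : SP} {s s' : Mem} (h : Frame P s s') (t : ℕ)
    (ht : P.writesW t = false := by rfl) : s'.w t = s.w t := h.1 t ht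

lemma Frame.r {P : SP} {s s' : Mem} (h : Frame P s s') (t : ℕ)
    (ht : P.writesR t = false := by rfl) : s'.r t = s.r t := h.2 t ht

lemma Frame.refl (P : SP) (s : Mem) : Frame P s s := ⟨fun _ _ => rfl, fun _ _ => rfl⟩

/-- A statement changes only the arrays to which it may write. -/
lemma wp_frame {P : SP} : ∀ {Q : Mem → Prop} {s : Mem}, wp Z P Q s →
    wp Z P (fun s' => Q s' ∧ Frame P s s') s := by
  induction P with
  | skip => exact fun hs => ⟨hs, Frame.refl _ _⟩
  | wset t i e =>
    refine fun hs => ⟨hs.1, hs.2, fun t' ht => ?_, fun t' ht => rfl⟩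
    exact Mem.setW_w_of_ne _ _ _ (by simpa [SP.writesW] using ht)
  | rset t i e =>
    refine fun hs => ⟨hs.1, hs.2.1, hs.2.2, fun t' ht => rfl, fun t' ht => ?_⟩
    exact Mem.setR_r_of_ne _ _ _ (by simpa [SP.writesR] using ht)
  | seq P P' ih ih' =>
    intro Q s hs
    refine wp_mono (P := P) Z ?_ (ih hs)
    rintro s1 ⟨h1, f1⟩
    refine wp_mono Z ?_ (ih' h1)
    rintro s2 ⟨h2, f2⟩
    refine ⟨h2, fun t ht => ?_, fun t ht => ?_⟩
    · simp only [SP.writesW, Bool.or_eq_false_iff] at ht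
      rw [f2.1 t ht.2, f1.1 t ht.1]
    · simp only [SP.writesR, Bool.or_eq_false_iff] at ht
      rw [f2.2 t ht.2, f1.2 t ht.1]
  | ite b P P' ih ih' =>
    intro Q s hs
    refine ⟨hs.1, fun hb => wp_mono Z ?_ (ih (hs.2.1 hb)),
      fun hb => wp_mono Z ?_ (ih' (hs.2.2 hb))⟩ <;>
    · rintro s1 ⟨h1, f1⟩
      refine ⟨h1, fun t ht => f1.1 t ?_, fun t ht => f1.2 t ?_⟩ <;>
      simp only [SP.writesW, SP.writesR, Bool.or_eq_false_iff] at ht <;> simp [ht]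
  | loop t bnd cf ka na P ih =>
    rintro Q s ⟨N, I, h1, h2, h3, h4, h5, h6⟩
    refine ⟨N, fun i s' => I i s' ∧ Frame (.loop t bnd cf ka na P) s s', h1, h2, ⟨h3, ?_⟩,
      fun i hi s' hs' => h4 i hi s' hs'.1, fun i hi s' hs' => ?_, fun s' hs' => ⟨h6 s' hs'.1, hs'.2⟩⟩
    · refine ⟨fun t' ht => ?_, fun t' ht => rfl⟩
      simp only [SP.writesW, Bool.or_eq_false_iff, beq_eq_false_iff_ne] at ht
      exact Mem.setW_w_of_ne _ _ _ ht.1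
    · refine wp_mono Z ?_ (ih (h5 i hi s' hs'.1))
      rintro s1 ⟨⟨h7, h8⟩, f1⟩
      refine ⟨h7, h8, fun t' ht => ?_, fun t' ht => ?_⟩
      · have ht' := ht
        simp only [SP.writesW, Bool.or_eq_false_iff, beq_eq_false_iff_ne] at ht
        rw [Mem.setW_w_of_ne _ _ _ ht.1, f1.1 t' ht.2, hs'.2.1 t' ht']
      · have ht' := ht
        simp only [SP.writesR] at ht
        rw [Mem.setW_r, f1.2 t' ht, hs'.2.2 t' ht']

/-- The word arrays whose entries a word expression reads. -/
def WE.reads : WE → ℕ → Bool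
  | .const _, _ => false
  | .get t' e, t => t == t' || e.reads t
  | .op _ x y, t => x.reads t || y.reads t

lemma WE.eval_congr {s s' : Mem} : ∀ {e : WE}, (∀ t, e.reads t = true → s'.w t = s.w t) →
    e.eval s' = e.eval s
  | .const _, _ => rfl
  | .get t e, h => by
    have h1 := WE.eval_congr (e := e) fun t ht => h t (by simp [WE.reads, ht])
    simp only [WE.eval, h1, h t (by simp [WE.reads])]
  | .op o x y, h => by
    have h1 := WE.eval_congr (e := x) fun t ht => h t (by simp [WE.reads, ht])
    have h2 := WE.eval_congr (e := y) fun t ht => h t (by simp [WE.reads, ht])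
    simp only [WE.eval, h1, h2]

/-- The loop rule.  Everything outside the arrays written by the loop is known to be unchanged in
each round; the counter and the bound are preserved because the body does not write to them. -/
lemma wp_loop {t : ℕ} {bnd : WE} {cf ka na : ℕ} {P : SP} {Q : Mem → Prop} {s : Mem}
    (I : ℕ → Mem → Prop) (N : ℕ) (hN : bnd.eval s = N) (hc : N ≤ cf * Z.k ^ ka * Z.n ^ na)
    (hV : N ≤ Z.V) (ht : P.writesW t = false)
    (hb : ∀ t', bnd.reads t' = true → (SP.loop t bnd cf ka na P).writesW t' = false)
    (h0 : I 0 (s.setW t 0 0))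
    (hstep : ∀ i < N, ∀ s', s'.w t 0 = i → Frame (.loop t bnd cf ka na P) s s' → I i s' →
      wp Z P (fun s'' => I (i + 1) (s''.setW t 0 (i + 1))) s')
    (hend : ∀ s', s'.w t 0 = N → Frame (.loop t bnd cf ka na P) s s' → I N s' → Q s') :
    wp Z (.loop t bnd cf ka na P) Q s := by
  have key : wp Z (.loop t bnd cf ka na P) (fun s' => s'.w t 0 = N ∧ I N s' ∧
      Frame (.loop t bnd cf ka na P) s s') s := by
    refine ⟨N, fun i s' => s'.w t 0 = i ∧ I i s' ∧ Frame (.loop t bnd cf ka na P) s s',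
      hc, hV, ⟨by simp, h0, ?_⟩, ?_, ?_, fun s' hs' => hs'⟩
    · refine ⟨fun t' ht => ?_, fun t' ht => rfl⟩
      simp only [SP.writesW, Bool.or_eq_false_iff, beq_eq_false_iff_ne] at ht
      exact Mem.setW_w_of_ne _ _ _ ht.1
    · rintro i hi s' ⟨h1, h2, h3⟩
      refine ⟨h1, ?_⟩
      rw [← hN]
      exact WE.eval_congr fun t' ht' => h3.1 t' (hb t' ht')
    · rintro i hi s' ⟨h1, h2, h3⟩
      refine wp_mono Z ?_ (wp_frame Z (hstep i hi s' h1 h3 h2))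
      rintro s'' ⟨h4, h5⟩
      refine ⟨by rw [h5.1 t ht, h1], by simp, h4, fun t' ht => ?_, fun t' ht => ?_⟩
      · have ht' := ht
        simp only [SP.writesW, Bool.or_eq_false_iff, beq_eq_false_iff_ne] at ht
        rw [Mem.setW_w_of_ne _ _ _ ht.1, h5.1 t' ht.2, h3.1 t' ht']
      · have ht' := ht
        simp only [SP.writesR] at ht
        rw [Mem.setW_r, h5.2 t' ht, h3.2 t' ht']
  exact wp_mono Z (fun s' hs' => hend s' hs'.1 hs'.2.2 hs'.2.1) key

/-! ### Compilation and its correctness -/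

/-- Entry `i` of word array `t` is word cell `t + 64 * i`. -/
def WE.addr (t : ℕ) (i : WExp) : WExp := .op .add (.const t) (.op .mul (.const 64) i)

def WE.compile : WE → WExp
  | .const c => .const c
  | .get t e => .cell (WE.addr t e.compile)
  | .op o x y => .op o x.compile y.compile

/-- Entry `i` of real array `0` is real cell `i`; entry `i` of real array `t > 0` is real cell
`base + t + 64 * i`, where `base` is the content of word cell `2`. -/
def RE.addr (t : ℕ) (i : WExp) : WExp :=
  if t = 0 then i else .op .add (.cell (.const 2)) (WE.addr t i)

def RE.compile : RE → RExp
  | .const c => .const c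
  | .get t e => .cell (RE.addr t e.compile)
  | .op o x y => .op o x.compile y.compile

def TE.compile : TE → Test
  | .wlt x y => .wlt x.compile y.compile
  | .rlt x y => .rlt x.compile y.compile

/-- The counter of a loop is set to `0` before the loop and increased after each round.  The claimed
bound on the number of rounds leaves no trace in the machine program. -/
def SP.compile : SP → Program
  | .skip => .skip
  | .wset t i e => .wset (WE.addr t i.compile) e.compile
  | .rset t i e => .rset (RE.addr t i.compile) e.compile
  | .seq P Q => .seq P.compile Q.compile
  | .ite b P Q => .ite b.compile P.compile Q.compile
  | .loop t bnd _ _ _ P =>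
      .seq (.wset (WE.addr t (.const 0)) (.const 0))
        (.loop (TE.wlt (.var t) bnd).compile
          (.seq P.compile (.wset (WE.addr t (.const 0)) (.op .add (WE.var t).compile (.const 1)))))

/-- All constants are at most `64`. -/
def WExp.small : WExp → Bool
  | .const c => c ≤ 64
  | .cell a => a.small
  | .op _ x y => x.small && y.small

/-- All tags are below `64`, so that the arrays do not overlap in memory. -/
def WE.wf : WE → Bool
  | .const _ => true
  | .get t e => t < 64 && e.wf
  | .op _ x y => x.wf && y.wf

/-- All tags are below `64`, and all addresses have constants at most `64` and cost at most `D`. -/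
def RE.wf (D : ℕ) : RE → Bool
  | .const _ => true
  | .get t e => t < 64 && e.wf && (RE.addr t e.compile).small && (RE.addr t e.compile).cost ≤ D
  | .op _ x y => x.wf D && y.wf D

/-- An admissible word expression: tags below `64`, constants at most `64`, cost at most `D`. -/
def WE.ok (D : ℕ) (e : WE) : Bool := e.wf && e.compile.small && e.compile.cost ≤ D

def TE.ok (D : ℕ) : TE → Bool
  | .wlt x y => x.ok D && y.ok D
  | .rlt x y => x.wf D && y.wf D

/-- An admissible statement.  Word cell `2` holds the base address of the real arrays, so that word
array `2` must not be written. -/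
def SP.ok (D : ℕ) : SP → Bool
  | .skip => true
  | .wset t i e => t < 64 && t != 2 && (WE.get t i).ok D && e.ok D
  | .rset t i e => (RE.get t i).wf D && e.wf D
  | .seq P Q => P.ok D && Q.ok D
  | .ite b P Q => b.ok D && P.ok D && Q.ok D
  | .loop t bnd _ _ _ P => t < 64 && t != 2 && 10 ≤ D && bnd.ok D && P.ok D

/-- Exponent of `k` in the time bound. -/
def SP.kd : SP → ℕ
  | .seq P Q => max P.kd Q.kd
  | .ite _ P Q => max P.kd Q.kd
  | .loop _ _ _ ka _ P => ka + P.kd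
  | _ => 0

/-- Exponent of `n` in the time bound. -/
def SP.nd : SP → ℕ
  | .seq P Q => max P.nd Q.nd
  | .ite _ P Q => max P.nd Q.nd
  | .loop _ _ _ _ na P => na + P.nd
  | _ => 0

/-- Constant factor in the time bound. -/
def SP.coef : SP → ℕ
  | .skip => 1
  | .wset t i e => (WE.addr t i.compile).cost + e.compile.cost + 1
  | .rset t i e => (RE.addr t i.compile).cost + e.compile.cost + 1
  | .seq P Q => P.coef + Q.coef
  | .ite b P Q => b.compile.cost + P.coef + Q.coef
  | .loop t bnd cf _ _ P =>
      cf * ((TE.wlt (.var t) bnd).compile.cost + (P.coef + 20)) +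
        (10 + (TE.wlt (.var t) bnd).compile.cost)

lemma WExp.eval_le_fits {V : ℕ} (hV : 64 ≤ V) {σ : State} (hσ : ∀ a, σ.word a ≤ V) :
    ∀ (e : WExp), e.small = true →
      e.eval σ ≤ V ^ e.cost ∧ ∀ D, e.cost ≤ D → e.Fits (V ^ D) σ
  | .const c, h => by
    have hc : c ≤ V := by
      simp only [WExp.small, decide_eq_true_eq] at h; omega
    refine ⟨by simpa [WExp.eval, WExp.cost] using hc, fun D hD => ?_⟩
    simp only [WExp.cost] at hD
    exact hc.trans (Nat.le_self_pow (by omega) V)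
  | .cell a, h => by
    have ih := WExp.eval_le_fits hV hσ a (by simpa [WExp.small] using h)
    refine ⟨?_, fun D hD => ?_⟩
    · exact (hσ _).trans (Nat.le_self_pow (by simp [WExp.cost]) V)
    · simp only [WExp.cost] at hD
      exact ⟨ih.2 D (by omega), (hσ _).trans (Nat.le_self_pow (by omega) V)⟩
  | .op o x y, h => by
    simp only [WExp.small, Bool.and_eq_true] at h
    have ihx := WExp.eval_le_fits hV hσ x h.1
    have ihy := WExp.eval_le_fits hV hσ y h.2
    have hx1 : 1 ≤ V ^ x.cost := Nat.one_le_pow _ _ (by omega)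
    have hy1 : 1 ≤ V ^ y.cost := Nat.one_le_pow _ _ (by omega)
    have key : o.apply (x.eval σ) (y.eval σ) ≤ V ^ (x.cost + y.cost + 1) := by
      have e1 : V ^ (x.cost + y.cost + 1) = V ^ x.cost * V ^ y.cost * V := by
        rw [pow_succ, pow_add]
      have e2 : V ^ x.cost * V ^ y.cost * 2 ≤ V ^ (x.cost + y.cost + 1) := by
        rw [e1]; exact Nat.mul_le_mul_left _ (by omega)
      have e3 : V ^ x.cost ≤ V ^ x.cost * V ^ y.cost := Nat.le_mul_of_pos_right _ (by omega)
      have e4 : V ^ y.cost ≤ V ^ x.cost * V ^ y.cost := Nat.le_mul_of_pos_left _ (by omega)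
      cases o with
      | add => have := ihx.1; have := ihy.1; simp only [WOp.apply]; omega
      | sub => have := ihx.1; simp only [WOp.apply]; omega
      | mul =>
        have := Nat.mul_le_mul ihx.1 ihy.1
        simp only [WOp.apply]; omega
    refine ⟨key, fun D hD => ?_⟩
    simp only [WExp.cost] at hD
    exact ⟨ihx.2 D (by omega), ihy.2 D (by omega),
      key.trans (Nat.pow_le_pow_right (by omega) hD)⟩

/-- The machine state `σ` represents the memory `s`. -/
structure Repr (σ : State) (s : Mem) : Prop where
  word : ∀ t < 64, ∀ i, σ.word (t + 64 * i) = s.w t i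
  real : ∀ t < 64, t ≠ 0 → ∀ i, σ.real (Z.base + (t + 64 * i)) = s.r t i
  io : ∀ i < Z.base, σ.real i = s.r 0 i
  bdd : ∀ a, σ.word a ≤ Z.V
  base : σ.word 2 = Z.base

section Compile
variable {Z} {σ : State} {s : Mem} (H : Repr Z σ s)
include H

lemma WE.eval_compile : ∀ {e : WE}, e.wf = true → e.compile.eval σ = e.eval s
  | .const _, _ => rfl
  | .get t e, h => by
    simp only [WE.wf, Bool.and_eq_true, decide_eq_true_eq] at h
    have := WE.eval_compile h.2
    simp only [WE.compile, WExp.eval, WE.addr, WOp.apply, WE.eval, this]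
    exact H.word t h.1 _
  | .op o x y, h => by
    simp only [WE.wf, Bool.and_eq_true] at h
    simp only [WE.compile, WExp.eval, WE.eval, WE.eval_compile h.1, WE.eval_compile h.2]

lemma RE.eval_compile : ∀ {e : RE} {D : ℕ}, e.wf D = true → e.Safe Z s →
    e.compile.eval σ = e.eval s
  | .const _, _, _, _ => rfl
  | .get t e, D, h, hs => by
    simp only [RE.wf, Bool.and_eq_true, decide_eq_true_eq] at h
    have := WE.eval_compile H h.1.1.2
    by_cases ht : t = 0
    · subst ht
      simp only [RE.compile, RExp.eval, RE.addr, RE.eval, if_true, this]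
      exact H.io _ (hs rfl)
    · simp only [RE.compile, RExp.eval, RE.addr, if_neg ht, WExp.eval, WE.addr, WOp.apply, RE.eval,
        this, H.base]
      exact H.real t h.1.1.1 ht _
  | .op o x y, D, h, hs => by
    simp only [RE.wf, Bool.and_eq_true] at h
    simp only [RE.compile, RExp.eval, RE.eval, RE.eval_compile h.1 hs.1,
      RE.eval_compile h.2 hs.2.1]

variable (hV : 64 ≤ Z.V)
include hV

lemma WE.fits_compile {e : WE} {D : ℕ} (h : e.ok D = true) : e.compile.Fits (Z.V ^ D) σ := by
  simp only [WE.ok, Bool.and_eq_true, decide_eq_true_eq] at h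
  exact (WExp.eval_le_fits hV H.bdd e.compile h.1.2).2 D h.2

lemma RE.fits_compile : ∀ {e : RE} {D : ℕ}, e.wf D = true → e.Safe Z s →
    e.compile.Fits (Z.V ^ D) σ
  | .const _, _, _, _ => trivial
  | .get t e, D, h, hs => by
    simp only [RE.wf, Bool.and_eq_true, decide_eq_true_eq] at h
    exact (WExp.eval_le_fits hV H.bdd _ h.1.2).2 D h.2
  | .op o x y, D, h, hs => by
    simp only [RE.wf, Bool.and_eq_true] at h
    refine ⟨RE.fits_compile h.1 hs.1, RE.fits_compile h.2 hs.2.1, fun ho => ?_⟩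
    rw [RE.eval_compile H h.2 hs.2.1]
    exact hs.2.2 ho

lemma TE.fits_compile {b : TE} {D : ℕ} (h : b.ok D = true) (hs : b.Safe Z s) :
    b.compile.Fits (Z.V ^ D) σ := by
  cases b <;> simp only [TE.ok, Bool.and_eq_true] at h
  · exact ⟨WE.fits_compile H hV h.1, WE.fits_compile H hV h.2⟩
  · exact ⟨RE.fits_compile H hV h.1 hs.1, RE.fits_compile H hV h.2 hs.2⟩

omit hV in
lemma TE.holds_compile {b : TE} {D : ℕ} (h : b.ok D = true) (hs : b.Safe Z s) :
    b.compile.Holds σ ↔ b.Holds s := by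
  cases b <;> simp only [TE.ok, WE.ok, Bool.and_eq_true] at h
  · simp only [TE.compile, Test.Holds, TE.Holds, WE.eval_compile H h.1.1.1,
      WE.eval_compile H h.2.1.1]
  · simp only [TE.compile, Test.Holds, TE.Holds, RE.eval_compile H h.1 hs.1,
      RE.eval_compile H h.2 hs.2]

omit hV in
lemma Repr.wset {t i v : ℕ} (ht : t < 64) (h2 : t ≠ 2) (hv : v ≤ Z.V) :
    Repr Z { σ with word := Function.update σ.word (t + 64 * i) v } (s.setW t i v) where
  word t' ht' i' := by
    simp only [Function.update_apply, Mem.setW]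
    rw [H.word t' ht' i']
    congr 1
    exact propext ⟨fun h => by omega, fun h => by omega⟩
  real := H.real
  io := H.io
  bdd a := by
    simp only [Function.update_apply]
    split_ifs
    exacts [hv, H.bdd a]
  base := by
    simp only [Function.update_apply]
    rw [if_neg (by omega), H.base]

omit hV in
lemma Repr.rset {t i : ℕ} {v : ℝ} (ht : t < 64) (h0 : t = 0 → i < Z.base) :
    Repr Z ⟨σ.word, Function.update σ.real (if t = 0 then i else Z.base + (t + 64 * i)) v⟩
      (s.setR t i v) where
  word := H.word
  real t' ht' h0' i' := by
    simp only [Function.update_apply, Mem.setR]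
    rw [H.real t' ht' h0' i']
    congr 1
    apply propext
    split_ifs with h
    · have := h0 h
      exact ⟨fun h => by omega, fun h => by omega⟩
    · exact ⟨fun h => by omega, fun h => by omega⟩
  io i' hi' := by
    simp only [Function.update_apply, Mem.setR]
    rw [H.io i' hi']
    congr 1
    apply propext
    split_ifs with h
    · exact ⟨fun h => by omega, fun h => by omega⟩
    · exact ⟨fun h => by omega, fun h => by omega⟩
  bdd := H.bdd
  base := H.base

lemma exec_wset {D t : ℕ} {i e : WE} (h : (SP.wset t i e).ok D = true) (hv : e.eval s ≤ Z.V) :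
    ∃ σ', Exec (Z.V ^ D) (SP.wset t i e).compile σ
      ((WE.addr t i.compile).cost + e.compile.cost + 1) σ' ∧
      Repr Z σ' (s.setW t (i.eval s) (e.eval s)) := by
  simp only [SP.ok, WE.ok, WE.wf, WE.compile, Bool.and_eq_true, decide_eq_true_eq,
    bne_iff_ne, ne_eq] at h
  obtain ⟨⟨⟨ht, h2⟩, ⟨⟨-, hi⟩, hsm⟩, hcost⟩, ⟨he, hesm⟩, hecost⟩ := h
  have hw := H.wset (i := i.eval s) ht h2 hv
  refine ⟨_, Exec.wset _ _ _ ?_ ((WExp.eval_le_fits hV H.bdd _ hesm).2 D hecost), ?_⟩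
  · have hcost' : (WE.addr t i.compile).cost + 1 ≤ D := of_decide_eq_true hcost
    exact (WExp.eval_le_fits hV H.bdd _ (by simpa [WExp.small] using hsm)).2 D (by omega)
  · simpa only [WE.addr, WExp.eval, WOp.apply, WE.eval_compile H hi, WE.eval_compile H he] using hw

end Compile

/-- Correctness of the compiler: what the calculus of weakest preconditions proves about a statement
holds for the machine program, with words bounded by `V ^ D` and time bounded by
`coef * k ^ kd * n ^ nd`. -/
theorem exec_compile (hV : 64 ≤ Z.V) (hk : 1 ≤ Z.k) (hn : 1 ≤ Z.n) {D : ℕ} :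
    ∀ {P : SP} {Q : Mem → Prop} {σ : State} {s : Mem}, P.ok D = true → Repr Z σ s → wp Z P Q s →
      ∃ T σ' s', Exec (Z.V ^ D) P.compile σ T σ' ∧ Repr Z σ' s' ∧ Q s' ∧
        T ≤ P.coef * (Z.k ^ P.kd * Z.n ^ P.nd) := by
  have pos : ∀ a b, 1 ≤ Z.k ^ a * Z.n ^ b := fun a b =>
    Nat.mul_pos (Nat.pow_pos (by omega)) (Nat.pow_pos (by omega))
  have mono : ∀ {a b a' b'}, a ≤ a' → b ≤ b' → Z.k ^ a * Z.n ^ b ≤ Z.k ^ a' * Z.n ^ b' :=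
    fun h h' => Nat.mul_le_mul (Nat.pow_le_pow_right hk h) (Nat.pow_le_pow_right hn h')
  intro P
  induction P with
  | skip =>
    intro Q σ s _ H hs
    exact ⟨1, σ, s, Exec.skip σ, H, hs, by simp [SP.coef, SP.kd, SP.nd]⟩
  | wset t i e =>
    intro Q σ s hok H hs
    obtain ⟨σ', h1, h2⟩ := exec_wset H hV hok hs.1
    exact ⟨_, σ', _, h1, h2, hs.2, by simp [SP.coef, SP.kd, SP.nd]⟩
  | rset t i e =>
    intro Q σ s hok H hs
    simp only [SP.ok, Bool.and_eq_true] at hok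
    have h1 := hok.1
    simp only [RE.wf, Bool.and_eq_true, decide_eq_true_eq] at h1
    obtain ⟨⟨⟨ht, hi⟩, hsm⟩, hcost⟩ := h1
    have hw := H.rset (i := i.eval s) (v := e.eval s) ht hs.2.1
    refine ⟨_, _, _, Exec.rset _ _ _ ((WExp.eval_le_fits hV H.bdd _ hsm).2 D hcost)
      (RE.fits_compile H hV hok.2 hs.1), ?_, hs.2.2, ?_⟩
    · convert hw using 3
      · unfold RE.addr
        split_ifs with h
        · exact WE.eval_compile H hi
        · simp only [WE.addr, WExp.eval, WOp.apply, WE.eval_compile H hi, H.base]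
      · exact RE.eval_compile H hok.2 hs.1
    · simp [SP.coef, SP.kd, SP.nd]
  | seq P P' ih ih' =>
    intro Q σ s hok H hs
    simp only [SP.ok, Bool.and_eq_true] at hok
    obtain ⟨T1, σ1, s1, e1, H1, q1, t1⟩ := ih hok.1 H hs
    obtain ⟨T2, σ2, s2, e2, H2, q2, t2⟩ := ih' hok.2 H1 q1
    refine ⟨T1 + T2, σ2, s2, Exec.seq e1 e2, H2, q2, ?_⟩
    simp only [SP.coef, SP.kd, SP.nd, add_mul]
    exact Nat.add_le_add
      (t1.trans (Nat.mul_le_mul_left _ (mono (le_max_left _ _) (le_max_left _ _))))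
      (t2.trans (Nat.mul_le_mul_left _ (mono (le_max_right _ _) (le_max_right _ _))))
  | ite b P P' ih ih' =>
    intro Q σ s hok H hs
    simp only [SP.ok, Bool.and_eq_true] at hok
    have hf := TE.fits_compile H hV hok.1.1 hs.1
    have hh := TE.holds_compile H hok.1.1 hs.1
    have hp := pos (max P.kd P'.kd) (max P.nd P'.nd)
    have hb : b.compile.cost ≤ b.compile.cost * (Z.k ^ max P.kd P'.kd * Z.n ^ max P.nd P'.nd) :=
      Nat.le_mul_of_pos_right _ hp
    by_cases hb' : b.Holds s
    · obtain ⟨T1, σ1, s1, e1, H1, q1, t1⟩ := ih hok.1.2 H (hs.2.1 hb')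
      refine ⟨_, σ1, s1, Exec.ite_true hf (hh.2 hb') e1, H1, q1, ?_⟩
      have := t1.trans (Nat.mul_le_mul_left P.coef
        (mono (le_max_left P.kd P'.kd) (le_max_left P.nd P'.nd)))
      simp only [SP.coef, SP.kd, SP.nd, add_mul]
      omega
    · obtain ⟨T1, σ1, s1, e1, H1, q1, t1⟩ := ih' hok.2 H (hs.2.2 hb')
      refine ⟨_, σ1, s1, Exec.ite_false hf (fun h => hb' (hh.1 h)) e1, H1, q1, ?_⟩
      have := t1.trans (Nat.mul_le_mul_left P'.coef
        (mono (le_max_right P.kd P'.kd) (le_max_right P.nd P'.nd)))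
      simp only [SP.coef, SP.kd, SP.nd, add_mul]
      omega
  | loop t bnd cf ka na P ih =>
    intro Q σ s hok H hs
    simp only [SP.ok, Bool.and_eq_true, decide_eq_true_eq, bne_iff_ne, ne_eq] at hok
    obtain ⟨⟨⟨⟨ht, h2⟩, hD⟩, hbnd⟩, hP⟩ := hok
    obtain ⟨N, I, h1, hNV, h3, h4, h5, h6⟩ := hs
    have ok0 : (SP.wset t (.const 0) (.const 0)).ok D = true := by
      simp [SP.ok, ht, h2, WE.ok, WE.wf, WE.compile, WE.addr, WExp.small, WExp.cost]
      omega
    have ok1 : (SP.wset t (.const 0) (.op .add (WE.var t) (.const 1))).ok D = true := by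
      simp [SP.ok, ht, h2, WE.ok, WE.var, WE.wf, WE.compile, WE.addr, WExp.small, WExp.cost]
      omega
    have okt : (TE.wlt (.var t) bnd).ok D = true := by
      simp only [TE.ok, hbnd, Bool.and_true]
      simp [ht, WE.ok, WE.var, WE.wf, WE.compile, WE.addr, WExp.small]
      exact ⟨by omega, by simp only [WExp.cost]; omega⟩
    set tc := (TE.wlt (.var t) bnd).compile.cost with htc
    set bt := P.coef * (Z.k ^ P.kd * Z.n ^ P.nd) with hbt
    -- the remaining rounds, by induction on their number
    have main : ∀ j, ∀ i, i + j = N → ∀ (σ : State) (s : Mem), Repr Z σ s → I i s →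
        ∃ T σ' s', Exec (Z.V ^ D) (.loop (TE.wlt (.var t) bnd).compile
          (.seq P.compile (SP.wset t (.const 0) (.op .add (WE.var t) (.const 1))).compile)) σ T σ' ∧
          Repr Z σ' s' ∧ I N s' ∧ T ≤ j * (tc + (bt + 20)) + tc := by
      intro j
      induction j with
      | zero =>
        intro i hi σ s H hI
        obtain ⟨hc, hb⟩ := h4 i (by omega) s hI
        refine ⟨tc, σ, s, Exec.loop_done (TE.fits_compile H hV okt trivial) ?_, H, ?_, by simp⟩
        · rw [TE.holds_compile H okt trivial]
          simp [hc, hb, ← hi]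
        · rwa [show N = i by omega]
      | succ j ihj =>
        intro i hi σ s H hI
        obtain ⟨hc, hb⟩ := h4 i (by omega) s hI
        obtain ⟨T1, σ1, s1, e1, H1, ⟨q1, q1'⟩, t1⟩ := ih hP H (h5 i (by omega) s hI)
        have hval : (WE.op .add (WE.var t) (.const 1)).eval s1 = i + 1 := by
          simp [WE.eval, WOp.apply, q1]
        obtain ⟨σ2, e2, H2⟩ := exec_wset H1 hV ok1 (by rw [hval]; omega)
        rw [hval] at H2
        obtain ⟨T3, σ3, s3, e3, H3, q3, t3⟩ := ihj (i + 1) (by omega) σ2 _ H2 q1'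
        refine ⟨_, σ3, s3, Exec.loop_step (TE.fits_compile H hV okt trivial) ?_
          (Exec.seq e1 e2) e3, H3, q3, ?_⟩
        · rw [TE.holds_compile H okt trivial]
          simp only [TE.holds_wlt, WE.eval_var, hc, hb]
          omega
        · have : (WE.addr t (WE.const 0).compile).cost +
              (WE.op .add (WE.var t) (.const 1)).compile.cost + 1 ≤ 20 := by
            simp [WE.addr, WE.compile, WE.var, WExp.cost]
          rw [Nat.succ_mul]
          omega
    obtain ⟨σ0, e0, H0⟩ := exec_wset H hV ok0 (by simp)
    obtain ⟨T, σ', s', e1, H1, q1, t1⟩ := main N 0 (by omega) σ0 _ H0 h3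
    refine ⟨_, σ', s', Exec.seq e0 e1, H1, h6 s' q1, ?_⟩
    have c0 : (WE.addr t (WE.const 0).compile).cost + (WE.const 0).compile.cost + 1 ≤ 10 := by
      simp [WE.addr, WE.compile, WExp.cost]
    have hp := pos (ka + P.kd) (na + P.nd)
    have hp' := pos P.kd P.nd
    have e5 : N * (tc + (bt + 20)) ≤
        cf * (tc + (P.coef + 20)) * (Z.k ^ (ka + P.kd) * Z.n ^ (na + P.nd)) := by
      calc N * (tc + (bt + 20)) ≤ (cf * Z.k ^ ka * Z.n ^ na) *
            ((tc + (P.coef + 20)) * (Z.k ^ P.kd * Z.n ^ P.nd)) := by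
            refine Nat.mul_le_mul h1 ?_
            rw [hbt]
            nlinarith
        _ = _ := by rw [pow_add, pow_add]; ring
    have e6 : 10 + tc ≤ (10 + tc) * (Z.k ^ (ka + P.kd) * Z.n ^ (na + P.nd)) :=
      Nat.le_mul_of_pos_right _ hp
    have e7 : (SP.loop t bnd cf ka na P).coef * (Z.k ^ (SP.loop t bnd cf ka na P).kd *
        Z.n ^ (SP.loop t bnd cf ka na P).nd) =
        cf * (tc + (P.coef + 20)) * (Z.k ^ (ka + P.kd) * Z.n ^ (na + P.nd)) +
        (10 + tc) * (Z.k ^ (ka + P.kd) * Z.n ^ (na + P.nd)) := by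
      simp only [SP.coef, SP.kd, SP.nd, add_mul]
      rfl
    omega

end RealRAM

/-! ### Points reachable with a given number of links -/

namespace LinkTour

/-- Carathéodory's theorem for cones generated by three vectors of the plane. -/
lemma exists_conic_comb_two (v : Fin 3 → Plane) (a : Fin 3 → ℝ) (ha : ∀ i, 0 ≤ a i) :
    ∃ (i : Fin 3) (b : Fin 3 → ℝ), (∀ j, 0 ≤ b j) ∧ b i = 0 ∧
      ∑ j, b j • v j = ∑ j, a j • v j := by
  have hdep : ¬ LinearIndependent ℝ v := fun h => by
    have := h.fintype_card_le_finrank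
    simp at this
  obtain ⟨g, hg, i0, hi0⟩ := Fintype.not_linearIndependent_iff.1 hdep
  -- the sign of the relation is chosen such that some coefficient is positive
  obtain ⟨h, hh, i1, hi1⟩ : ∃ h : Fin 3 → ℝ, ∑ i, h i • v i = 0 ∧ ∃ i, 0 < h i := by
    rcases lt_or_gt_of_ne hi0 with hlt | hgt
    · exact ⟨fun i => -g i, by simp [neg_smul, Finset.sum_neg_distrib, hg], i0, by simpa using hlt⟩
    · exact ⟨g, hg, i0, hgt⟩
  obtain ⟨i, hi, hmin⟩ := Finset.exists_min_image (Finset.univ.filter fun i => 0 < h i)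
    (fun i => a i / h i) ⟨i1, by simpa using hi1⟩
  simp only [Finset.mem_filter, Finset.mem_univ, true_and] at hi hmin
  have hq : 0 ≤ a i / h i := div_nonneg (ha i) hi.le
  refine ⟨i, fun j => a j - a i / h i * h j, fun j => ?_, ?_, ?_⟩
  · rcases lt_or_ge 0 (h j) with hj | hj
    · have := hmin j hj
      rw [le_div_iff₀ hj] at this
      linarith
    · have := ha j
      nlinarith [mul_nonneg hq (neg_nonneg.2 hj)]
  · simp [div_mul_cancel₀ _ hi.ne']
  · simp only [sub_smul, mul_smul, Finset.sum_sub_distrib, ← Finset.smul_sum, hh, smul_zero,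
      sub_zero]

/-- The determinant of two vectors of the plane. -/
def det2 (a b : Plane) : ℝ := a.1 * b.2 - a.2 * b.1

/-- The data of an instance in the form used by the algorithm: `k` orientations `dir c`, and
segments `0, …, n + 1` of which number `i` consists of the points `org i + τ • vec i` with
`1 ≤ τ ≤ 2`.  Segment `0` is the start and segment `n + 1` is the end of the tour. -/
structure Scene where
  k : ℕ
  n : ℕ
  dir : ℕ → Plane
  org : ℕ → Plane
  vec : ℕ → Plane

namespace Scene

variable (S : Scene)

/-- The point with parameter `τ` on the line of segment `i`. -/
def pt (i : ℕ) (τ : ℝ) : Plane := S.org i + τ • S.vec i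

/-- Segment `i`. -/
def seg (i : ℕ) : Set Plane := S.pt i '' Set.Icc 1 2

/-- What is used about the orientations and the segments. -/
structure Valid : Prop where
  vec_zero : S.vec 0 = 0
  spans : ∀ z : Plane, ∃ i < S.k, ∃ j < S.k, ∃ α β : ℝ, 0 ≤ α ∧ 0 ≤ β ∧
    z = α • S.dir i + β • S.dir j
  neg : ∀ j < S.k, ∃ j' < S.k, S.dir j' = -S.dir j
  inj : ∀ i < S.k, ∀ j < S.k, S.dir i = S.dir j → i = j
  par : ∀ i < S.k, ∀ j < S.k, det2 (S.dir i) (S.dir j) = 0 →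
    S.dir i = S.dir j ∨ S.dir i = -S.dir j
  dir_ne : ∀ j < S.k, S.dir j ≠ 0
  vec_dir : ∀ i ≤ S.n + 1, ∃ j < S.k, ∃ r : ℝ, 0 ≤ r ∧ S.vec i = r • S.dir j
  disj : ∀ i ≤ S.n, ∀ p ∈ S.seg i, p ∉ S.seg (i + 1)

/-- `Reach m i c q`: the point `q` of segment `i` can be reached from segment `0` by `m` links, of
which the last has orientation `c`, that visit the segments up to `i` in order.  Links may be
degenerate.  Between two consecutive visits the path makes at most one turn. -/
inductive Reach : ℕ → ℕ → ℕ → Plane → Prop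
  | start {c : ℕ} (hc : c < S.k) : Reach 1 0 c (S.pt 0 1)
  | push {m i c : ℕ} {p q : Plane} {α : ℝ} (hp : Reach m i c p) (hα : 0 ≤ α)
      (h : q = p + α • S.dir c) (hq : q ∈ S.seg (i + 1)) : Reach m (i + 1) c q
  | turn {m i d c : ℕ} {p q : Plane} {α β : ℝ} (hp : Reach m i d p) (hc : c < S.k) (hα : 0 ≤ α)
      (hβ : 0 ≤ β) (h : q = p + α • S.dir d + β • S.dir c) (hq : q ∈ S.seg (i + 1)) :
      Reach (m + 1) (i + 1) c q
  | deg {m i d c : ℕ} {q : Plane} (hq : Reach m i d q) (hc : c < S.k) : Reach (m + 1) i c q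

/-- `Ext m i c z`: the point `z` of the plane can be reached by `m` links, of which the last has
orientation `c`, after a visit of segment `i`, with at most one turn since then. -/
inductive Ext : ℕ → ℕ → ℕ → Plane → Prop
  | ray {m i c : ℕ} {p z : Plane} {α : ℝ} (hp : S.Reach m i c p) (hα : 0 ≤ α)
      (h : z = p + α • S.dir c) : Ext m i c z
  | turn {m i d c : ℕ} {p z : Plane} {α β : ℝ} (hp : S.Reach m i d p) (hc : c < S.k) (hα : 0 ≤ α)
      (hβ : 0 ≤ β) (h : z = p + α • S.dir d + β • S.dir c) : Ext (m + 1) i c z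
  | deg {m i d c : ℕ} {z : Plane} (hz : Ext m i d z) (hc : c < S.k) : Ext (m + 1) i c z

variable {S}

lemma Reach.lt_k {m i c : ℕ} {q : Plane} (h : S.Reach m i c q) : c < S.k := by
  induction h <;> assumption

lemma Reach.pos {m i c : ℕ} {q : Plane} (h : S.Reach m i c q) : 1 ≤ m := by
  induction h <;> omega

lemma Reach.mem_seg {m i c : ℕ} {q : Plane} (h : S.Reach m i c q) : q ∈ S.seg i := by
  induction h with
  | start hc => exact ⟨1, by norm_num, rfl⟩
  | push _ _ _ hq => exact hq
  | turn _ _ _ _ _ hq => exact hq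
  | deg _ _ ih => exact ih

lemma Ext.of_reach {m i c : ℕ} {q : Plane} (h : S.Reach m i c q) : S.Ext m i c q :=
  .ray h le_rfl (by simp)

lemma reach_succ_iff {m i c : ℕ} {q : Plane} :
    S.Reach m (i + 1) c q ↔ q ∈ S.seg (i + 1) ∧ S.Ext m i c q := by
  constructor
  · intro h
    refine ⟨h.mem_seg, ?_⟩
    generalize hi : i + 1 = i' at h
    induction h with
    | start => omega
    | push hp hα h _ =>
      obtain rfl : i = _ := Nat.succ_injective hi
      exact .ray hp hα h
    | turn hp hc hα hβ h _ =>
      obtain rfl : i = _ := Nat.succ_injective hi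
      exact .turn hp hc hα hβ h
    | deg _ hc ih => exact .deg (ih hi) hc
  · rintro ⟨hq, h⟩
    induction h with
    | ray hp hα h => exact .push hp hα h hq
    | turn hp hc hα hβ h => exact .turn hp hc hα hβ h hq
    | deg _ hc ih => exact .deg (ih hq) hc

lemma Reach.mono {m m' i c : ℕ} {q : Plane} (h : S.Reach m i c q) (hm : m ≤ m') :
    S.Reach m' i c q := by
  induction m', hm using Nat.le_induction with
  | base => exact h
  | succ m' _ ih => exact ih.deg h.lt_k

/-- A further link can always be added: of the three directions of two turns after a visit, two
suffice, and the direction that is dropped leaves a degenerate link. -/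
lemma Ext.link {m i d c : ℕ} {y z : Plane} {β : ℝ} (h : S.Ext m i d y) (hc : c < S.k) (hβ : 0 ≤ β)
    (hz : z = y + β • S.dir c) : S.Ext (m + 1) i c z := by
  induction h generalizing z with
  | ray hp hα h => exact .turn hp hc hα hβ (by rw [hz, h])
  | @turn m i d' d p y α γ hp hd hα hγ h =>
    obtain ⟨x, b, hb, hx, hsum⟩ := exists_conic_comb_two ![S.dir d', S.dir d, S.dir c] ![α, γ, β]
      (by intro j; fin_cases j <;> simp [hα, hγ, hβ])
    simp only [Fin.sum_univ_three, Matrix.cons_val_zero, Matrix.cons_val_one,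
      Matrix.cons_val] at hsum
    have hz' : z = p + (b 0 • S.dir d' + b 1 • S.dir d + b 2 • S.dir c) := by
      rw [hz, h, hsum]; abel
    fin_cases x
    · have hx' : b 0 = 0 := hx
      exact .turn (hp.deg hd) hc (hb 1) (hb 2) (by rw [hz', hx']; simp [add_assoc])
    · have hx' : b 1 = 0 := hx
      exact .turn (hp.deg hp.lt_k) hc (hb 0) (hb 2) (by rw [hz', hx']; simp [add_assoc])
    · have hx' : b 2 = 0 := hx
      exact .deg (.turn hp hd (hb 0) (hb 1) (by rw [hz', hx']; simp [add_assoc])) hc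
  | deg _ hc' ih => exact .deg (ih hz) hc

/-- The last link can be made longer. -/
lemma Ext.extend {m i c : ℕ} {y z : Plane} {β : ℝ} (h : S.Ext m i c y) (hβ : 0 ≤ β)
    (hz : z = y + β • S.dir c) : S.Ext m i c z := by
  cases h with
  | ray hp hα h => exact .ray hp (add_nonneg hα hβ) (by rw [hz, h, add_smul, add_assoc])
  | turn hp hc hα hγ h =>
    exact .turn hp hc hα (add_nonneg hγ hβ) (by rw [hz, h, add_smul, add_assoc])
  | deg hy hc => exact hy.link hc hβ hz

/-! ### The minimum number of links on each segment -/

/-- The minimum number of links with which segment `i` can be reached. -/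
noncomputable def mu (S : Scene) (i : ℕ) : ℕ := sInf {m | ∃ c q, S.Reach m i c q}

lemma mu_le {m i c : ℕ} {q : Plane} (h : S.Reach m i c q) : S.mu i ≤ m := Nat.sInf_le ⟨c, q, h⟩

section Valid
variable (hS : S.Valid)
include hS

lemma Valid.k_pos : 0 < S.k := by
  obtain ⟨i, hi, -⟩ := hS.spans 0
  omega

/-- Two links reach every point. -/
lemma Valid.reach_add_two {m i c : ℕ} {p q : Plane} (h : S.Reach m i c p) (hq : q ∈ S.seg (i + 1)) :
    ∃ d, S.Reach (m + 2) (i + 1) d q := by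
  obtain ⟨a, ha, b, hb, α, β, hα, hβ, hab⟩ := hS.spans (q - p)
  refine ⟨b, reach_succ_iff.2 ⟨hq, ?_⟩⟩
  have h1 : S.Ext (m + 1) i a (p + α • S.dir a) := (Ext.of_reach h).link ha hα rfl
  refine h1.link hb hβ ?_
  rw [add_assoc, ← hab]; abel

/-- Since the segments are oriented, one more link reaches every point of the same segment. -/
lemma Valid.reach_add_one {m i c : ℕ} {p q : Plane} (hi : i ≤ S.n + 1) (h : S.Reach m i c p)
    (hq : q ∈ S.seg i) : ∃ d, S.Reach (m + 1) i d q := by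
  obtain ⟨σ, -, rfl⟩ := h.mem_seg
  have hq' := hq
  obtain ⟨τ, -, rfl⟩ := hq
  obtain ⟨j, hj, r, hr, hv⟩ := hS.vec_dir i hi
  cases i with
  | zero =>
    refine ⟨c, ?_⟩
    have : S.pt 0 τ = S.pt 0 σ := by simp [pt, hS.vec_zero]
    rw [this]
    exact h.deg h.lt_k
  | succ i =>
    obtain ⟨-, he⟩ := reach_succ_iff.1 h
    obtain ⟨j', hj', hneg⟩ := hS.neg j hj
    rcases le_total σ τ with hle | hle
    · refine ⟨j, reach_succ_iff.2 ⟨hq', he.link hj (mul_nonneg (sub_nonneg.2 hle) hr) ?_⟩⟩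
      simp only [pt, hv, smul_smul, sub_mul, sub_smul]; abel
    · refine ⟨j', reach_succ_iff.2 ⟨hq', he.link hj' (mul_nonneg (sub_nonneg.2 hle) hr) ?_⟩⟩
      simp only [pt, hv, hneg, smul_smul, sub_mul, sub_smul, smul_neg]; abel

lemma Valid.exists_reach (i : ℕ) : ∃ m c q, S.Reach m i c q := by
  induction i with
  | zero => exact ⟨1, 0, _, .start hS.k_pos⟩
  | succ i ih =>
    obtain ⟨m, c, q, h⟩ := ih
    obtain ⟨d, hd⟩ := hS.reach_add_two h (q := S.pt (i + 1) 1) ⟨1, by norm_num, rfl⟩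
    exact ⟨_, d, _, hd⟩

lemma Valid.exists_reach_mu (i : ℕ) : ∃ c q, S.Reach (S.mu i) i c q := by
  obtain ⟨m, c, q, h⟩ := hS.exists_reach i
  exact Nat.sInf_mem (s := {m | ∃ c q, S.Reach m i c q}) ⟨m, c, q, h⟩

lemma Valid.mu_pos (i : ℕ) : 1 ≤ S.mu i := by
  obtain ⟨c, q, h⟩ := hS.exists_reach_mu i
  exact h.pos

lemma Valid.mu_zero : S.mu 0 = 1 :=
  le_antisymm (mu_le (.start hS.k_pos)) (hS.mu_pos 0)

lemma Valid.mu_succ_le (i : ℕ) : S.mu (i + 1) ≤ S.mu i + 2 := by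
  obtain ⟨c, q, h⟩ := hS.exists_reach_mu i
  obtain ⟨d, hd⟩ := hS.reach_add_two h (q := S.pt (i + 1) 1) ⟨1, by norm_num, rfl⟩
  exact mu_le hd

omit hS in
lemma Ext.exists_reach {m i c : ℕ} {z : Plane} (h : S.Ext m i c z) : ∃ d p, S.Reach m i d p := by
  induction h with
  | ray hp _ _ => exact ⟨_, _, hp⟩
  | turn hp hc _ _ _ => exact ⟨_, _, hp.deg hc⟩
  | deg _ hc ih =>
    obtain ⟨d, p, hp⟩ := ih
    exact ⟨_, _, hp.deg hc⟩

lemma Valid.mu_le_succ (i : ℕ) : S.mu i ≤ S.mu (i + 1) := by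
  obtain ⟨c, q, h⟩ := hS.exists_reach_mu (i + 1)
  obtain ⟨d, p, hp⟩ := (reach_succ_iff.1 h).2.exists_reach
  exact mu_le hp

/-- With one link more than the minimum, all points of the segment are reached. -/
lemma Valid.full_one {i : ℕ} (hi : i ≤ S.n + 1) {q : Plane} (hq : q ∈ S.seg i) :
    ∃ d, S.Reach (S.mu i + 1) i d q := by
  obtain ⟨c, p, h⟩ := hS.exists_reach_mu i
  exact hS.reach_add_one hi h hq

/-- With two links more than the minimum, all points of the segment are reached with any orientation
of the last link. -/
lemma Valid.full_two {i c : ℕ} (hi : i ≤ S.n + 1) (hc : c < S.k) {q : Plane} (hq : q ∈ S.seg i) :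
    S.Reach (S.mu i + 2) i c q := by
  obtain ⟨d, h⟩ := hS.full_one hi hq
  exact h.deg hc

/-- If the minimum increases by two, then the minimum suffices for all points of the segment. -/
lemma Valid.full_zero {i : ℕ} (h2 : S.mu (i + 1) = S.mu i + 2) {q : Plane}
    (hq : q ∈ S.seg (i + 1)) : ∃ d, S.Reach (S.mu (i + 1)) (i + 1) d q := by
  obtain ⟨c, p, h⟩ := hS.exists_reach_mu i
  rw [h2]
  exact hS.reach_add_two h hq

end Valid

/-! ### Paths with possibly degenerate links -/

variable (S)

/-- The path with vertices `v 0, …, v m` starts on segment `0`, and its link number `j` has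
orientation `κ j` and length `r j ≥ 0`. -/
structure Trail (m : ℕ) (v : ℕ → Plane) (κ : ℕ → ℕ) (r : ℕ → ℝ) : Prop where
  start : v 0 = S.pt 0 1
  lt_k : ∀ j < m, κ j < S.k
  len : ∀ j < m, 0 ≤ r j
  step : ∀ j < m, v (j + 1) = v j + r j • S.dir (κ j)

/-- The path visits the segments `1, …, i` in order; the visit of segment `i'` is on link `J i'` at
distance `X i'` from its initial vertex. -/
structure Visits (m i : ℕ) (v : ℕ → Plane) (κ : ℕ → ℕ) (r : ℕ → ℝ) (J : ℕ → ℕ) (X : ℕ → ℝ) :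
    Prop where
  lt : ∀ i', 1 ≤ i' → i' ≤ i → J i' < m
  nonneg : ∀ i', 1 ≤ i' → i' ≤ i → 0 ≤ X i'
  le : ∀ i', 1 ≤ i' → i' ≤ i → X i' ≤ r (J i')
  mem : ∀ i', 1 ≤ i' → i' ≤ i → v (J i') + X i' • S.dir (κ (J i')) ∈ S.seg i'
  mono : ∀ i' i'', 1 ≤ i' → i' < i'' → i'' ≤ i → J i' < J i'' ∨ (J i' = J i'' ∧ X i' ≤ X i'')

variable {S}

/-- Completeness of `Reach` for paths, for a numbering `cnt` of the links under which consecutive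
links may share a number as long as the path continues in the orientation `κ'`. -/
lemma ext_of_visits {m N : ℕ} {v : ℕ → Plane} {κ : ℕ → ℕ} {r : ℕ → ℝ} {J : ℕ → ℕ} {X : ℕ → ℝ}
    (ht : S.Trail m v κ r) (hv : S.Visits m N v κ r J X) (cnt κ' : ℕ → ℕ)
    (h0 : ∀ x, 0 ≤ x → x ≤ r 0 → S.Ext (cnt 0) 0 (κ' 0) (v 0 + x • S.dir (κ 0)))
    (hstep : ∀ i j, j + 1 < m → S.Ext (cnt j) i (κ' j) (v (j + 1)) → ∀ x, 0 ≤ x → x ≤ r (j + 1) →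
      S.Ext (cnt (j + 1)) i (κ' (j + 1)) (v (j + 1) + x • S.dir (κ (j + 1))))
    (hcont : ∀ i j y x, j < m → 0 ≤ y → y ≤ x → x ≤ r j →
      S.Reach (cnt j) i (κ' j) (v j + y • S.dir (κ j)) →
      S.Ext (cnt j) i (κ' j) (v j + x • S.dir (κ j))) :
    ∀ i ≤ N, ∀ j < m, (1 ≤ i → J i ≤ j) → ∀ x, 0 ≤ x → x ≤ r j → (1 ≤ i → J i = j → X i ≤ x) →
      S.Ext (cnt j) i (κ' j) (v j + x • S.dir (κ j)) := by
  intro i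
  induction i with
  | zero =>
    intro _ j
    induction j with
    | zero => exact fun _ _ x hx hx' _ => h0 x hx hx'
    | succ j ih =>
      intro hj _ x hx hx' _
      refine hstep 0 j hj ?_ x hx hx'
      rw [ht.step j (by omega)]
      exact ih (by omega) (by omega) (r j) (ht.len j (by omega)) le_rfl (by omega)
  | succ i ih =>
    intro hi j hj hJ
    have h1 : 1 ≤ i + 1 := by omega
    have hJ' := hJ h1
    clear hJ
    induction j, hJ' using Nat.le_induction with
    | base =>
      intro x hx hx' hX
      refine hcont (i + 1) _ (X (i + 1)) x hj (hv.nonneg _ h1 hi) (hX h1 rfl) hx' ?_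
      refine reach_succ_iff.2 ⟨hv.mem _ h1 hi, ?_⟩
      refine ih (by omega) _ hj (fun h => ?_) _ (hv.nonneg _ h1 hi) (hv.le _ h1 hi) (fun h he => ?_)
      · rcases hv.mono i (i + 1) h (by omega) hi with h' | h' <;> omega
      · rcases hv.mono i (i + 1) h (by omega) hi with h' | h'
        · omega
        · exact h'.2
    | succ j hJ ihj =>
      intro x hx hx' _
      refine hstep (i + 1) j hj ?_ x hx hx'
      rw [ht.step j (by omega)]
      refine ihj (by omega) (r j) (ht.len j (by omega)) le_rfl fun _ he => ?_
      rw [← he]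
      exact hv.le _ h1 hi

/-- Every path is covered by `Reach`. -/
lemma reach_of_visits {m N : ℕ} {v : ℕ → Plane} {κ : ℕ → ℕ} {r : ℕ → ℝ} {J : ℕ → ℕ} {X : ℕ → ℝ}
    (ht : S.Trail m v κ r) (hv : S.Visits m (N + 1) v κ r J X) :
    ∃ c q, S.Reach m (N + 1) c q := by
  have h1 : 1 ≤ N + 1 := by omega
  have hJ := hv.lt _ h1 le_rfl
  have key := ext_of_visits ht hv (fun j => j + 1) κ
    (fun x hx _ => .ray (.start (ht.lt_k 0 (by omega))) hx (by rw [ht.start]))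
    (fun i j hj h x hx _ => h.link (ht.lt_k _ hj) hx rfl)
    (fun i j y x hj hy hyx _ h => .ray h (sub_nonneg.2 hyx) (by rw [sub_smul]; abel))
    (N + 1) le_rfl _ hJ (fun _ => le_rfl) _ (hv.nonneg _ h1 le_rfl) (hv.le _ h1 le_rfl)
    (fun _ _ => le_rfl)
  obtain ⟨d, p, hp⟩ := key.exists_reach
  exact ⟨d, p, hp.mono hJ⟩

/-- A path with a degenerate link can do with one link less. -/
lemma reach_of_visits_of_degenerate {m N : ℕ} {v : ℕ → Plane} {κ : ℕ → ℕ} {r : ℕ → ℝ} {J : ℕ → ℕ}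
    {X : ℕ → ℝ} (ht : S.Trail m v κ r) (hv : S.Visits m (N + 1) v κ r J X) (hm : 2 ≤ m) {j₀ : ℕ}
    (hj₀ : j₀ < m) (hr : r j₀ = 0) : ∃ c q, S.Reach (m - 1) (N + 1) c q := by
  have h1 : 1 ≤ N + 1 := by omega
  have hJ := hv.lt _ h1 le_rfl
  have cont : ∀ (m' i c : ℕ) (z : Plane) (y x : ℝ), y ≤ x →
      S.Reach m' i c (z + y • S.dir c) → S.Ext m' i c (z + x • S.dir c) :=
    fun m' i c z y x hyx h => .ray h (sub_nonneg.2 hyx) (by rw [sub_smul]; abel)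
  have triv : ∀ (z : Plane) (x : ℝ) (c : ℕ), 0 ≤ x → x ≤ r j₀ → z + x • S.dir c = z := by
    intro z x c hx hx'
    have : x = 0 := le_antisymm (hr ▸ hx') hx
    simp [this]
  rcases Nat.eq_zero_or_pos j₀ with hz | hpos
  · subst hz
    have key := ext_of_visits ht hv (fun j => if j = 0 then 1 else j)
      (fun j => if j = 0 then κ 1 else κ j)
      (fun x hx hx' => by
        rw [triv _ x _ hx hx']
        exact .of_reach (by rw [ht.start]; exact .start (ht.lt_k 1 (by omega))))
      (fun i j hj h x hx _ => by
        rcases Nat.eq_zero_or_pos j with rfl | hj'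
        · exact Ext.extend (by simpa using h) hx rfl
        · simp only [hj'.ne', if_false, Nat.succ_ne_zero] at h ⊢
          exact h.link (ht.lt_k _ hj) hx rfl)
      (fun i j y x hj hy hyx hx h => by
        rcases Nat.eq_zero_or_pos j with rfl | hj'
        · rw [triv _ y _ hy (hyx.trans hx)] at h
          rw [triv _ x _ (hy.trans hyx) hx]
          exact .of_reach h
        · simp only [hj'.ne', if_false] at h ⊢
          exact cont _ _ _ _ _ _ hyx h)
      (N + 1) le_rfl _ hJ (fun _ => le_rfl) _ (hv.nonneg _ h1 le_rfl) (hv.le _ h1 le_rfl)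
      (fun _ _ => le_rfl)
    obtain ⟨d, p, hp⟩ := key.exists_reach
    exact ⟨d, p, hp.mono (by split_ifs <;> omega)⟩
  · have key := ext_of_visits ht hv (fun j => if j < j₀ then j + 1 else j)
      (fun j => if j = j₀ then κ (j₀ - 1) else κ j)
      (fun x hx _ => by
        simp only [hpos, if_true, hpos.ne, if_false]
        exact .ray (.start (ht.lt_k 0 (by omega))) hx (by rw [ht.start]))
      (fun i j hj h x hx hx' => by
        rcases lt_trichotomy (j + 1) j₀ with hlt | heq | hgt
        · simp only [hlt, show j < j₀ by omega, hlt.ne, show j ≠ j₀ by omega, if_true, if_false]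
            at h ⊢
          exact h.link (ht.lt_k _ hj) hx rfl
        · rw [heq] at hx'
          rw [triv _ x _ hx hx']
          simp only [← heq, lt_irrefl, if_true, if_false, Nat.lt_succ_self, Nat.add_sub_cancel, (Nat.succ_ne_self j).symm] at h ⊢
          exact h
        · simp only [show ¬ (j + 1 < j₀) by omega, show ¬ (j < j₀) by omega,
            show j + 1 ≠ j₀ by omega, if_false] at h ⊢
          exact h.link (ht.lt_k _ hj) hx rfl)
      (fun i j y x hj hy hyx hx h => by
        by_cases heq : j = j₀
        · subst heq
          rw [triv _ y _ hy (hyx.trans hx)] at h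
          rw [triv _ x _ (hy.trans hyx) hx]
          exact .of_reach h
        · simp only [heq, if_false] at h ⊢
          exact cont _ _ _ _ _ _ hyx h)
      (N + 1) le_rfl _ hJ (fun _ => le_rfl) _ (hv.nonneg _ h1 le_rfl) (hv.le _ h1 le_rfl)
      (fun _ _ => le_rfl)
    obtain ⟨d, p, hp⟩ := key.exists_reach
    exact ⟨d, p, hp.mono (by split_ifs <;> omega)⟩

variable (S)

/-- The path with vertices `u 0, …, u (m - 1), q` has `m ≥ 1` links, the last of orientation `c`, and
visits the segments `1, …, i` in order. -/
def Pre (m i c : ℕ) (q : Plane) (u : ℕ → Plane) : Prop :=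
  1 ≤ m ∧ ∃ κ r J X, S.Trail m (Function.update u m q) κ r ∧ κ (m - 1) = c ∧
    S.Visits m i (Function.update u m q) κ r J X

variable {S}

lemma Pre.congr {m i c : ℕ} {q : Plane} {u u' : ℕ → Plane} (h : S.Pre m i c q u)
    (hu : ∀ j < m, u' j = u j) : S.Pre m i c q u' := by
  obtain ⟨hm, κ, r, J, X, ht, hc, hv⟩ := h
  have e : ∀ j ≤ m, Function.update u' m q j = Function.update u m q j := by
    intro j hj
    rcases hj.lt_or_eq with h | rfl
    · simp [Function.update_of_ne h.ne, hu j h]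
    · simp
  refine ⟨hm, κ, r, J, X, ⟨by rw [e 0 (by omega), ht.start], ht.lt_k, ht.len, fun j hj => ?_⟩, hc,
    ⟨hv.lt, hv.nonneg, hv.le, fun i' h1 h2 => ?_, hv.mono⟩⟩
  · rw [e _ hj, e _ hj.le, ht.step j hj]
  · rw [e _ (hv.lt i' h1 h2).le]
    exact hv.mem i' h1 h2

lemma Pre.start {c : ℕ} (hc : c < S.k) {u : ℕ → Plane} (hu : u 0 = S.pt 0 1) :
    S.Pre 1 0 c (S.pt 0 1) u := by
  refine ⟨le_rfl, fun _ => c, fun _ => 0, fun _ => 0, fun _ => 0, ⟨by simp [hu], fun _ _ => hc,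
    fun _ _ => le_rfl, fun j hj => ?_⟩, rfl, ⟨?_, ?_, ?_, ?_, ?_⟩⟩
  · obtain rfl : j = 0 := by omega
    simp [hu]
  all_goals intros; omega

lemma Pre.extend {m i c : ℕ} {p q : Plane} {u : ℕ → Plane} {α : ℝ} (h : S.Pre m i c p u)
    (hα : 0 ≤ α) (hq : q = p + α • S.dir c) : S.Pre m i c q u := by
  obtain ⟨hm, κ, r, J, X, ht, hc, hv⟩ := h
  obtain ⟨m, rfl⟩ : ∃ m', m = m' + 1 := ⟨m - 1, by omega⟩
  simp only [Nat.add_sub_cancel] at hc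
  have e : ∀ j < m + 1, Function.update u (m + 1) q j = Function.update u (m + 1) p j :=
    fun j hj => by simp [Function.update_of_ne hj.ne]
  refine ⟨hm, κ, Function.update r m (r m + α), J, X,
    ⟨by rw [e 0 (by omega), ht.start], ht.lt_k, fun j hj => ?_, fun j hj => ?_⟩, by simpa using hc,
    ⟨hv.lt, hv.nonneg, fun i' h1 h2 => ?_, fun i' h1 h2 => ?_, hv.mono⟩⟩
  · by_cases hjm : j = m
    · subst hjm
      have := ht.len j hj
      simp only [Function.update_self]
      linarith
    · simpa [hjm] using ht.len j hj
  · have := ht.step j hj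
    by_cases hjm : j = m
    · subst hjm
      rw [e j hj]
      simp only [Function.update_self] at this ⊢
      rw [hc] at this ⊢
      rw [hq, add_smul, ← add_assoc, ← this]
    · rw [e j hj, e (j + 1) (by omega), this]
      simp [hjm]
  · have h3 := hv.le i' h1 h2
    by_cases hjm : J i' = m
    · rw [hjm] at h3 ⊢
      simp only [Function.update_self]
      linarith
    · simpa [hjm] using h3
  · rw [e _ (hv.lt i' h1 h2)]
    exact hv.mem i' h1 h2

lemma Pre.link {m i d c : ℕ} {p q : Plane} {u : ℕ → Plane} {β : ℝ} (h : S.Pre m i d p u)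
    (hc : c < S.k) (hβ : 0 ≤ β) (hq : q = p + β • S.dir c) :
    S.Pre (m + 1) i c q (Function.update u m p) := by
  obtain ⟨hm, κ, r, J, X, ht, -, hv⟩ := h
  have e : ∀ j ≤ m, Function.update (Function.update u m p) (m + 1) q j =
      Function.update u m p j := fun j hj => by
    simp [Function.update_of_ne (show j ≠ m + 1 by omega)]
  refine ⟨by omega, Function.update κ m c, Function.update r m β, J, X,
    ⟨by rw [e 0 (by omega), ht.start], fun j hj => ?_, fun j hj => ?_, fun j hj => ?_⟩, by simp,
    ⟨fun i' h1 h2 => (hv.lt i' h1 h2).trans (Nat.lt_succ_self m), hv.nonneg,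
      fun i' h1 h2 => ?_, fun i' h1 h2 => ?_, hv.mono⟩⟩
  · by_cases hjm : j = m
    · simpa [hjm] using hc
    · simpa [hjm] using ht.lt_k j (by omega)
  · by_cases hjm : j = m
    · simpa [hjm] using hβ
    · simpa [hjm] using ht.len j (by omega)
  · by_cases hjm : j = m
    · subst hjm
      rw [e j le_rfl]
      simpa using hq
    · rw [e j (by omega), e (j + 1) (by omega), ht.step j (by omega)]
      simp [hjm]
  · have := hv.lt i' h1 h2
    simpa [this.ne] using hv.le i' h1 h2
  · have := hv.lt i' h1 h2
    rw [e _ this.le]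
    simpa [this.ne] using hv.mem i' h1 h2

lemma Pre.visit {m i c : ℕ} {q : Plane} {u : ℕ → Plane} (h : S.Pre m i c q u)
    (hq : q ∈ S.seg (i + 1)) : S.Pre m (i + 1) c q u := by
  obtain ⟨hm, κ, r, J, X, ht, hc, hv⟩ := h
  obtain ⟨m, rfl⟩ : ∃ m', m = m' + 1 := ⟨m - 1, by omega⟩
  refine ⟨hm, κ, r, Function.update J (i + 1) m, Function.update X (i + 1) (r m), ht, hc,
    ⟨fun i' h1 h2 => ?_, fun i' h1 h2 => ?_, fun i' h1 h2 => ?_, fun i' h1 h2 => ?_,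
      fun i' i'' h1 h2 h3 => ?_⟩⟩
  · by_cases hi : i' = i + 1
    · simp [hi]
    · simpa [hi] using hv.lt i' h1 (by omega)
  · by_cases hi : i' = i + 1
    · simpa [hi] using ht.len m (by omega)
    · simpa [hi] using hv.nonneg i' h1 (by omega)
  · by_cases hi : i' = i + 1
    · simp [hi]
    · simpa [hi] using hv.le i' h1 (by omega)
  · by_cases hi : i' = i + 1
    · subst hi
      have := ht.step m (by omega)
      rw [Function.update_self, Function.update_self, ← this]
      simpa using hq
    · rw [Function.update_of_ne hi, Function.update_of_ne hi]
      exact hv.mem i' h1 (by omega)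
  · rw [Function.update_of_ne (show i' ≠ i + 1 by omega),
      Function.update_of_ne (show i' ≠ i + 1 by omega)]
    by_cases hi : i'' = i + 1
    · have h4 := hv.lt i' h1 (by omega)
      have h5 := hv.le i' h1 (by omega)
      rw [hi, Function.update_self, Function.update_self]
      rcases Nat.lt_succ_iff_lt_or_eq.1 h4 with h6 | h6
      · exact Or.inl h6
      · exact Or.inr ⟨h6, h6 ▸ h5⟩
    · simpa [hi] using hv.mono i' i'' h1 h2 (by omega)

end Scene
end LinkTour

/-! ### The scene of an input -/

namespace LinkTour

open Scene

section Input

variable {k n : ℕ} (C : Fin k → Plane) (E : Fin n → Plane × Plane) (s t : Plane)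

/-- The scene of an input.  The parametrization of the segment with endpoints `a`, `b` is
`(2 a - b) + τ (b - a)`. -/
noncomputable def sceneOf : Scene where
  k := k
  n := n
  dir j := if h : j < k then C ⟨j, h⟩ else 0
  org i := if i = 0 then s else if h : i - 1 < n then
    (2 : ℝ) • (E ⟨i - 1, h⟩).1 - (E ⟨i - 1, h⟩).2 else t
  vec i := if i = 0 then 0 else if h : i - 1 < n then
    (E ⟨i - 1, h⟩).2 - (E ⟨i - 1, h⟩).1 else 0

lemma sceneOf_dir (j : Fin k) : (sceneOf C E s t).dir j = C j := by
  simp [sceneOf]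

lemma sceneOf_pt_zero (τ : ℝ) : (sceneOf C E s t).pt 0 τ = s := by
  simp [Scene.pt, sceneOf]

lemma sceneOf_pt_last (τ : ℝ) : (sceneOf C E s t).pt (n + 1) τ = t := by
  simp [Scene.pt, sceneOf]

lemma sceneOf_seg_zero : (sceneOf C E s t).seg 0 = {s} := by
  ext p
  simp only [Scene.seg, sceneOf_pt_zero, Set.mem_image, Set.mem_singleton_iff]
  exact ⟨fun ⟨_, _, h⟩ => h.symm, fun h => ⟨1, by norm_num, h.symm⟩⟩

lemma sceneOf_seg_last : (sceneOf C E s t).seg (n + 1) = {t} := by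
  ext p
  simp only [Scene.seg, sceneOf_pt_last, Set.mem_image, Set.mem_singleton_iff]
  exact ⟨fun ⟨_, _, h⟩ => h.symm, fun h => ⟨1, by norm_num, h.symm⟩⟩

lemma sceneOf_seg (i : Fin n) : (sceneOf C E s t).seg (i + 1) = points (E i) := by
  ext p
  rw [points, segment_eq_image', Scene.seg]
  have e : ∀ τ : ℝ, (sceneOf C E s t).pt (i + 1) τ =
      (E i).1 + (τ - 1) • ((E i).2 - (E i).1) := fun τ => by
    simp only [Scene.pt, sceneOf, Nat.succ_ne_zero, if_false, Nat.add_sub_cancel, i.2, dif_pos]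
    module
  simp only [e, Set.mem_image, Set.mem_Icc]
  exact ⟨fun ⟨τ, h, h'⟩ => ⟨τ - 1, ⟨by linarith, by linarith⟩, h'⟩,
    fun ⟨τ, h, h'⟩ => ⟨τ + 1, ⟨by linarith, by linarith⟩, by simpa using h'⟩⟩

variable {C E s t}
variable (hn : 1 ≤ n) (hC : IsOrientationSet C)
  (hE : ∀ i, ∃ j, HasOrientation (E i).1 (E i).2 (C j))
  (hdisj : ∀ i i', i ≠ i' → Disjoint (points (E i)) (points (E i')))
  (hs : ∀ i, s ∉ points (E i)) (ht : ∀ i, t ∉ points (E i))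

include hn hC hE hdisj hs ht in
lemma sceneOf_valid : (sceneOf C E s t).Valid where
  vec_zero := by simp [sceneOf]
  spans z := by
    obtain ⟨i, j, α, β, hα, hβ, h⟩ := hC.spans 0 z
    refine ⟨i, i.2, j, j.2, α, β, hα, hβ, ?_⟩
    simpa [sceneOf_dir] using h
  neg j hj := by
    obtain ⟨j', h⟩ := hC.symmetric ⟨j, hj⟩
    refine ⟨j', j'.2, ?_⟩
    rw [sceneOf_dir, h]
    exact congrArg _ (sceneOf_dir C E s t ⟨j, hj⟩).symm
  inj i hi j hj h := by
    have h1 := sceneOf_dir C E s t ⟨i, hi⟩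
    have h2 := sceneOf_dir C E s t ⟨j, hj⟩
    have := hC.injective ((h1.symm.trans h).trans h2)
    exact Fin.mk.inj_iff.1 this
  par i hi j hj h := by
    have h1 := hC.unit ⟨i, hi⟩
    have h2 := hC.unit ⟨j, hj⟩
    rw [← sceneOf_dir C E s t] at h1 h2
    simp only at h1 h2
    generalize (sceneOf C E s t).dir i = a at h h1
    generalize (sceneOf C E s t).dir j = b at h h2
    obtain ⟨a1, a2⟩ := a
    obtain ⟨b1, b2⟩ := b
    simp only [det2] at h h1 h2
    have h3 : (a1 * b1 + a2 * b2 - 1) * (a1 * b1 + a2 * b2 + 1) = 0 := by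
      linear_combination (b1 ^ 2 + b2 ^ 2) * h1 + h2 - (a1 * b2 - a2 * b1) * h
    rcases mul_eq_zero.1 h3 with h4 | h4
    · left
      have h5 : (a1 - b1) ^ 2 + (a2 - b2) ^ 2 = 0 := by linear_combination h1 + h2 - 2 * h4
      ext
      · nlinarith [sq_nonneg (a1 - b1), sq_nonneg (a2 - b2)]
      · nlinarith [sq_nonneg (a1 - b1), sq_nonneg (a2 - b2)]
    · right
      have h5 : (a1 + b1) ^ 2 + (a2 + b2) ^ 2 = 0 := by linear_combination h1 + h2 + 2 * h4
      ext
      · change a1 = -b1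
        nlinarith [sq_nonneg (a1 + b1), sq_nonneg (a2 + b2)]
      · change a2 = -b2
        nlinarith [sq_nonneg (a1 + b1), sq_nonneg (a2 + b2)]
  dir_ne j hj h := by
    have h1 := sceneOf_dir C E s t ⟨j, hj⟩
    have h2 := hC.unit ⟨j, hj⟩
    have h3 : C ⟨j, hj⟩ = 0 := h1.symm.trans h
    simp [h3] at h2
  vec_dir i _ := by
    have hk : 0 < k := by
      obtain ⟨i, -⟩ := hC.spans 0 0
      exact i.pos
    by_cases h0 : i = 0
    · exact ⟨0, hk, 0, le_rfl, by simp [sceneOf, h0]⟩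
    · by_cases h : i - 1 < n
      · obtain ⟨j, r, hr, hj⟩ := hE ⟨i - 1, h⟩
        refine ⟨j, j.2, r, hr.le, ?_⟩
        rw [sceneOf_dir, ← hj]
        simp [sceneOf, h0, h]
      · exact ⟨0, hk, 0, le_rfl, by simp [sceneOf, h0, h]⟩
  disj i hi p hp hp' := by
    change i ≤ n at hi
    rcases Nat.eq_zero_or_pos i with rfl | hpos
    · rw [sceneOf_seg_zero] at hp
      rw [zero_add, show 1 = ((⟨0, hn⟩ : Fin n) : ℕ) + 1 from rfl, sceneOf_seg] at hp'
      obtain rfl : p = s := hp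
      exact hs _ hp'
    · obtain ⟨i, rfl⟩ : ∃ i', i = i' + 1 := ⟨i - 1, by omega⟩
      have hp2 := sceneOf_seg C E s t ⟨i, by omega⟩
      simp only at hp2
      rw [hp2] at hp
      by_cases h : i + 1 < n
      · have hp3 := sceneOf_seg C E s t ⟨i + 1, h⟩
        simp only at hp3
        rw [hp3] at hp'
        exact Set.disjoint_left.1 (hdisj ⟨i, by omega⟩ ⟨i + 1, h⟩ (by simp)) hp hp'
      · obtain rfl : n = i + 1 := by omega
        rw [sceneOf_seg_last] at hp'
        obtain rfl : p = t := hp'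
        exact ht _ hp

omit hn in
/-- Every oriented tour has at least as many links as the minimum with which the end is reached. -/
lemma mu_le_of_isTour {m : ℕ} {v : ℕ → Plane} (hn : 1 ≤ n) (hv : IsTour E s t m v)
    (ho : IsOriented C m v) : (sceneOf C E s t).mu (n + 1) ≤ m := by
  obtain ⟨hv0, hvm, j, τ, hj, hmono⟩ := hv
  have hm : 0 < m := (Nat.zero_le _).trans_lt (hj ⟨0, hn⟩).1
  have hstep : ∀ l, ∃ (c : ℕ) (r : ℝ), l < m → c < k ∧ 0 < r ∧
      v (l + 1) = v l + r • (sceneOf C E s t).dir c := by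
    intro l
    by_cases hl : l < m
    · obtain ⟨c, r, hr, h⟩ := ho l hl
      refine ⟨c, r, fun _ => ⟨c.2, hr, ?_⟩⟩
      rw [sceneOf_dir, ← h]; abel
    · exact ⟨0, 0, fun h => absurd h hl⟩
  choose κ r hκr using hstep
  have hT : (sceneOf C E s t).Trail m v κ r :=
    ⟨by rw [hv0, sceneOf_pt_zero], fun l hl => (hκr l hl).1, fun l hl => (hκr l hl).2.1.le,
      fun l hl => (hκr l hl).2.2⟩
  set J : ℕ → ℕ := fun i => if h : i - 1 < n then j ⟨i - 1, h⟩ else m - 1 with hJ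
  set X : ℕ → ℝ := fun i => if h : i - 1 < n then τ ⟨i - 1, h⟩ * r (j ⟨i - 1, h⟩)
    else r (m - 1) with hX
  have hV : (sceneOf C E s t).Visits m (n + 1) v κ r J X := by
    refine ⟨fun i h1 h2 => ?_, fun i h1 h2 => ?_, fun i h1 h2 => ?_, fun i h1 h2 => ?_,
      fun i i' h1 h2 h3 => ?_⟩
    · simp only [hJ]
      split_ifs with h
      · exact (hj _).1
      · omega
    · simp only [hX]
      split_ifs with h
      · exact mul_nonneg (hj _).2.1 (hT.len _ (hj _).1)
      · exact hT.len _ (by omega)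
    · simp only [hX, hJ]
      split_ifs with h
      · exact mul_le_of_le_one_left (hT.len _ (hj _).1) (hj _).2.2.1
      · exact le_rfl
    · simp only [hX, hJ]
      split_ifs with h
      · obtain ⟨h4, h5, h6, h7⟩ := hj ⟨i - 1, h⟩
        have := sceneOf_seg C E s t ⟨i - 1, h⟩
        simp only [Nat.sub_add_cancel h1] at this
        rw [this]
        convert h7 using 1
        rw [AffineMap.lineMap_apply_module', hT.step _ h4, add_sub_cancel_left, smul_smul, add_comm]
      · obtain rfl : i = n + 1 := by omega
        rw [sceneOf_seg_last, ← hT.step _ (by omega), Nat.sub_add_cancel hm]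
        exact hvm
    · simp only [hX, hJ, show i - 1 < n by omega, dif_pos]
      split_ifs with h
      · rcases hmono ⟨i - 1, by omega⟩ ⟨i' - 1, h⟩ (by simp only [Fin.mk_lt_mk]; omega) with h4 | h4
        · exact Or.inl h4
        · refine Or.inr ⟨h4.1, ?_⟩
          rw [h4.1]
          exact mul_le_mul_of_nonneg_right h4.2.le (hT.len _ (hj _).1)
      · obtain ⟨h4, h5, h6, h7⟩ := hj ⟨i - 1, by omega⟩
        rcases (Nat.le_sub_one_of_lt h4).lt_or_eq with h8 | h8
        · exact Or.inl h8
        · refine Or.inr ⟨h8, ?_⟩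
          rw [← h8]
          exact mul_le_of_le_one_left (hT.len _ h4) h6
  obtain ⟨c, q, h⟩ := reach_of_visits hT hV
  exact mu_le h

include hn hC hE hdisj hs ht in
/-- A path to the end with the minimum number of links is a minimum-link tour: it has no degenerate
link, since such a link could be dropped. -/
lemma isMinLinkTour_of_pre {m c : ℕ} {v : ℕ → Plane} (hm : m = (sceneOf C E s t).mu (n + 1))
    (hv : v m = t) (h : (sceneOf C E s t).Pre m (n + 1) c t v) : IsMinLinkTour C E s t m v := by
  have hS := sceneOf_valid hn hC hE hdisj hs ht
  obtain ⟨h1m, κ, r, J, X, hT, -, hV⟩ := h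
  have hu : Function.update v m t = v := by rw [← hv, Function.update_eq_self]
  rw [hu] at hT hV
  have hpos : ∀ j < m, 0 < r j := by
    intro j hj
    refine lt_of_le_of_ne (hT.len j hj) fun h0 => ?_
    rcases h1m.lt_or_eq with h2 | rfl
    · obtain ⟨d, q, hq⟩ := reach_of_visits_of_degenerate hT hV h2 hj h0.symm
      have := mu_le hq
      omega
    · obtain rfl : j = 0 := by omega
      have h3 : J 1 = 0 := by have := hV.lt 1 le_rfl (by omega); omega
      have h4 := hV.le 1 le_rfl (by omega)
      have h5 := hV.nonneg 1 le_rfl (by omega)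
      have h6 := hV.mem 1 le_rfl (by omega)
      rw [h3] at h4 h6
      rw [le_antisymm (h0 ▸ h4) h5, zero_smul, add_zero, hT.start] at h6
      exact hS.disj 0 (Nat.zero_le _) _ ⟨1, by norm_num, rfl⟩ h6
  have hpt : ∀ i : Fin n, v (J (i + 1)) + X (i + 1) • (sceneOf C E s t).dir (κ (J (i + 1))) ∈
      points (E i) := fun i => by
    rw [← sceneOf_seg C E s t]
    exact hV.mem _ (by omega) (by omega)
  refine ⟨⟨by rw [hT.start, sceneOf_pt_zero], hv, fun i => J (i + 1),
    fun i => X (i + 1) / r (J (i + 1)), fun i => ?_, fun i i' hii' => ?_⟩, fun j hj => ?_,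
    fun m' v' h1 h2 => hm.le.trans (mu_le_of_isTour hn h1 h2)⟩
  · have h3 := hV.lt (i + 1) (by omega) (by omega)
    have h4 := hpos _ h3
    refine ⟨h3, div_nonneg (hV.nonneg _ (by omega) (by omega)) h4.le,
      (div_le_one h4).2 (hV.le _ (by omega) (by omega)), ?_⟩
    rw [AffineMap.lineMap_apply_module', hT.step _ h3, add_sub_cancel_left, smul_smul,
      div_mul_cancel₀ _ h4.ne', add_comm]
    exact hpt i
  · rcases hV.mono (i + 1) (i' + 1) (by omega) (by simpa using hii') (by omega) with h3 | ⟨h3, h4⟩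
    · exact Or.inl h3
    · refine Or.inr ⟨h3, ?_⟩
      have h5 := hpos _ (hV.lt (i' + 1) (by omega) (by omega))
      change X (i + 1) / r (J (i + 1)) < X (i' + 1) / r (J (i' + 1))
      rw [h3]
      refine div_lt_div_of_pos_right (lt_of_le_of_ne h4 fun h6 => ?_) h5
      have h7 := hpt i
      rw [h3, h6] at h7
      exact Set.disjoint_left.1 (hdisj i i' hii'.ne) h7 (hpt i')
  · refine ⟨⟨κ j, hT.lt_k j hj⟩, r j, hpos j hj, ?_⟩
    rw [hT.step j hj, add_sub_cancel_left]
    exact congrArg _ (sceneOf_dir C E s t ⟨κ j, hT.lt_k j hj⟩)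

end Input

end LinkTour

/-! ### Visits with at most one turn in between -/

namespace LinkTour

/-- `z` is a nonnegative combination of `a` and `b`; if `a` and `b` are parallel, only multiples of
`b` are admitted. -/
def InCone (a b z : Plane) : Prop :=
  ∃ α β : ℝ, 0 ≤ α ∧ 0 ≤ β ∧ (det2 a b = 0 → α = 0) ∧ z = α • a + β • b

lemma det2_expand {a b : Plane} (z : Plane) (h : det2 a b ≠ 0) :
    z = (det2 z b / det2 a b) • a + (det2 a z / det2 a b) • b := by
  have h' : a.1 * b.2 - a.2 * b.1 ≠ 0 := h
  ext <;> simp only [det2, Prod.fst_add, Prod.snd_add, Prod.smul_fst, Prod.smul_snd, smul_eq_mul] <;>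
    rw [div_mul_eq_mul_div, div_mul_eq_mul_div, ← add_div, eq_div_iff h'] <;> ring

lemma det2_comb_left (a b : Plane) (α β : ℝ) : det2 (α • a + β • b) b = α * det2 a b := by
  simp only [det2, Prod.fst_add, Prod.snd_add, Prod.smul_fst, Prod.smul_snd, smul_eq_mul]; ring

lemma det2_comb_right (a b : Plane) (α β : ℝ) : det2 a (α • a + β • b) = β * det2 a b := by
  simp only [det2, Prod.fst_add, Prod.snd_add, Prod.smul_fst, Prod.smul_snd, smul_eq_mul]; ring

lemma det2_self (a : Plane) : det2 a a = 0 := by simp only [det2]; ring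

lemma inCone_iff_of_ne {a b z : Plane} (h : det2 a b ≠ 0) :
    InCone a b z ↔ 0 ≤ det2 a b * det2 z b ∧ 0 ≤ det2 a b * det2 a z := by
  constructor
  · rintro ⟨α, β, hα, hβ, -, rfl⟩
    rw [det2_comb_left, det2_comb_right]
    constructor <;> nlinarith [mul_self_nonneg (det2 a b)]
  · rintro ⟨h1, h2⟩
    have key : ∀ x : ℝ, 0 ≤ det2 a b * x → 0 ≤ x / det2 a b := fun x hx => by
      have : x / det2 a b = det2 a b * x / (det2 a b * det2 a b) := by field_simp
      rw [this]
      exact div_nonneg hx (mul_self_nonneg _)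
    exact ⟨_, _, key _ h1, key _ h2, fun h' => absurd h' h, det2_expand z h⟩

lemma inCone_iff_of_eq {a b z : Plane} (hb : b ≠ 0) (h : det2 a b = 0) :
    InCone a b z ↔ 0 ≤ det2 z b ∧ 0 ≤ - det2 z b ∧ 0 ≤ z.1 * b.1 + z.2 * b.2 := by
  have hb' : 0 < b.1 ^ 2 + b.2 ^ 2 := by
    by_contra hcon
    apply hb
    have h1 : b.1 = 0 := by nlinarith [sq_nonneg b.1, sq_nonneg b.2]
    have h2 : b.2 = 0 := by nlinarith [sq_nonneg b.1, sq_nonneg b.2]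
    exact Prod.ext h1 h2
  constructor
  · rintro ⟨α, β, hα, hβ, h0, rfl⟩
    rw [h0 h]
    refine ⟨le_of_eq ?_, le_of_eq ?_, ?_⟩
    · simp only [det2, zero_smul, zero_add, Prod.smul_fst, Prod.smul_snd, smul_eq_mul]; ring
    · simp only [det2, zero_smul, zero_add, Prod.smul_fst, Prod.smul_snd, smul_eq_mul]; ring
    · simp only [zero_smul, zero_add, Prod.smul_fst, Prod.smul_snd, smul_eq_mul]
      nlinarith
  · rintro ⟨h1, h2, h3⟩
    refine ⟨0, (z.1 * b.1 + z.2 * b.2) / (b.1 ^ 2 + b.2 ^ 2), le_rfl, div_nonneg h3 hb'.le,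
      fun _ => rfl, ?_⟩
    have h4 : z.1 * b.2 - z.2 * b.1 = 0 := le_antisymm (by simpa [det2] using h2) h1
    rw [zero_smul, zero_add]
    ext <;> simp only [Prod.smul_fst, Prod.smul_snd, smul_eq_mul] <;>
      rw [div_mul_eq_mul_div, eq_div_iff hb'.ne']
    · linear_combination b.2 * h4
    · linear_combination -b.1 * h4

/-! ### Fourier–Motzkin elimination of one variable -/

/-- A finite system of linear inequalities `0 ≤ c j + b j * σ` that bounds `σ` from below and above
is solvable if and only if each lower bound is compatible with each upper bound; the largest lower
bound is then a solution. -/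
lemma exists_iff_pairs {N : ℕ} (b c : ℕ → ℝ) (h0 : ∃ j < N, 0 < b j) (h1 : ∃ j < N, b j < 0) :
    (∃ σ, ∀ j < N, 0 ≤ c j + b j * σ) ↔
      ∀ j < N, ∀ l < N, 0 ≤ b j → b l ≤ 0 → 0 ≤ b j * c l - b l * c j := by
  constructor
  · rintro ⟨σ, h⟩ j hj l hl hbj hbl
    nlinarith [mul_nonneg hbj (h l hl), mul_nonneg (neg_nonneg.2 hbl) (h j hj)]
  · intro h
    obtain ⟨j0, hj0, hb0⟩ := h0
    obtain ⟨j1, hj1, hb1⟩ := h1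
    obtain ⟨j, hj, hmax⟩ := Finset.exists_max_image
      ((Finset.range N).filter fun j => 0 < b j) (fun j => -c j / b j)
      ⟨j0, by simp [hj0, hb0]⟩
    simp only [Finset.mem_filter, Finset.mem_range] at hj hmax
    refine ⟨-c j / b j, fun l hl => ?_⟩
    rcases lt_trichotomy (b l) 0 with hbl | hbl | hbl
    · have := h j hj.1 l hl hj.2.le hbl.le
      have e : c l + b l * (-c j / b j) = (b j * c l - b l * c j) / b j := by
        field_simp [hj.2.ne']; ring
      rw [e]
      exact div_nonneg this hj.2.le
    · have := h l hl j1 hj1 hbl.ge hb1.le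
      rw [hbl] at this ⊢
      nlinarith
    · have := hmax l ⟨hl, hbl⟩
      rw [div_le_iff₀ hbl] at this
      linarith

lemma largest_lower_bound {N : ℕ} (b c : ℕ → ℝ) (σ : ℝ) (hlow : ∀ j < N, 0 < b j → -c j / b j ≤ σ)
    (hatt : ∃ j < N, 0 < b j ∧ σ = -c j / b j) (hsol : ∃ σ, ∀ j < N, 0 ≤ c j + b j * σ) :
    ∀ j < N, 0 ≤ c j + b j * σ := by
  obtain ⟨σ', h⟩ := hsol
  obtain ⟨j, hj, hbj, hσ⟩ := hatt
  have hle : σ ≤ σ' := by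
    rw [hσ, div_le_iff₀ hbj]
    linarith [h j hj]
  intro l hl
  rcases lt_or_ge 0 (b l) with hbl | hbl
  · have := hlow l hl hbl
    rw [div_le_iff₀ hbl] at this
    linarith
  · have := h l hl
    nlinarith

namespace Scene

variable (S : Scene)

/-- The parameters of the points on segment `i + 1` that can be reached from the points of segment
`i` with parameters in `P` by a path that starts in orientation `d` and ends in orientation `c`. -/
def cone (i : ℕ) (P : Set ℝ) (d c : ℕ) : Set ℝ :=
  {τ | τ ∈ Set.Icc (1 : ℝ) 2 ∧ ∃ σ ∈ P, InCone (S.dir d) (S.dir c) (S.pt (i + 1) τ - S.pt i σ)}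

variable {S}

lemma cone_mono {i d c : ℕ} {P P' : Set ℝ} (h : P ⊆ P') : S.cone i P d c ⊆ S.cone i P' d c :=
  fun _ ⟨h1, σ, h2, h3⟩ => ⟨h1, σ, h h2, h3⟩

lemma cone_subset {i d c : ℕ} {P : Set ℝ} : S.cone i P d c ⊆ Set.Icc 1 2 := fun _ h => h.1

lemma inCone_ray {a b : Plane} {β : ℝ} (hβ : 0 ≤ β) : InCone a b (β • b) :=
  ⟨0, β, le_rfl, hβ, fun _ => rfl, by simp⟩

lemma cone_ray_subset {i d c : ℕ} {P : Set ℝ} : S.cone i P c c ⊆ S.cone i P d c := by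
  rintro τ ⟨h1, σ, h2, α, β, hα, hβ, h0, h⟩
  refine ⟨h1, σ, h2, ?_⟩
  rw [h0 (det2_self _), zero_smul, zero_add] at h
  rw [h]
  exact inCone_ray hβ

lemma cone_eq_ray {i d c : ℕ} {P : Set ℝ} (hdc : det2 (S.dir d) (S.dir c) = 0) :
    S.cone i P d c = S.cone i P c c := by
  refine Set.Subset.antisymm ?_ cone_ray_subset
  rintro τ ⟨h1, σ, h2, α, β, hα, hβ, h0, h⟩
  refine ⟨h1, σ, h2, ?_⟩
  rw [h0 hdc, zero_smul, zero_add] at h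
  rw [h]
  exact inCone_ray hβ

lemma cone_self_subset_of_ne {i d c : ℕ} {P : Set ℝ} (hdc : det2 (S.dir d) (S.dir c) ≠ 0) :
    S.cone i P d d ⊆ S.cone i P d c := by
  rintro τ ⟨h1, σ, h2, α, β, hα, hβ, h0, h⟩
  rw [h0 (det2_self _), zero_smul, zero_add] at h
  exact ⟨h1, σ, h2, β, 0, hβ, le_rfl, fun h' => absurd h' hdc, by rw [h]; simp⟩

/-- Two affine functions that are nonnegative at `τ`, with one negative at `1` and the other at `2`,
have zeros at which the other one is nonnegative. -/
lemma affine_cross {f₀ f₁ g₀ g₁ τ : ℝ} (h1 : 1 ≤ τ) (h2 : τ ≤ 2) (hf : 0 ≤ f₀ + τ * f₁)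
    (hg : 0 ≤ g₀ + τ * g₁) (hf1 : f₀ + f₁ < 0) (hg2 : g₀ + 2 * g₁ < 0) :
    (∃ t ∈ Set.Icc (1 : ℝ) 2, f₀ + t * f₁ = 0 ∧ 0 ≤ g₀ + t * g₁) ∧
      ∃ t ∈ Set.Icc (1 : ℝ) 2, g₀ + t * g₁ = 0 ∧ 0 ≤ f₀ + t * f₁ := by
  have hf' : 0 < f₁ := by nlinarith
  have hg' : g₁ < 0 := by nlinarith
  have a1 : 1 ≤ -f₀ / f₁ := by rw [le_div_iff₀ hf']; linarith
  have a2 : -f₀ / f₁ ≤ τ := by rw [div_le_iff₀ hf']; linarith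
  have b1 : -g₀ / g₁ ≤ 2 := by rw [div_le_iff_of_neg hg']; linarith
  have b2 : τ ≤ -g₀ / g₁ := by rw [le_div_iff_of_neg hg']; linarith
  refine ⟨⟨-f₀ / f₁, ⟨a1, a2.trans h2⟩, ?_, ?_⟩, ⟨-g₀ / g₁, ⟨h1.trans b2, b1⟩, ?_, ?_⟩⟩
  · rw [div_mul_cancel₀ _ hf'.ne']; ring
  · nlinarith
  · rw [div_mul_cancel₀ _ hg'.ne]; ring
  · nlinarith

/-- The segment `i + 1` either ends inside the region that is swept by a turn, or it crosses both of
the rays that bound the region. -/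
lemma cone_cases {i d c : ℕ} {P : Set ℝ} (hdc : det2 (S.dir d) (S.dir c) ≠ 0)
    (h : (S.cone i P d c).Nonempty) :
    1 ∈ S.cone i P d c ∨ 2 ∈ S.cone i P d c ∨
      ((S.cone i P c c).Nonempty ∧ (S.cone i P d d).Nonempty) := by
  obtain ⟨τ, ⟨h1, h2⟩, σ, hσ, hc⟩ := h
  set a := S.dir d
  set b := S.dir c
  set D := det2 a b with hD
  have hz : ∀ t : ℝ, S.pt (i + 1) t - S.pt i σ =
      (S.org (i + 1) - S.pt i σ) + t • S.vec (i + 1) := fun t => by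
    simp only [pt]; abel
  have hl : ∀ t : ℝ, D * det2 (S.pt (i + 1) t - S.pt i σ) b =
      D * det2 (S.org (i + 1) - S.pt i σ) b + t * (D * det2 (S.vec (i + 1)) b) := fun t => by
    rw [hz]
    simp only [det2, Prod.fst_add, Prod.snd_add, Prod.smul_fst, Prod.smul_snd, smul_eq_mul]; ring
  have hr : ∀ t : ℝ, D * det2 a (S.pt (i + 1) t - S.pt i σ) =
      D * det2 a (S.org (i + 1) - S.pt i σ) + t * (D * det2 a (S.vec (i + 1))) := fun t => by
    rw [hz]
    simp only [det2, Prod.fst_add, Prod.snd_add, Prod.smul_fst, Prod.smul_snd, smul_eq_mul]; ring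
  have hmem : ∀ t, InCone a b (S.pt (i + 1) t - S.pt i σ) ↔
      0 ≤ D * det2 (S.org (i + 1) - S.pt i σ) b + t * (D * det2 (S.vec (i + 1)) b) ∧
      0 ≤ D * det2 a (S.org (i + 1) - S.pt i σ) + t * (D * det2 a (S.vec (i + 1))) := fun t => by
    rw [inCone_iff_of_ne hdc, ← hD, hl, hr]
  have zero_l : ∀ t ∈ Set.Icc (1 : ℝ) 2,
      D * det2 (S.org (i + 1) - S.pt i σ) b + t * (D * det2 (S.vec (i + 1)) b) = 0 →
      0 ≤ D * det2 a (S.org (i + 1) - S.pt i σ) + t * (D * det2 a (S.vec (i + 1))) →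
      (S.cone i P c c).Nonempty := by
    intro t ht e1 e2
    obtain ⟨α, β, hα, hβ, -, he⟩ := (hmem t).2 ⟨e1.ge, e2⟩
    rw [← hl t, he, det2_comb_left, ← hD] at e1
    have hα0 : α = 0 := by
      rcases mul_eq_zero.1 e1 with h | h
      · exact absurd h hdc
      · exact (mul_eq_zero.1 h).resolve_right hdc
    refine ⟨t, ht, σ, hσ, ?_⟩
    rw [he, hα0, zero_smul, zero_add]
    exact inCone_ray hβ
  have zero_r : ∀ t ∈ Set.Icc (1 : ℝ) 2,
      D * det2 a (S.org (i + 1) - S.pt i σ) + t * (D * det2 a (S.vec (i + 1))) = 0 →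
      0 ≤ D * det2 (S.org (i + 1) - S.pt i σ) b + t * (D * det2 (S.vec (i + 1)) b) →
      (S.cone i P d d).Nonempty := by
    intro t ht e1 e2
    obtain ⟨α, β, hα, hβ, -, he⟩ := (hmem t).2 ⟨e2, e1.ge⟩
    rw [← hr t, he, det2_comb_right, ← hD] at e1
    have hβ0 : β = 0 := by
      rcases mul_eq_zero.1 e1 with h | h
      · exact absurd h hdc
      · exact (mul_eq_zero.1 h).resolve_right hdc
    refine ⟨t, ht, σ, hσ, ?_⟩
    rw [he, hβ0, zero_smul, add_zero]
    exact inCone_ray hα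
  obtain ⟨hτl, hτr⟩ := (hmem τ).1 hc
  by_cases e1 : InCone a b (S.pt (i + 1) 1 - S.pt i σ)
  · exact Or.inl ⟨by norm_num, σ, hσ, e1⟩
  by_cases e2 : InCone a b (S.pt (i + 1) 2 - S.pt i σ)
  · exact Or.inr (Or.inl ⟨by norm_num, σ, hσ, e2⟩)
  refine Or.inr (Or.inr ?_)
  rw [hmem, not_and_or, not_le, not_le] at e1 e2
  rw [one_mul] at e1
  have both : ∀ {f₀ f₁ : ℝ}, 0 ≤ f₀ + τ * f₁ → f₀ + f₁ < 0 → f₀ + 2 * f₁ < 0 → False := by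
    intro f₀ f₁ e3 e4 e5
    rcases le_total 0 f₁ with h | h <;> nlinarith
  rw [one_mul] at e1
  rcases e1 with e1 | e1 <;> rcases e2 with e2 | e2
  · exact (both hτl e1 e2).elim
  · obtain ⟨⟨t, ht, u1, u2⟩, ⟨t', ht', u3, u4⟩⟩ := affine_cross h1 h2 hτl hτr e1 e2
    exact ⟨zero_l t ht u1 u2, zero_r t' ht' u3 u4⟩
  · obtain ⟨⟨t, ht, u1, u2⟩, ⟨t', ht', u3, u4⟩⟩ := affine_cross h1 h2 hτr hτl e1 e2
    exact ⟨zero_l t' ht' u3 u4, zero_r t ht u1 u2⟩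
  · exact (both hτr e1 e2).elim

/-- Rays of orientation `c` from segment `i` and rays of the opposite orientation cannot both meet
segment `i + 1`, since the segments are disjoint. -/
lemma Valid.not_above_below (hS : S.Valid) {i c d : ℕ} (hi : i ≤ S.n) {P P' : Set ℝ}
    (hP : P ⊆ Set.Icc 1 2) (hP' : P' ⊆ Set.Icc 1 2) (hdc : S.dir d = -S.dir c)
    (h : (S.cone i P c c).Nonempty) (h' : (S.cone i P' d d).Nonempty) : False := by
  obtain ⟨τ, hτ, σ, hσ, α₀, α, -, hα, h0, e⟩ := h
  obtain ⟨τ', hτ', σ', hσ', β₀, β, -, hβ, h0', e'⟩ := h'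
  rw [h0 (det2_self _), zero_smul, zero_add] at e
  rw [h0' (det2_self _), zero_smul, zero_add, hdc, smul_neg] at e'
  have e1 : S.pt (i + 1) τ = S.pt i σ + α • S.dir c := by rw [← e]; abel
  have e2 : S.pt (i + 1) τ' = S.pt i σ' - β • S.dir c := by
    rw [sub_eq_add_neg, ← e']; abel
  have conv : ∀ (i : ℕ) (τ τ' x y : ℝ), x + y = 1 →
      S.pt i (x * τ + y * τ') = x • S.pt i τ + y • S.pt i τ' := by
    intro i τ τ' x y hxy
    obtain rfl : y = 1 - x := by linarith
    simp only [pt]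
    module
  have hcx : ∀ (τ τ' x y : ℝ), τ ∈ Set.Icc (1 : ℝ) 2 → τ' ∈ Set.Icc (1 : ℝ) 2 → 0 ≤ x → 0 ≤ y →
      x + y = 1 → x * τ + y * τ' ∈ Set.Icc (1 : ℝ) 2 := by
    intro τ τ' x y h1 h2 hx hy hxy
    exact convex_Icc (1 : ℝ) 2 h1 h2 hx hy hxy
  obtain ⟨x, y, hx, hy, hxy, hbal⟩ : ∃ x y : ℝ, 0 ≤ x ∧ 0 ≤ y ∧ x + y = 1 ∧ x * α = y * β := by
    rcases (add_nonneg hα hβ).eq_or_lt with h | h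
    · refine ⟨1, 0, by norm_num, le_rfl, by norm_num, ?_⟩
      have : α = 0 := by linarith
      simp [this]
    · refine ⟨β / (α + β), α / (α + β), by positivity, by positivity, ?_, by ring⟩
      rw [← add_div, add_comm, div_self h.ne']
  refine hS.disj i hi (S.pt i (x * σ + y * σ')) ⟨_, hcx _ _ x y (hP hσ) (hP' hσ') hx hy hxy, rfl⟩
    ⟨x * τ + y * τ', hcx _ _ x y hτ hτ' hx hy hxy, ?_⟩
  rw [conv _ _ _ _ _ hxy, conv _ _ _ _ _ hxy, e1, e2]
  have : y • β • S.dir c = x • α • S.dir c := by rw [smul_smul, smul_smul, hbal]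
  rw [smul_add, smul_sub, this]
  abel

end Scene
end LinkTour

/-! ### Reachable sets as unions of slots -/

namespace LinkTour
namespace Scene

variable (S : Scene)

/-- The family of slots `X c g`, `g < G`, describes the points of segment `i` that are reached with
`m` links of which the last has orientation `c`. -/
def Desc (G i m : ℕ) (X : ℕ → ℕ → Set ℝ) : Prop :=
  ∀ c < S.k, ∀ τ, (∃ g < G, τ ∈ X c g) ↔ τ ∈ Set.Icc (1 : ℝ) 2 ∧ S.Reach m i c (S.pt i τ)

/-- The situation before the computation of the slots for segment `i + 1` and `m + 1` links: `Xl` and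
`Xa` describe segment `i` for `m` and `m + 1` links, and `Yl` describes segment `i + 1` for `m`
links.  Slot `Φ d g c` of `Xa` contains slot `g` of `Xl`.  The slots `2 * i + 1` and `2 * i + 2` are
still unused. -/
structure LevelHyp (G i m : ℕ) (Xa Xl Yl : ℕ → ℕ → Set ℝ) (Φ : ℕ → ℕ → ℕ → ℕ) : Prop where
  hi : i ≤ S.n
  hG : 2 * i + 3 ≤ G
  descA : S.Desc G i (m + 1) Xa
  descL : S.Desc G i m Xl
  descY : S.Desc G (i + 1) m Yl
  sub : ∀ d < S.k, ∀ g < G, ∀ c < S.k, Xl d g ⊆ Xa c (Φ d g c)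
  ptr : ∀ d < S.k, ∀ g < G, ∀ c < S.k, Φ d g c < 2 * i + 1
  freshA : ∀ c < S.k, ∀ g < G, 2 * i + 1 ≤ g → Xa c g = ∅
  freshL : ∀ c < S.k, ∀ g < G, 2 * i + 1 ≤ g → Xl c g = ∅
  star : ∀ d < S.k, ∀ g < G, 1 ∈ Yl d g ∨ 2 ∈ Yl d g ∨ Yl d g ⊆ S.cone i (Xl d g) d d

/-- Invariant of the computation of the slots `Ya` for segment `i + 1` and `m + 1` links, when the
triples in `Done` have been treated. -/
structure FInv (G i m : ℕ) (Xa Yl : ℕ → ℕ → Set ℝ) (Done : ℕ → ℕ → ℕ → Prop)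
    (Ya : ℕ → ℕ → Set ℝ) : Prop where
  snd : ∀ c < S.k, ∀ g < G, ∀ τ ∈ Ya c g,
    τ ∈ Set.Icc (1 : ℝ) 2 ∧ S.Reach (m + 1) (i + 1) c (S.pt (i + 1) τ)
  psh : ∀ c < S.k, ∀ g < G, S.cone i (Xa c g) c c ⊆ Ya c g
  endL : ∀ c < S.k, Ya c (2 * i + 1) = ∅ ∨ 1 ∈ Ya c (2 * i + 1)
  endR : ∀ c < S.k, Ya c (2 * i + 2) = ∅ ∨ 2 ∈ Ya c (2 * i + 2)
  own : ∀ c < S.k, ∀ g < 2 * i + 1, Ya c g = ∅ ∨ (S.cone i (Set.Icc 1 2) c c).Nonempty ∨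
    ∃ d < S.k, S.dir d = -S.dir c ∧ Done d g c
  only : (∀ d < S.k, ∀ g < G, Yl d g = ∅) → ∀ c < S.k, ∀ g < 2 * i + 1,
    Ya c g ⊆ S.cone i (Xa c g) c c
  fresh : ∀ c < S.k, ∀ g < G, 2 * i + 3 ≤ g → Ya c g = ∅

/-- The family `Ya` with the set `Z` added to slot `T` for orientation `c`. -/
def addTo (Ya : ℕ → ℕ → Set ℝ) (c T : ℕ) (Z : Set ℝ) : ℕ → ℕ → Set ℝ :=
  fun c' g' => if c' = c ∧ g' = T then Ya c' g' ∪ Z else Ya c' g'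

variable {S}

lemma subset_addTo (Ya : ℕ → ℕ → Set ℝ) (c T : ℕ) (Z : Set ℝ) (c' g' : ℕ) :
    Ya c' g' ⊆ addTo Ya c T Z c' g' := by
  unfold addTo
  split_ifs
  · exact Set.subset_union_left
  · exact subset_rfl

lemma addTo_self (Ya : ℕ → ℕ → Set ℝ) (c T : ℕ) (Z : Set ℝ) :
    addTo Ya c T Z c T = Ya c T ∪ Z := by simp [addTo]

lemma addTo_of_ne (Ya : ℕ → ℕ → Set ℝ) {c T : ℕ} (Z : Set ℝ) {c' g' : ℕ} (h : ¬ (c' = c ∧ g' = T)) :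
    addTo Ya c T Z c' g' = Ya c' g' := by simp [addTo, h]

section Level

variable {G i m : ℕ} {Xa Xl Yl Ya : ℕ → ℕ → Set ℝ} {Φ : ℕ → ℕ → ℕ → ℕ}
  {Done Done' : ℕ → ℕ → ℕ → Prop}

lemma reach_of_cone {d c m : ℕ} {P : Set ℝ} (hc : c < S.k)
    (hP : ∀ σ ∈ P, S.Reach m i d (S.pt i σ)) {τ : ℝ} (h : τ ∈ S.cone i P d c) :
    τ ∈ Set.Icc (1 : ℝ) 2 ∧ S.Reach (m + 1) (i + 1) c (S.pt (i + 1) τ) := by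
  obtain ⟨h1, σ, hσ, α, β, hα, hβ, -, h⟩ := h
  exact ⟨h1, .turn (hP σ hσ) hc hα hβ (by rw [add_assoc, ← h]; abel) ⟨τ, h1, rfl⟩⟩

lemma reach_of_ray {c m : ℕ} {P : Set ℝ} (hP : ∀ σ ∈ P, S.Reach m i c (S.pt i σ)) {τ : ℝ}
    (h : τ ∈ S.cone i P c c) :
    τ ∈ Set.Icc (1 : ℝ) 2 ∧ S.Reach m (i + 1) c (S.pt (i + 1) τ) := by
  obtain ⟨h1, σ, hσ, α, β, hα, hβ, h0, h⟩ := h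
  rw [h0 (det2_self _), zero_smul, zero_add] at h
  exact ⟨h1, .push (hP σ hσ) hβ (by rw [← h]; abel) ⟨τ, h1, rfl⟩⟩

lemma FInv.insert (H : S.FInv G i m Xa Yl Done Ya) (hD : ∀ d g c, Done d g c → Done' d g c)
    {c T : ℕ} {Z : Set ℝ}
    (hZ : ∀ τ ∈ Z, τ ∈ Set.Icc (1 : ℝ) 2 ∧ S.Reach (m + 1) (i + 1) c (S.pt (i + 1) τ))
    (hT : (T = 2 * i + 1 ∧ 1 ∈ Z) ∨ (T = 2 * i + 2 ∧ 2 ∈ Z) ∨ (T < 2 * i + 1 ∧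
      ((S.cone i (Set.Icc 1 2) c c).Nonempty ∨ ∃ d < S.k, S.dir d = -S.dir c ∧ Done' d T c) ∧
      ((∀ d < S.k, ∀ g < G, Yl d g = ∅) → Z ⊆ S.cone i (Xa c T) c c))) :
    S.FInv G i m Xa Yl Done' (addTo Ya c T Z) where
  snd c' hc' g' hg' τ hτ := by
    by_cases h : c' = c ∧ g' = T
    · obtain ⟨rfl, rfl⟩ := h
      rw [addTo_self] at hτ
      rcases hτ with hτ | hτ
      · exact H.snd _ hc' _ hg' _ hτ
      · exact hZ _ hτ
    · rw [addTo_of_ne _ _ h] at hτ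
      exact H.snd _ hc' _ hg' _ hτ
  psh c' hc' g' hg' := (H.psh c' hc' g' hg').trans (subset_addTo _ _ _ _ _ _)
  endL c' hc' := by
    by_cases h : c' = c ∧ 2 * i + 1 = T
    · obtain ⟨rfl, rfl⟩ := h
      rw [addTo_self]
      rcases hT with h | h | h
      · exact Or.inr (Or.inr h.2)
      · omega
      · omega
    · rw [addTo_of_ne _ _ h]
      exact H.endL _ hc'
  endR c' hc' := by
    by_cases h : c' = c ∧ 2 * i + 2 = T
    · obtain ⟨rfl, rfl⟩ := h
      rw [addTo_self]
      rcases hT with h | h | h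
      · omega
      · exact Or.inr (Or.inr h.2)
      · omega
    · rw [addTo_of_ne _ _ h]
      exact H.endR _ hc'
  own c' hc' g' hg' := by
    by_cases h : c' = c ∧ g' = T
    · obtain ⟨rfl, rfl⟩ := h
      rcases hT with h | h | h
      · omega
      · omega
      · exact Or.inr h.2.1
    · rw [addTo_of_ne _ _ h]
      rcases H.own _ hc' _ hg' with h | h | ⟨d, hd, h, h'⟩
      · exact Or.inl h
      · exact Or.inr (Or.inl h)
      · exact Or.inr (Or.inr ⟨d, hd, h, hD _ _ _ h'⟩)
  only hE c' hc' g' hg' := by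
    by_cases h : c' = c ∧ g' = T
    · obtain ⟨rfl, rfl⟩ := h
      rw [addTo_self]
      rcases hT with h | h | h
      · omega
      · omega
      · exact Set.union_subset (H.only hE _ hc' _ hg') (h.2.2 hE)
    · rw [addTo_of_ne _ _ h]
      exact H.only hE _ hc' _ hg'
  fresh c' hc' g' hg' hg'' := by
    rw [addTo_of_ne _ _ (by rintro ⟨-, rfl⟩; omega)]
    exact H.fresh _ hc' _ hg' hg''

lemma FInv.mono (H : S.FInv G i m Xa Yl Done Ya) (hD : ∀ d g c, Done d g c → Done' d g c) :
    S.FInv G i m Xa Yl Done' Ya :=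
  { H with
    own := fun c hc g hg => by
      rcases H.own _ hc _ hg with h | h | ⟨d, hd, h, h'⟩
      · exact Or.inl h
      · exact Or.inr (Or.inl h)
      · exact Or.inr (Or.inr ⟨d, hd, h, hD _ _ _ h'⟩) }

variable (L : S.LevelHyp G i m Xa Xl Yl Φ)
include L

lemma LevelHyp.reachL {d g : ℕ} (hd : d < S.k) (hg : g < G) {σ : ℝ} (h : σ ∈ Xl d g) :
    σ ∈ Set.Icc (1 : ℝ) 2 ∧ S.Reach m i d (S.pt i σ) := (L.descL d hd σ).1 ⟨g, hg, h⟩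

lemma LevelHyp.reachA {d g : ℕ} (hd : d < S.k) (hg : g < G) {σ : ℝ} (h : σ ∈ Xa d g) :
    σ ∈ Set.Icc (1 : ℝ) 2 ∧ S.Reach (m + 1) i d (S.pt i σ) := (L.descA d hd σ).1 ⟨g, hg, h⟩

lemma LevelHyp.reachY {d g : ℕ} (hd : d < S.k) (hg : g < G) {τ : ℝ} (h : τ ∈ Yl d g) :
    τ ∈ Set.Icc (1 : ℝ) 2 ∧ S.Reach m (i + 1) d (S.pt (i + 1) τ) := (L.descY d hd τ).1 ⟨g, hg, h⟩

lemma LevelHyp.init : S.FInv G i m Xa Yl Done fun c g => S.cone i (Xa c g) c c := by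
  have hG := L.hG
  have hempty : ∀ c < S.k, ∀ g < G, 2 * i + 1 ≤ g → S.cone i (Xa c g) c c = ∅ := by
    intro c hc g hg hg'
    rw [L.freshA c hc g hg hg', Set.eq_empty_iff_forall_notMem]
    rintro τ ⟨-, σ, hσ, -⟩
    exact hσ
  refine ⟨fun c hc g hg τ hτ => ?_, fun c hc g hg => subset_rfl, fun c hc => ?_, fun c hc => ?_,
    fun c hc g hg => ?_, fun _ c hc g hg => subset_rfl, fun c hc g hg hg' => ?_⟩
  · exact reach_of_ray (fun σ hσ => (L.reachA hc hg hσ).2) hτ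
  · exact Or.inl (hempty c hc _ (by omega) (by omega))
  · exact Or.inl (hempty c hc _ (by omega) (by omega))
  · rcases Set.eq_empty_or_nonempty (S.cone i (Xa c g) c c) with h | h
    · exact Or.inl h
    · exact Or.inr (Or.inl (h.mono (cone_mono fun σ hσ => (L.reachA hc (by omega) hσ).1)))
  · exact hempty c hc g hg (by omega)

/-- The set of points that are reached by a turn is connected to the slot to which it is added. -/
lemma LevelHyp.turn (H : S.FInv G i m Xa Yl Done Ya) (hD : ∀ d g c, Done d g c → Done' d g c)
    {d g c T : ℕ} (hd : d < S.k) (hg : g < G) (hc : c < S.k)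
    (hne : (S.cone i (Xl d g) d c).Nonempty)
    (hT : (T = 2 * i + 1 ∧ 1 ∈ S.cone i (Xl d g) d c) ∨
      (T = 2 * i + 2 ∧ 2 ∈ S.cone i (Xl d g) d c) ∨
      (T = Φ d g c ∧ 1 ∉ S.cone i (Xl d g) d c ∧ 2 ∉ S.cone i (Xl d g) d c)) :
    T < 2 * i + 3 ∧ (Ya c T = ∅ ∨ (Ya c T ∩ S.cone i (Xl d g) d c).Nonempty) ∧
      S.FInv G i m Xa Yl Done' (addTo Ya c T (S.cone i (Xl d g) d c)) := by
  have hG := L.hG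
  set Z := S.cone i (Xl d g) d c with hZ
  have hsnd : ∀ τ ∈ Z, τ ∈ Set.Icc (1 : ℝ) 2 ∧ S.Reach (m + 1) (i + 1) c (S.pt (i + 1) τ) :=
    fun τ hτ => reach_of_cone hc (fun σ hσ => (L.reachL hd hg hσ).2) hτ
  rcases hT with ⟨rfl, h⟩ | ⟨rfl, h⟩ | ⟨rfl, h1, h2⟩
  · refine ⟨by omega, ?_, H.insert hD hsnd (Or.inl ⟨rfl, h⟩)⟩
    rcases H.endL c hc with h' | h'
    · exact Or.inl h'
    · exact Or.inr ⟨1, h', h⟩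
  · refine ⟨by omega, ?_, H.insert hD hsnd (Or.inr (Or.inl ⟨rfl, h⟩))⟩
    rcases H.endR c hc with h' | h'
    · exact Or.inl h'
    · exact Or.inr ⟨2, h', h⟩
  · have hptr := L.ptr d hd g hg c hc
    have hsub := L.sub d hd g hg c hc
    have hpar : (S.cone i (Xl d g) c c).Nonempty ∧
        ((∀ d < S.k, ∀ g < G, Yl d g = ∅) → Z ⊆ S.cone i (Xa c (Φ d g c)) c c) := by
      by_cases hdc : det2 (S.dir d) (S.dir c) = 0
      · have := cone_eq_ray (i := i) (P := Xl d g) hdc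
        rw [hZ, this]
        exact ⟨this ▸ hne, fun _ => cone_mono hsub⟩
      · rcases cone_cases hdc hne with h | h | ⟨h, τ, h'⟩
        · exact absurd h h1
        · exact absurd h h2
        · refine ⟨h, fun hE => ?_⟩
          obtain ⟨hτ, hr⟩ := reach_of_ray (fun σ hσ => (L.reachL hd hg hσ).2) h'
          obtain ⟨g', hg', hmem⟩ := (L.descY d hd τ).2 ⟨hτ, hr⟩
          rw [hE d hd g' hg'] at hmem
          exact hmem.elim
    refine ⟨by omega, Or.inr ?_, H.insert hD hsnd (Or.inr (Or.inr ⟨hptr, Or.inl ?_, hpar.2⟩))⟩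
    · obtain ⟨τ, hτ⟩ := hpar.1
      exact ⟨τ, H.psh c hc _ (by omega) (cone_mono hsub hτ), cone_ray_subset hτ⟩
    · exact hpar.1.mono (cone_mono fun σ hσ => (L.reachL hd hg hσ).1)

/-- The points that are reached with one link less are connected to the slot to which they are
added.  When they do not contain an endpoint of the segment and `d` is opposite to `c`, this is
because slot `g` is still empty: the segment cannot be met by rays of both orientations. -/
lemma LevelHyp.absorb (hS : S.Valid) (H : S.FInv G i m Xa Yl Done Ya)
    (hD : ∀ d g c, Done d g c → Done' d g c)
    {d g c T : ℕ} (hd : d < S.k) (hg : g < G) (hc : c < S.k)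
    (hnd : ¬ Done d g c) (hd' : Done' d g c) (hne : (Yl d g).Nonempty)
    (hT : (T = 2 * i + 1 ∧ 1 ∈ Yl d g) ∨ (T = 2 * i + 2 ∧ 2 ∈ Yl d g) ∨
      (T = g ∧ S.dir d = -S.dir c ∧ 1 ∉ Yl d g ∧ 2 ∉ Yl d g)) :
    T < 2 * i + 3 ∧ (Ya c T = ∅ ∨ (Ya c T ∩ Yl d g).Nonempty) ∧
      S.FInv G i m Xa Yl Done' (addTo Ya c T (Yl d g)) := by
  have hG := L.hG
  have hsnd : ∀ τ ∈ Yl d g, τ ∈ Set.Icc (1 : ℝ) 2 ∧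
      S.Reach (m + 1) (i + 1) c (S.pt (i + 1) τ) :=
    fun τ hτ => ⟨(L.reachY hd hg hτ).1, (L.reachY hd hg hτ).2.deg hc⟩
  rcases hT with ⟨rfl, h⟩ | ⟨rfl, h⟩ | ⟨rfl, hop, h1, h2⟩
  · refine ⟨by omega, ?_, H.insert hD hsnd (Or.inl ⟨rfl, h⟩)⟩
    rcases H.endL c hc with h' | h'
    · exact Or.inl h'
    · exact Or.inr ⟨1, h', h⟩
  · refine ⟨by omega, ?_, H.insert hD hsnd (Or.inr (Or.inl ⟨rfl, h⟩))⟩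
    rcases H.endR c hc with h' | h'
    · exact Or.inl h'
    · exact Or.inr ⟨2, h', h⟩
  · have hsub : Yl d T ⊆ S.cone i (Xl d T) d d :=
      ((L.star d hd T hg).resolve_left h1).resolve_left h2
    have hT' : T < 2 * i + 1 := by
      by_contra hcon
      obtain ⟨τ, hτ⟩ := hne
      obtain ⟨-, σ, hσ, -⟩ := hsub hτ
      rw [L.freshL d hd T hg (by omega)] at hσ
      exact hσ
    refine ⟨by omega, Or.inl ?_, H.insert hD hsnd
      (Or.inr (Or.inr ⟨hT', Or.inr ⟨d, hd, hop, hd'⟩, fun hE => ?_⟩))⟩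
    · rcases H.own c hc T hT' with h | h | ⟨d', hd', h, h'⟩
      · exact h
      · exact (hS.not_above_below L.hi subset_rfl (fun σ hσ => (L.reachL hd hg hσ).1) hop h
          (hne.mono hsub)).elim
      · rw [hS.inj d' hd' d hd (h.trans hop.symm)] at h'
        exact absurd h' hnd
    · rw [hE d hd T hg]
      exact Set.empty_subset _

/-- When all triples have been treated, the slots describe the reachable points. -/
lemma LevelHyp.desc (hS : S.Valid) (H : S.FInv G i m Xa Yl Done Ya)
    (h1 : ∀ d < S.k, ∀ g < G, ∀ c < S.k, ∃ g' < G, S.cone i (Xl d g) d c ⊆ Ya c g')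
    (h2 : ∀ d < S.k, ∀ g < G, ∀ c < S.k, ∃ g' < G, Yl d g ⊆ Ya c g') :
    S.Desc G (i + 1) (m + 1) Ya := by
  intro c hc τ
  constructor
  · rintro ⟨g, hg, h⟩
    exact H.snd c hc g hg τ h
  · rintro ⟨hτ, h⟩
    have lower : ∀ d < S.k, S.Reach m (i + 1) d (S.pt (i + 1) τ) → ∃ g < G, τ ∈ Ya c g := by
      intro d hd hr
      obtain ⟨g, hg, hmem⟩ := (L.descY d hd τ).2 ⟨hτ, hr⟩
      obtain ⟨g', hg', hsub⟩ := h2 d hd g hg c hc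
      exact ⟨g', hg', hsub hmem⟩
    have push : ∀ (p : Plane) (α : ℝ), S.Reach (m + 1) i c p → 0 ≤ α → S.pt (i + 1) τ = p + α • S.dir c →
        ∃ g < G, τ ∈ Ya c g := by
      intro p α hp hα e
      obtain ⟨σ, hσ, rfl⟩ := hp.mem_seg
      obtain ⟨g, hg, hmem⟩ := (L.descA c hc σ).2 ⟨hσ, hp⟩
      refine ⟨g, hg, H.psh c hc g hg ⟨hτ, σ, hmem, ?_⟩⟩
      rw [e, add_sub_cancel_left]
      exact inCone_ray hα
    generalize hq : S.pt (i + 1) τ = q at h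
    generalize hm' : m + 1 = m' at h
    generalize hi' : i + 1 = i' at h
    cases h with
    | start => omega
    | push hp hα e hq' =>
      obtain rfl : i = _ := Nat.succ_injective hi'
      subst hm'
      exact push _ _ hp hα (hq.trans e)
    | @turn m₁ i₁ d c p q α β hp hc' hα hβ e hq' =>
      obtain rfl : i = i₁ := Nat.succ_injective hi'
      obtain rfl : m = m₁ := Nat.succ_injective hm'
      have hd := hp.lt_k
      obtain ⟨σ, hσ, rfl⟩ := hp.mem_seg
      obtain ⟨g, hg, hmem⟩ := (L.descL d hd σ).2 ⟨hσ, hp⟩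
      by_cases hdc : det2 (S.dir d) (S.dir c) = 0
      · rcases hS.par d hd c hc hdc with hpar | hpar
        · refine push _ (α + β) (hp.deg hc) (add_nonneg hα hβ) ?_
          rw [hq, e, hpar, add_smul, add_assoc]
        · rcases le_total α β with hle | hle
          · refine push _ (β - α) (hp.deg hc) (sub_nonneg.2 hle) ?_
            rw [hq, e, hpar, sub_smul, smul_neg]; abel
          · refine lower d hd (.push hp (sub_nonneg.2 hle) (α := α - β) ?_ (hq ▸ hq'))
            rw [hq, e, sub_smul, hpar, smul_neg, smul_neg]; abel
      · obtain ⟨g', hg', hsub⟩ := h1 d hd g hg c hc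
        refine ⟨g', hg', hsub ⟨hτ, σ, hmem, α, β, hα, hβ, fun h => absurd h hdc, ?_⟩⟩
        rw [hq, e]; abel
    | @deg m₁ i₁ d c q hr hc' =>
      subst hi'
      obtain rfl : m = m₁ := Nat.succ_injective hm'
      exact lower d hr.lt_k (hq ▸ hr)

/-- A slot for one link less that is not absorbed is already covered by the corresponding turn. -/
lemma LevelHyp.subset_turn (hS : S.Valid) {d g c : ℕ} (hd : d < S.k) (hg : g < G) (hc : c < S.k)
    (hop : S.dir d ≠ -S.dir c) (h1 : 1 ∉ Yl d g) (h2 : 2 ∉ Yl d g) :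
    Yl d g ⊆ S.cone i (Xl d g) d c := by
  have hsub := ((L.star d hd g hg).resolve_left h1).resolve_left h2
  by_cases hdc : det2 (S.dir d) (S.dir c) = 0
  · obtain rfl : d = c := hS.inj d hd c hc ((hS.par d hd c hc hdc).resolve_right hop)
    exact hsub
  · exact hsub.trans (cone_self_subset_of_ne hdc)

omit L in
/-- If there is nothing to absorb, slots that contain no endpoint come from rays only. -/
lemma FInv.star_succ (H : S.FInv G i m Xa Yl Done Ya)
    (hE : ∀ d < S.k, ∀ g < G, Yl d g = ∅) :
    ∀ c < S.k, ∀ g < G, 1 ∈ Ya c g ∨ 2 ∈ Ya c g ∨ Ya c g ⊆ S.cone i (Xa c g) c c := by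
  intro c hc g hg
  rcases lt_or_ge g (2 * i + 1) with h | h
  · exact Or.inr (Or.inr (H.only hE c hc g h))
  · have hemp : Ya c g = ∅ → 1 ∈ Ya c g ∨ 2 ∈ Ya c g ∨ Ya c g ⊆ S.cone i (Xa c g) c c :=
      fun h => Or.inr (Or.inr (h ▸ Set.empty_subset _))
    rcases h.eq_or_lt with rfl | h
    · rcases H.endL c hc with h | h
      · exact hemp h
      · exact Or.inl h
    · rcases (Nat.succ_le_of_lt h).eq_or_lt with h' | h'
      · obtain rfl : g = 2 * i + 2 := by omega
        rcases H.endR c hc with h | h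
        · exact hemp h
        · exact Or.inr (Or.inl h)
      · exact hemp (H.fresh c hc g hg (by omega))

end Level
end Scene
end LinkTour

/-! ### Statements and memory layout of the algorithm -/

/-
The word scalars of the program are: `0` number of orientations, `1` number of segments, `2` first
cell after real array `0`, `3` radix of the index computations, `4` number of slots, `5` current
segment, `7`, `8`, `9` orientation, slot, orientation (or other counters), `10`, `11` counters, `12`
nonemptiness flag, `13` address of the current slot, `14` target slot, `15` its address, `16`–`19`
flags and auxiliary values, `23`–`26` rows, `27` number of links, `28`–`31` state of the backtracking,
`32`, `33` search result, `34`, `35` counters.  Word array `20` holds the rows by segment and level,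
`21` the increments of the number of links, `22` the slot pointers.

The real arrays are: `0` input and output, `1`, `2` orientations, `3`, `4` and `5`, `6` origins and
vectors of the segments, `7`, `8` slots, `9`, `10`, `11` linear constraints, `30`, `31` vertices; the
other tags are scalars.
-/

namespace RealRAM

/-- A sequence of statements. -/
def SP.block : List SP → SP
  | [] => .skip
  | [P] => P
  | P :: Ps => .seq P (SP.block Ps)

/-- Assignment to a word scalar. -/
def SP.setw (t : ℕ) (e : WE) : SP := .wset t 0 e

/-- Assignment to a real scalar. -/
def SP.setr (t : ℕ) (e : RE) : SP := .rset t 0 e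

variable (Z : Sizes)

@[simp] lemma wp_skip (Q : Mem → Prop) (s : Mem) : wp Z .skip Q s ↔ Q s := Iff.rfl
@[simp] lemma wp_block_one (P : SP) (Q : Mem → Prop) (s : Mem) :
    wp Z (.block [P]) Q s ↔ wp Z P Q s := Iff.rfl
@[simp] lemma wp_block_cons (P P' : SP) (Ps : List SP) (Q : Mem → Prop) (s : Mem) :
    wp Z (.block (P :: P' :: Ps)) Q s ↔ wp Z P (wp Z (.block (P' :: Ps)) Q) s := Iff.rfl
@[simp] lemma wp_wset (t : ℕ) (i e : WE) (Q : Mem → Prop) (s : Mem) :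
    wp Z (.wset t i e) Q s ↔ e.eval s ≤ Z.V ∧ Q (s.setW t (i.eval s) (e.eval s)) := Iff.rfl
@[simp] lemma wp_rset (t : ℕ) (i : WE) (e : RE) (Q : Mem → Prop) (s : Mem) :
    wp Z (.rset t i e) Q s ↔ e.Safe Z s ∧ (t = 0 → i.eval s < Z.base) ∧
      Q (s.setR t (i.eval s) (e.eval s)) := Iff.rfl
@[simp] lemma wp_setw (t : ℕ) (e : WE) (Q : Mem → Prop) (s : Mem) :
    wp Z (.setw t e) Q s ↔ e.eval s ≤ Z.V ∧ Q (s.setW t 0 (e.eval s)) := Iff.rfl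
@[simp] lemma wp_setr (t : ℕ) (e : RE) (Q : Mem → Prop) (s : Mem) :
    wp Z (.setr t e) Q s ↔ e.Safe Z s ∧ (t = 0 → 0 < Z.base) ∧
      Q (s.setR t 0 (e.eval s)) := Iff.rfl
@[simp] lemma wp_ite (b : TE) (P P' : SP) (Q : Mem → Prop) (s : Mem) :
    wp Z (.ite b P P') Q s ↔ b.Safe Z s ∧ (b.Holds s → wp Z P Q s) ∧ (¬ b.Holds s → wp Z P' Q s) :=
  Iff.rfl

end RealRAM

namespace LinkTour
open RealRAM

/-- The index of slot `g` for orientation `c` in row `ρ`, in radix `M`. -/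
def idx3 (M ρ c g : ℕ) : ℕ := (ρ * M + c) * M + g

/-- The index of the pointer for `(d, g, c)` in row `ρ`, in radix `M`. -/
def idx4 (M ρ d g c : ℕ) : ℕ := ((ρ * M + d) * M + g) * M + c

lemma radix_inj {M x y x' y' : ℕ} (hy : y < M) (hy' : y' < M) (h : x * M + y = x' * M + y') :
    x = x' ∧ y = y' := by
  have h1 : (x * M + y) / M = x := by
    rw [mul_comm, Nat.mul_add_div (by omega), Nat.div_eq_of_lt hy, add_zero]
  have h2 : (x' * M + y') / M = x' := by
    rw [mul_comm, Nat.mul_add_div (by omega), Nat.div_eq_of_lt hy', add_zero]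
  have h3 : x = x' := by rw [← h1, h, h2]
  subst h3
  exact ⟨rfl, by omega⟩

lemma idx3_inj {M ρ c g ρ' c' g' : ℕ} (hc : c < M) (hg : g < M) (hc' : c' < M) (hg' : g' < M) :
    idx3 M ρ c g = idx3 M ρ' c' g' ↔ ρ = ρ' ∧ c = c' ∧ g = g' := by
  constructor
  · intro h
    obtain ⟨h1, h2⟩ := radix_inj hg hg' h
    obtain ⟨h3, h4⟩ := radix_inj hc hc' h1
    exact ⟨h3, h4, h2⟩
  · rintro ⟨rfl, rfl, rfl⟩; rfl

lemma idx4_inj {M ρ d g c ρ' d' g' c' : ℕ} (hd : d < M) (hg : g < M) (hc : c < M) (hd' : d' < M)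
    (hg' : g' < M) (hc' : c' < M) :
    idx4 M ρ d g c = idx4 M ρ' d' g' c' ↔ ρ = ρ' ∧ d = d' ∧ g = g' ∧ c = c' := by
  constructor
  · intro h
    obtain ⟨h1, h2⟩ := radix_inj hc hc' h
    obtain ⟨h3, h4, h5⟩ := (idx3_inj hd hg hd' hg').1 h1
    exact ⟨h3, h4, h5, h2⟩
  · rintro ⟨rfl, rfl, rfl, rfl⟩; rfl

/-- The interval of parameters stored at index `x` of the slot arrays.  Cells that have never been
written hold the empty interval. -/
def slot (s : Mem) (x : ℕ) : Set ℝ := Set.Icc (s.r 7 x + 1) (s.r 8 x)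

/-- The program constants and the description of the scene are present in memory. -/
structure Env (S : Scene) (s : Mem) : Prop where
  k : s.w 0 0 = S.k
  n : s.w 1 0 = S.n
  radix : s.w 3 0 = 16 * S.k * S.n
  slots : s.w 4 0 = 2 * S.n + 4
  dx : ∀ j < S.k, s.r 1 j = (S.dir j).1
  dy : ∀ j < S.k, s.r 2 j = (S.dir j).2
  ox : ∀ i ≤ S.n + 1, s.r 3 i = (S.org i).1
  oy : ∀ i ≤ S.n + 1, s.r 4 i = (S.org i).2
  vx : ∀ i ≤ S.n + 1, s.r 5 i = (S.vec i).1
  vy : ∀ i ≤ S.n + 1, s.r 6 i = (S.vec i).2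

/-- The statement does not write to the cells described by `Env`. -/
def keepsEnv (P : SP) : Bool :=
  !(P.writesW 0 || P.writesW 1 || P.writesW 3 || P.writesW 4 || P.writesR 1 || P.writesR 2 ||
    P.writesR 3 || P.writesR 4 || P.writesR 5 || P.writesR 6)

lemma Env.frame {S : Scene} {P : SP} {s s' : Mem} (h : Env S s) (hf : Frame P s s')
    (hp : keepsEnv P = true := by rfl) : Env S s' := by
  simp only [keepsEnv, Bool.not_eq_true', Bool.or_eq_false_iff] at hp
  obtain ⟨⟨⟨⟨⟨⟨⟨⟨⟨h0, h1⟩, h2⟩, h3⟩, h4⟩, h5⟩, h6⟩, h7⟩, h8⟩, h9⟩ := hp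
  exact ⟨by rw [hf.1 _ h0, h.k], by rw [hf.1 _ h1, h.n], by rw [hf.1 _ h2, h.radix],
    by rw [hf.1 _ h3, h.slots], by rw [hf.2 _ h4]; exact h.dx, by rw [hf.2 _ h5]; exact h.dy,
    by rw [hf.2 _ h6]; exact h.ox, by rw [hf.2 _ h7]; exact h.oy, by rw [hf.2 _ h8]; exact h.vx,
    by rw [hf.2 _ h9]; exact h.vy⟩

lemma Env.setW {S : Scene} {s : Mem} (h : Env S s) {t i v : ℕ}
    (ht : (t != 0 && t != 1 && t != 3 && t != 4) = true := by rfl) : Env S (s.setW t i v) := by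
  simp only [bne_iff_ne, ne_eq, Bool.and_eq_true] at ht
  obtain ⟨⟨⟨h0, h1⟩, h3⟩, h4⟩ := ht
  exact ⟨by rw [Mem.setW_w_of_ne _ _ _ (Ne.symm h0), h.k],
    by rw [Mem.setW_w_of_ne _ _ _ (Ne.symm h1), h.n],
    by rw [Mem.setW_w_of_ne _ _ _ (Ne.symm h3), h.radix],
    by rw [Mem.setW_w_of_ne _ _ _ (Ne.symm h4), h.slots], h.dx, h.dy, h.ox, h.oy, h.vx, h.vy⟩

lemma Env.setR {S : Scene} {s : Mem} (h : Env S s) {t i : ℕ} {v : ℝ}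
    (ht : decide (t = 0 ∨ 6 < t) = true := by rfl) : Env S (s.setR t i v) := by
  have ht := of_decide_eq_true ht
  have hr : ∀ t', 1 ≤ t' → t' ≤ 6 → (s.setR t i v).r t' = s.r t' := fun t' h1 h2 =>
    Mem.setR_r_of_ne _ _ _ (by omega)
  exact ⟨h.k, h.n, h.radix, h.slots, by rw [hr 1 (by omega) (by omega)]; exact h.dx,
    by rw [hr 2 (by omega) (by omega)]; exact h.dy, by rw [hr 3 (by omega) (by omega)]; exact h.ox,
    by rw [hr 4 (by omega) (by omega)]; exact h.oy, by rw [hr 5 (by omega) (by omega)]; exact h.vx,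
    by rw [hr 6 (by omega) (by omega)]; exact h.vy⟩

/-- The sizes of a run fit the scene. -/
structure SizesOK (S : Scene) (Z : Sizes) : Prop where
  k : Z.k = S.k
  n : Z.n = S.n
  kpos : 1 ≤ S.k
  npos : 1 ≤ S.n
  V : (16 * S.k * S.n) ^ 4 ≤ Z.V

lemma radix_eq (k n : ℕ) : 16 * k * n = 16 * (k * n) := by ring

namespace SizesOK
variable {S : Scene} {Z : Sizes} (h : SizesOK S Z)
include h

lemma kn_pos : 1 ≤ S.k * S.n := Nat.mul_pos h.kpos h.npos

lemma k_le : S.k ≤ S.k * S.n := Nat.le_mul_of_pos_right _ h.npos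

lemma n_le : S.n ≤ S.k * S.n := Nat.le_mul_of_pos_left _ h.kpos

lemma k_lt : S.k < 16 * S.k * S.n := by have := h.k_le; have := h.kn_pos; rw [radix_eq]; omega

lemma G_lt : 2 * S.n + 4 < 16 * S.k * S.n := by
  have := h.n_le; have := h.kn_pos; rw [radix_eq]; omega

lemma radix_le : 16 * S.k * S.n ≤ Z.V :=
  (Nat.le_self_pow (by norm_num) _).trans h.V

lemma row_lt : 4 * S.n + 8 < 16 * S.k * S.n := by
  have := h.n_le; have := h.kn_pos; rw [radix_eq]; omega

lemma idx3_le {ρ c g : ℕ} (hρ : ρ < 16 * S.k * S.n) (hc : c < 16 * S.k * S.n)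
    (hg : g < 16 * S.k * S.n) : idx3 (16 * S.k * S.n) ρ c g ≤ Z.V := by
  refine le_trans ?_ h.V
  set M := 16 * S.k * S.n
  have h1 : ρ * M + c < M * M := by nlinarith
  have h2 : idx3 M ρ c g < M * M * M := by unfold idx3; nlinarith
  have h3 : M * M * M ≤ M ^ 4 := by
    rw [show M ^ 4 = M * M * M * M by ring]
    exact Nat.le_mul_of_pos_right _ (by omega)
  omega

end SizesOK

namespace Algo

/-- Index expression for `idx3`. -/
def e3 (ρ c g : WE) : WE := (ρ * .var 3 + c) * .var 3 + g

/-- Index expression for `idx4`. -/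
def e4 (ρ d g c : WE) : WE := ((ρ * .var 3 + d) * .var 3 + g) * .var 3 + c

@[simp] lemma eval_e3 (s : Mem) (ρ c g : WE) :
    (e3 ρ c g).eval s = idx3 (s.w 3 0) (ρ.eval s) (c.eval s) (g.eval s) := rfl

@[simp] lemma eval_e4 (s : Mem) (ρ d g c : WE) :
    (e4 ρ d g c).eval s = idx4 (s.w 3 0) (ρ.eval s) (d.eval s) (g.eval s) (c.eval s) := rfl

/-- Three linear inequalities that define the cone of the orientations with numbers in the scalars
`7` and `9`. -/
def forms : SP := .block [
  .setr 14 (.get 1 (.var 7) * .get 2 (.var 9) - .get 2 (.var 7) * .get 1 (.var 9)),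
  .ite (.rlt 0 (.var 14 * .var 14))
    (.block [
      .setr 17 (.var 14 * .get 2 (.var 9)), .setr 18 (0 - .var 14 * .get 1 (.var 9)),
      .setr 19 (0 - .var 14 * .get 2 (.var 7)), .setr 20 (.var 14 * .get 1 (.var 7)),
      .setr 21 0, .setr 22 0])
    (.block [
      .setr 17 (.get 2 (.var 9)), .setr 18 (0 - .get 1 (.var 9)),
      .setr 19 (0 - .get 2 (.var 9)), .setr 20 (.get 1 (.var 9)),
      .setr 21 (.get 1 (.var 9)), .setr 22 (.get 2 (.var 9))])]

section
variable {S : Scene} {Z : Sizes} {s : Mem} {Q : Mem → Prop}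

lemma wp_forms (hS : S.Valid) (hE : Env S s) (hd : s.w 7 0 < S.k) (hc : s.w 9 0 < S.k)
    (h : ∀ s', Frame forms s s' →
      (∀ z, InCone (S.dir (s.w 7 0)) (S.dir (s.w 9 0)) z ↔
        0 ≤ s'.r 17 0 * z.1 + s'.r 18 0 * z.2 ∧ 0 ≤ s'.r 19 0 * z.1 + s'.r 20 0 * z.2 ∧
        0 ≤ s'.r 21 0 * z.1 + s'.r 22 0 * z.2) → Q s') :
    wp Z forms Q s := by
  refine wp_mono Z (fun s' hs' => h s' hs'.2 hs'.1) (wp_frame Z ?_)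
  simp [forms]
  simp only [hE.dx _ hd, hE.dy _ hd, hE.dx _ hc, hE.dy _ hc]
  have hb := hS.dir_ne _ hc
  generalize S.dir (s.w 7 0) = a
  generalize S.dir (s.w 9 0) = b at hb
  constructor
  · intro hD z1 z2
    have : det2 a b ≠ 0 := by
      intro h0
      simp only [det2] at h0
      rw [h0] at hD
      simp at hD
    rw [inCone_iff_of_ne this]
    simp only [det2]
    constructor
    · rintro ⟨h1, h2⟩; exact ⟨by linarith, by linarith⟩
    · rintro ⟨h1, h2⟩; exact ⟨by linarith, by linarith⟩
  · intro hD z1 z2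
    have : det2 a b = 0 := by
      simp only [det2]
      nlinarith
    rw [inCone_iff_of_eq hb this]
    simp only [det2]
    constructor
    · rintro ⟨h1, h2, h3⟩; exact ⟨by linarith, by linarith, by linarith⟩
    · rintro ⟨h1, h2, h3⟩; exact ⟨by linarith, by linarith, by linarith⟩

end

end Algo
end LinkTour

/-! ### Cones computed by elimination -/

namespace LinkTour
open RealRAM

namespace Algo

/-- The inner product of linear form number `q` with the vector whose coordinates are given by the
expressions `x` and `y`. -/
def formAt (q : ℕ) (x y : RE) : RE := .var (17 + 2 * q) * x + .var (18 + 2 * q) * y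

/-- Writes constraint number `j`, that the value of form `q` at the difference of the points with
parameters `τ` and `σ` is nonnegative. -/
def putForm (j : WE) (q : ℕ) : SP := .block [
  .rset 9 j (formAt q (.get 5 (.var 5 + 1)) (.get 6 (.var 5 + 1))),
  .rset 10 j (0 - formAt q (.get 5 (.var 5)) (.get 6 (.var 5))),
  .rset 11 j (formAt q (.get 3 (.var 5 + 1) - .get 3 (.var 5))
    (.get 4 (.var 5 + 1) - .get 4 (.var 5)))]

/-- The constraints on a pair of parameters `τ`, `σ`: the latter belongs to the slot with address in
scalar `13`, and the point with parameter `τ` lies in the cone at the point with parameter `σ`. -/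
def constraints : SP := .block [forms,
  .rset 9 0 0, .rset 10 0 1, .rset 11 0 (0 - (.get 7 (.var 13) + 1)),
  .rset 9 1 0, .rset 10 1 (0 - 1), .rset 11 1 (.get 8 (.var 13)),
  putForm 2 0, putForm 3 1, putForm 4 2]

/-- Constraint number `j` in memory `s`, as a function of two parameters. -/
def constraint (s : Mem) (τ σ : ℝ) (j : ℕ) : Prop :=
  0 ≤ (s.r 11 j + s.r 9 j * τ) + s.r 10 j * σ

/-- The constraints in memory say that the point with parameter `τ` on segment `i + 1` is in the cone
for `d` and `c` at the point with parameter `σ` in `X` on segment `i`. -/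
structure Constrained (S : Scene) (i : ℕ) (X : Set ℝ) (d c : ℕ) (s : Mem) : Prop where
  low : s.r 10 0 = 1
  high : s.r 10 1 = -1
  iff : ∀ τ σ, (∀ j < 5, constraint s τ σ j) ↔
    σ ∈ X ∧ InCone (S.dir d) (S.dir c) (S.pt (i + 1) τ - S.pt i σ)

section
variable {S : Scene} {Z : Sizes} {s : Mem} {Q : Mem → Prop}

lemma forall_lt_five {p : ℕ → Prop} : (∀ j < 5, p j) ↔ p 0 ∧ p 1 ∧ p 2 ∧ p 3 ∧ p 4 := by
  constructor
  · intro h; exact ⟨h 0 (by omega), h 1 (by omega), h 2 (by omega), h 3 (by omega), h 4 (by omega)⟩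
  · rintro ⟨h0, h1, h2, h3, h4⟩ j hj
    interval_cases j <;> assumption

lemma wp_constraints (hS : S.Valid) (hE : Env S s) (hi : s.w 5 0 ≤ S.n) (hd : s.w 7 0 < S.k)
    (hc : s.w 9 0 < S.k)
    (h : ∀ s', Frame constraints s s' →
      Constrained S (s.w 5 0) (slot s (s.w 13 0)) (s.w 7 0) (s.w 9 0) s' → Q s') :
    wp Z constraints Q s := by
  refine wp_mono Z (fun s' hs' => h s' hs'.2 hs'.1) (wp_frame Z ?_)
  simp only [constraints, wp_block_cons]
  refine wp_forms hS hE hd hc fun s1 f1 h1 => ?_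
  have w5 : s1.w 5 = s.w 5 := f1.w 5
  have w13 : s1.w 13 = s.w 13 := f1.w 13
  have E1 := hE.frame f1
  have r7 : s1.r 7 = s.r 7 := f1.r 7
  have r8 : s1.r 8 = s.r 8 := f1.r 8
  simp [putForm, formAt, w5, w13, r7, r8]
  refine ⟨by simp [Mem.setR_r_same], by simp [Mem.setR_r_same], fun τ σ => ?_⟩
  rw [h1, forall_lt_five]
  simp [constraint, Mem.setR_r_same, slot, Scene.pt, E1.ox _ (show s.w 5 0 ≤ S.n + 1 by omega),
    E1.oy _ (show s.w 5 0 ≤ S.n + 1 by omega), E1.vx _ (show s.w 5 0 ≤ S.n + 1 by omega),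
    E1.vy _ (show s.w 5 0 ≤ S.n + 1 by omega), E1.ox _ (show s.w 5 0 + 1 ≤ S.n + 1 by omega),
    E1.oy _ (show s.w 5 0 + 1 ≤ S.n + 1 by omega), E1.vx _ (show s.w 5 0 + 1 ≤ S.n + 1 by omega),
    E1.vy _ (show s.w 5 0 + 1 ≤ S.n + 1 by omega)]
  rw [and_assoc]
  refine and_congr (by constructor <;> intro h <;> linarith) (and_congr
    (by constructor <;> intro h <;> linarith) (and_congr ?_ (and_congr ?_ ?_)))
  all_goals
    apply iff_of_eq
    congr 1
    ring

end

/-- Restricts the interval in the scalars `12` and `13` by the condition that the linear function with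
coefficients in the scalars `14` and `15` is nonnegative. -/
def clip : SP :=
  .ite (.rlt 0 (.var 14))
    (.block [.setr 16 (0 - .var 15 / .var 14), .ite (.rlt (.var 12) (.var 16)) (.setr 12 (.var 16)) .skip])
    (.ite (.rlt (.var 14) 0)
      (.block [.setr 16 (0 - .var 15 / .var 14), .ite (.rlt (.var 16) (.var 13)) (.setr 13 (.var 16)) .skip])
      (.ite (.rlt (.var 15) 0) (.setr 13 (.var 12 - 1)) .skip))

/-- The interval in the scalars `12` and `13`. -/
def window (s : Mem) : Set ℝ := Set.Icc (s.r 12 0) (s.r 13 0)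

section
variable {S : Scene} {Z : Sizes} {s : Mem} {Q : Mem → Prop}

lemma wp_clip (h : ∀ s', Frame clip s s' →
      (∀ τ, τ ∈ window s' ↔ τ ∈ window s ∧ 0 ≤ s.r 15 0 + s.r 14 0 * τ) → Q s') :
    wp Z clip Q s := by
  refine wp_mono Z (fun s' hs' => h s' hs'.2 hs'.1) (wp_frame Z ?_)
  simp [clip, window]
  refine ⟨fun hp => ⟨hp.ne', fun hlt τ => ?_, fun hle τ => ?_⟩,
    fun hp => ⟨fun hn => ⟨hn.ne, fun hlt τ => ?_, fun hle τ => ?_⟩, fun hn => ⟨fun hb τ => ?_,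
      fun hb τ => ?_⟩⟩⟩
  · have e : 0 ≤ s.r 15 0 + s.r 14 0 * τ ↔ -(s.r 15 0 / s.r 14 0) ≤ τ := by
      rw [← neg_div, div_le_iff₀ hp]; constructor <;> intro h <;> linarith
    rw [e]
    constructor
    · rintro ⟨h1, h2⟩; exact ⟨⟨by linarith, h2⟩, h1⟩
    · rintro ⟨⟨h1, h2⟩, h3⟩; exact ⟨h3, h2⟩
  · have e : 0 ≤ s.r 15 0 + s.r 14 0 * τ ↔ -(s.r 15 0 / s.r 14 0) ≤ τ := by
      rw [← neg_div, div_le_iff₀ hp]; constructor <;> intro h <;> linarith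
    rw [e]
    intro h1 h2
    linarith
  · have e : 0 ≤ s.r 15 0 + s.r 14 0 * τ ↔ τ ≤ -(s.r 15 0 / s.r 14 0) := by
      rw [← neg_div, le_div_iff_of_neg hn]; constructor <;> intro h <;> linarith
    rw [e]
    constructor
    · rintro ⟨h1, h2⟩; exact ⟨⟨by linarith, by linarith⟩, h2⟩
    · rintro ⟨⟨h1, h2⟩, h3⟩; exact ⟨h1, h3⟩
  · have e : 0 ≤ s.r 15 0 + s.r 14 0 * τ ↔ τ ≤ -(s.r 15 0 / s.r 14 0) := by
      rw [← neg_div, le_div_iff_of_neg hn]; constructor <;> intro h <;> linarith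
    rw [e]
    intro h1 h2
    linarith
  · have h0 : s.r 14 0 = 0 := le_antisymm hp hn
    rw [h0]
    constructor
    · rintro ⟨h1, h2⟩; linarith
    · rintro ⟨h1, h2⟩; linarith
  · have h0 : s.r 14 0 = 0 := le_antisymm hp hn
    rw [h0]
    intro h1 h2
    linarith

end

/-- Eliminates the parameter `σ` from the constraints `j` and `l` given by the scalars `10`, `11`. -/
def eliminate : SP :=
  .ite (.rlt (.get 10 (.var 10)) 0) .skip (.ite (.rlt 0 (.get 10 (.var 11))) .skip (.block [
    .setr 14 (.get 10 (.var 10) * .get 9 (.var 11) - .get 10 (.var 11) * .get 9 (.var 10)),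
    .setr 15 (.get 10 (.var 10) * .get 11 (.var 11) - .get 10 (.var 11) * .get 11 (.var 10)),
    clip]))

/-- Computes the cone for the orientations in the scalars `7` and `9` and the slot with address in
scalar `13`. -/
def coneProg : SP := .block [constraints, .setr 12 1, .setr 13 2,
  .loop 10 5 5 0 0 (.loop 11 5 5 0 0 eliminate)]

/-- The condition obtained by elimination from the constraints `j` and `l`. -/
def pairCond (s : Mem) (τ : ℝ) (j l : ℕ) : Prop :=
  0 ≤ s.r 10 j → s.r 10 l ≤ 0 →
    0 ≤ s.r 10 j * (s.r 11 l + s.r 9 l * τ) - s.r 10 l * (s.r 11 j + s.r 9 j * τ)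

section
variable {S : Scene} {Z : Sizes} {s : Mem} {Q : Mem → Prop}

lemma wp_eliminate (h : ∀ s', Frame eliminate s s' →
      (∀ τ, τ ∈ window s' ↔ τ ∈ window s ∧ pairCond s τ (s.w 10 0) (s.w 11 0)) → Q s') :
    wp Z eliminate Q s := by
  refine wp_mono Z (fun s' hs' => h s' hs'.2 hs'.1) (wp_frame Z ?_)
  simp [eliminate]
  refine ⟨fun hj τ => ?_, fun hj => ⟨fun hl τ => ?_, fun hl => ?_⟩⟩
  · exact fun _ h' => absurd h' (not_le.2 hj)
  · exact fun _ _ h' => absurd h' (not_le.2 hl)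
  · refine wp_clip fun s' f' h' τ => ?_
    rw [h']
    simp [window, pairCond]
    intro _ _
    refine ⟨fun h _ _ => by linarith, fun h => by linarith [h hj hl]⟩

/-- The window holds the parameters that satisfy all conditions obtained by elimination from the
pairs of constraints in `D`. -/
def Eliminated (D : ℕ → ℕ → Prop) (s : Mem) : Prop :=
  ∀ τ, τ ∈ window s ↔ τ ∈ Set.Icc (1 : ℝ) 2 ∧ ∀ j l, D j l → pairCond s τ j l

lemma pairCond_congr {s s' : Mem} (h9 : s'.r 9 = s.r 9) (h10 : s'.r 10 = s.r 10)
    (h11 : s'.r 11 = s.r 11) (τ : ℝ) (j l : ℕ) : pairCond s' τ j l ↔ pairCond s τ j l := by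
  simp only [pairCond, h9, h10, h11]

lemma wp_coneProg (hS : S.Valid) (hZ : SizesOK S Z) (hE : Env S s) (hi : s.w 5 0 ≤ S.n)
    (hd : s.w 7 0 < S.k) (hc : s.w 9 0 < S.k)
    (h : ∀ s', Frame coneProg s s' →
      Constrained S (s.w 5 0) (slot s (s.w 13 0)) (s.w 7 0) (s.w 9 0) s' →
      window s' = S.cone (s.w 5 0) (slot s (s.w 13 0)) (s.w 7 0) (s.w 9 0) → Q s') :
    wp Z coneProg Q s := by
  refine wp_mono Z (fun s' hs' => h s' hs'.2 hs'.1.1 hs'.1.2) (wp_frame Z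
    (Q := fun s' => Constrained S (s.w 5 0) (slot s (s.w 13 0)) (s.w 7 0) (s.w 9 0) s' ∧
      window s' = S.cone (s.w 5 0) (slot s (s.w 13 0)) (s.w 7 0) (s.w 9 0)) ?_)
  have hV : 5 ≤ Z.V := by
    have := hZ.radix_le; have := hZ.kn_pos; rw [radix_eq] at *; omega
  simp only [coneProg, wp_block_cons]
  refine wp_constraints hS hE hi hd hc fun s1 f1 h1 => ?_
  refine ⟨trivial, by simp, trivial, by simp, ?_⟩
  rw [RE.eval_lit_1, RE.eval_lit_2]
  set s2 := (s1.setR 12 0 1).setR 13 0 2 with hs2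
  have hw : window s2 = Set.Icc 1 2 := by simp [window, hs2]
  refine wp_loop Z (fun j s' => Eliminated (fun j' l => j' < j ∧ l < 5) s') 5 rfl (by simp) hV rfl
    (by simp [WE.reads, show (5 : WE) = .const 5 from rfl]) ?_ ?_ ?_
  · intro τ
    change τ ∈ window s2 ↔ _
    rw [hw]
    simp
  · intro j hj s' hj' f' I'
    refine wp_loop Z (fun l s'' => Eliminated (fun j' l' => (j' < j ∧ l' < 5) ∨ (j' = j ∧ l' < l)) s'')
      5 rfl (by simp) hV rfl (by simp [WE.reads, show (5 : WE) = .const 5 from rfl]) ?_ ?_ ?_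
    · intro τ
      change τ ∈ window s' ↔ _ ∧ ∀ j' l, _ → pairCond s' τ j' l
      simpa using I' τ
    · intro l hl s3 hl3 f3 I3
      refine wp_eliminate fun s4 f4 h4 => ?_
      intro τ
      have e10 : s3.w 10 0 = j := by rw [f3.w 10, hj']
      rw [e10, hl3] at h4
      change τ ∈ window s4 ↔ _
      rw [h4, I3 τ, and_assoc]
      refine and_congr_right fun _ => ?_
      have e : ∀ j l', pairCond (s4.setW 11 0 (l + 1)) τ j l' ↔ pairCond s3 τ j l' := fun j l =>
        pairCond_congr (f4.r 9) (f4.r 10) (f4.r 11) τ j l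
      simp only [e]
      constructor
      · rintro ⟨h5, h6⟩ j' l' hjl
        rcases hjl with hjl | ⟨rfl, hl'⟩
        · exact h5 _ _ (Or.inl hjl)
        · rcases Nat.lt_succ_iff_lt_or_eq.1 hl' with h7 | rfl
          · exact h5 _ _ (Or.inr ⟨rfl, h7⟩)
          · exact h6
      · intro h5
        exact ⟨fun j' l' hjl => h5 _ _ (by omega), h5 _ _ (by omega)⟩
    · intro s3 hl3 f3 I3 τ
      change τ ∈ window s3 ↔ _
      rw [I3 τ]
      have e : ∀ j' l', ((j' < j ∧ l' < 5) ∨ (j' = j ∧ l' < 5)) ↔ (j' < j + 1 ∧ l' < 5) := by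
        intro j' l'; omega
      simp only [e]
      exact Iff.rfl
  · intro s' _ f' I'
    have e9 : s'.r 9 = s1.r 9 := f'.r 9
    have e10 : s'.r 10 = s1.r 10 := f'.r 10
    have e11 : s'.r 11 = s1.r 11 := f'.r 11
    have hcon : Constrained S (s.w 5 0) (slot s (s.w 13 0)) (s.w 7 0) (s.w 9 0) s' := by
      refine ⟨by rw [e10, h1.low], by rw [e10, h1.high], ?_⟩
      simpa only [constraint, e9, e10, e11] using h1.iff
    refine ⟨hcon, Set.ext fun τ => ?_⟩
    rw [I' τ]
    have := exists_iff_pairs (N := 5) (fun j => s'.r 10 j) (fun j => s'.r 11 j + s'.r 9 j * τ)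
      ⟨0, by omega, by simp [hcon.low]⟩ ⟨1, by omega, by simp [hcon.high]⟩
    refine and_congr_right fun _ => ?_
    have e := hcon.iff τ
    simp only [constraint] at e
    simp only [e] at this
    rw [this]
    exact ⟨fun h j hj l hl => h j l ⟨hj, hl⟩, fun h j l hjl => h j hjl.1 l hjl.2⟩

end

end Algo
end LinkTour

/-! ### The reachable points of the next segment -/

namespace LinkTour
open RealRAM

/-- The number of slots for each row and orientation. -/
abbrev Scene.slots (S : Scene) : ℕ := 2 * S.n + 4

/-- The family of the intervals stored in row `ρ`. -/
noncomputable def Scene.row (S : Scene) (s : Mem) (ρ c g : ℕ) : Set ℝ :=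
  open Classical in
  if c < S.k ∧ g < S.slots then slot s (idx3 (16 * S.k * S.n) ρ c g) else ∅

/-- The pointer stored for `(d, g, c)` in row `ρ`. -/
def Scene.ptr (S : Scene) (s : Mem) (ρ d g c : ℕ) : ℕ := s.w 22 (idx4 (16 * S.k * S.n) ρ d g c)

@[simp] lemma row_setW (S : Scene) (s : Mem) (t i v : ℕ) : S.row (s.setW t i v) = S.row s := rfl

lemma row_of_lt {S : Scene} {s : Mem} {ρ c g : ℕ} (hc : c < S.k) (hg : g < S.slots) :
    S.row s ρ c g = slot s (idx3 (16 * S.k * S.n) ρ c g) := if_pos ⟨hc, hg⟩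

lemma row_congr {S : Scene} {s s' : Mem} (h7 : s'.r 7 = s.r 7) (h8 : s'.r 8 = s.r 8) :
    S.row s' = S.row s := by
  funext ρ c g
  simp only [Scene.row, slot, h7, h8]

lemma ptr_congr {S : Scene} {s s' : Mem} (h : s'.w 22 = s.w 22) : S.ptr s' = S.ptr s := by
  funext ρ d g c
  simp only [Scene.ptr, h]

lemma Icc_hull {a b a' b' : ℝ} (h : (Set.Icc a b ∩ Set.Icc a' b').Nonempty) :
    Set.Icc (min a a') (max b b') = Set.Icc a b ∪ Set.Icc a' b' := by
  obtain ⟨x, ⟨h1, h2⟩, h3, h4⟩ := h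
  exact (Set.Icc_union_Icc' (by linarith) (by linarith)).symm

namespace Algo

/-- Adds the window to the slot with number in scalar `14` of the row in scalar `25`, for the
orientation in scalar `9`. -/
def insert : SP := .block [
  .setw 15 (e3 (.var 25) (.var 9) (.var 14)),
  .ite (.rlt (.get 8 (.var 15)) (.get 7 (.var 15) + 1))
    (.block [.rset 7 (.var 15) (.var 12 - 1), .rset 8 (.var 15) (.var 13)])
    (.block [
      .ite (.rlt (.var 12) (.get 7 (.var 15) + 1)) (.rset 7 (.var 15) (.var 12 - 1)) .skip,
      .ite (.rlt (.get 8 (.var 15)) (.var 13)) (.rset 8 (.var 15) (.var 13)) .skip]),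
  .setw 12 1]

section
variable {S : Scene} {Z : Sizes} {s : Mem} {Q : Mem → Prop}

lemma row_eq_addTo (hZ : SizesOK S Z) {s' : Mem} {ρ c T : ℕ} {W : Set ℝ} (hc : c < S.k)
    (hT : T < S.slots) (h7 : ∀ x ≠ idx3 (16 * S.k * S.n) ρ c T, s'.r 7 x = s.r 7 x)
    (h8 : ∀ x ≠ idx3 (16 * S.k * S.n) ρ c T, s'.r 8 x = s.r 8 x)
    (hW : slot s' (idx3 (16 * S.k * S.n) ρ c T) = slot s (idx3 (16 * S.k * S.n) ρ c T) ∪ W) :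
    S.row s' ρ = Scene.addTo (S.row s ρ) c T W ∧ ∀ ρ' ≠ ρ, S.row s' ρ' = S.row s ρ' := by
  have hk := hZ.k_lt
  have hG : S.slots < _ := hZ.G_lt
  constructor
  · funext c' g'
    by_cases h : c' = c ∧ g' = T
    · obtain ⟨rfl, rfl⟩ := h
      rw [Scene.addTo_self, row_of_lt hc hT, row_of_lt hc hT, hW]
    · rw [Scene.addTo_of_ne _ _ h]
      unfold Scene.row
      split_ifs with hb
      · have hne : idx3 (16 * S.k * S.n) ρ c' g' ≠ idx3 (16 * S.k * S.n) ρ c T := fun e =>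
          h ((idx3_inj (by omega) (by omega) (by omega) (by omega)).1 e).2
        simp only [slot, h7 _ hne, h8 _ hne]
      · rfl
  · intro ρ' hρ
    funext c' g'
    unfold Scene.row
    split_ifs with hb
    · have hne : idx3 (16 * S.k * S.n) ρ' c' g' ≠ idx3 (16 * S.k * S.n) ρ c T := fun e =>
          hρ ((idx3_inj (by omega) (by omega) (by omega) (by omega)).1 e).1
      simp only [slot, h7 _ hne, h8 _ hne]
    · rfl

lemma wp_insert (hZ : SizesOK S Z) (hE : Env S s) (hc : s.w 9 0 < S.k) (hT : s.w 14 0 < S.slots)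
    (hρ : s.w 25 0 < 16 * S.k * S.n) (hne : (window s).Nonempty)
    (hcon : S.row s (s.w 25 0) (s.w 9 0) (s.w 14 0) = ∅ ∨
      (S.row s (s.w 25 0) (s.w 9 0) (s.w 14 0) ∩ window s).Nonempty)
    (h : ∀ s', Frame insert s s' → s'.w 12 0 = 1 →
      S.row s' (s.w 25 0) = Scene.addTo (S.row s (s.w 25 0)) (s.w 9 0) (s.w 14 0) (window s) →
      (∀ ρ ≠ s.w 25 0, S.row s' ρ = S.row s ρ) → Q s') :
    wp Z insert Q s := by
  have hk := hZ.k_lt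
  have hG := hZ.G_lt
  have hx := hZ.idx3_le hρ (hc.trans hk) (hT.trans hG)
  refine wp_mono Z (fun s' hs' => h s' hs'.2 hs'.1.1 hs'.1.2.1 hs'.1.2.2) (wp_frame Z
    (Q := fun s' => s'.w 12 0 = 1 ∧
      S.row s' (s.w 25 0) = Scene.addTo (S.row s (s.w 25 0)) (s.w 9 0) (s.w 14 0) (window s) ∧
      (∀ ρ ≠ s.w 25 0, S.row s' ρ = S.row s ρ)) ?_)
  rw [row_of_lt hc hT] at hcon
  have hV1 : 1 ≤ Z.V := by
    have := hZ.radix_le; have := hZ.kn_pos; rw [radix_eq] at *; omega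
  obtain ⟨x0, hx0, hx0'⟩ := hne
  simp only [insert, wp_block_cons, wp_setw, eval_e3, hE.radix, WE.eval_var]
  refine ⟨hx, ?_⟩
  simp
  set x := idx3 (16 * S.k * S.n) (s.w 25 0) (s.w 9 0) (s.w 14 0)
  have key := @row_eq_addTo S Z s hZ
  refine ⟨fun he => ⟨hV1, ?_⟩, fun he => ⟨fun h1 => ⟨fun h2 => ⟨hV1, ?_⟩, fun h2 => ⟨hV1, ?_⟩⟩,
    fun h1 => ⟨fun h2 => ⟨hV1, ?_⟩, fun h2 => ⟨hV1, ?_⟩⟩⟩⟩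
  · refine key hc hT ?_ ?_ ?_
    · intro x' hx'; simp [Mem.setR_r_same, hx', x]
    · intro x' hx'; simp [Mem.setR_r_same, hx', x]
    · simp [slot, x, window, Set.Icc_eq_empty (not_le.2 he)]
  all_goals
    have hne : (slot s x ∩ window s).Nonempty := by
      refine hcon.resolve_left (Set.Nonempty.ne_empty ⟨_, Set.left_mem_Icc.2 he⟩)
    have hu := Icc_hull hne
  · rw [min_eq_right h1.le, max_eq_right h2.le] at hu
    refine key hc hT ?_ ?_ ?_
    · intro x' hx'; simp [Mem.setR_r_same, hx', x]
    · intro x' hx'; simp [Mem.setR_r_same, hx', x]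
    · simpa [slot, Mem.setR_r_same, x, window] using hu
  · rw [min_eq_right h1.le, max_eq_left h2] at hu
    refine key hc hT ?_ ?_ ?_
    · intro x' hx'; simp [Mem.setR_r_same, hx', x]
    · intro x' hx'; simp
    · simpa [slot, Mem.setR_r_same, x, window] using hu
  · rw [min_eq_left h1, max_eq_right h2.le] at hu
    refine key hc hT ?_ ?_ ?_
    · intro x' hx'; simp
    · intro x' hx'; simp [Mem.setR_r_same, hx', x]
    · simpa [slot, Mem.setR_r_same, x, window] using hu
  · rw [min_eq_left h1, max_eq_left h2] at hu
    refine (key (s' := s) hc hT (fun _ _ => rfl) (fun _ _ => rfl) ?_).1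
    simpa [slot, x, window] using hu

end

/-- Computes the cone for the orientations in the scalars `7` and `9` and slot number `8` of the row
in scalar `ρ`. -/
def coneAt (ρ : ℕ) : SP := .block [.setw 13 (e3 (.var ρ) (.var 7) (.var 8)), coneProg]

/-- Fills the row in scalar `25` with the points reached by rays from the row in scalar `23`. -/
def pushAll : SP :=
  .loop 7 (.var 0) 1 1 0 (.loop 8 (.var 4) 6 0 1 (.block [
    .setw 9 (.var 7), .setw 14 (.var 8), coneAt 23, .ite (.rlt (.var 13) (.var 12)) .skip insert]))

/-- Adds the points reached by a turn to a slot that contains them or the same endpoint. -/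
def turnStep : SP := .block [
  coneAt 24, .setw 14 (.get 22 (e4 (.var 23) (.var 7) (.var 8) (.var 9))),
  .ite (.rlt (.var 13) (.var 12)) .skip (.block [
    .ite (.rlt 1 (.var 12))
      (.ite (.rlt (.var 13) 2) .skip (.setw 14 (2 * .var 5 + 2)))
      (.setw 14 (2 * .var 5 + 1)),
    insert])]

/-- Vanishes if and only if the orientations in the scalars `7` and `9` are opposite. -/
def oppTest : RE :=
  (.get 1 (.var 7) + .get 1 (.var 9)) * (.get 1 (.var 7) + .get 1 (.var 9)) +
    (.get 2 (.var 7) + .get 2 (.var 9)) * (.get 2 (.var 7) + .get 2 (.var 9))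

/-- Adds the points reached with one link less to a slot that contains the same endpoint, or, when the
orientations are opposite, to the slot with the same number. -/
def absorbStep : SP := .block [
  .setw 13 (e3 (.var 26) (.var 7) (.var 8)),
  .setr 12 (.get 7 (.var 13) + 1), .setr 13 (.get 8 (.var 13)),
  .ite (.rlt (.var 13) (.var 12)) .skip (.block [
    .setw 16 1,
    .ite (.rlt 1 (.var 12))
      (.ite (.rlt (.var 13) 2)
        (.ite (.rlt 0 oppTest) (.setw 16 0) (.setw 14 (.var 8)))
        (.setw 14 (2 * .var 5 + 2)))
      (.setw 14 (2 * .var 5 + 1)),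
    .ite (.wlt 0 (.var 16)) insert .skip])]

/-- Computes the row in scalar `25` for segment `i + 1`. -/
def level : SP := .block [.setw 12 0, pushAll,
  .loop 7 (.var 0) 1 1 0 (.loop 8 (.var 4) 6 0 1 (.loop 9 (.var 0) 1 1 0 (.block [
    turnStep, absorbStep,
    .wset 22 (e4 (.var 25) (.var 7) (.var 8) (.var 9)) (.var 14)])))]

section
variable {S : Scene} {Z : Sizes} {s s₀ : Mem} {Q : Mem → Prop}

/-- The fixed data of the computation of a level. -/
structure LevelEnv (S : Scene) (s : Mem) (i xa xl ya yl : ℕ) : Prop where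
  env : Env S s
  w5 : s.w 5 0 = i
  w23 : s.w 23 0 = xa
  w24 : s.w 24 0 = xl
  w25 : s.w 25 0 = ya
  w26 : s.w 26 0 = yl

/-- The statement does not write to the cells described by `LevelEnv`. -/
def keepsLevelEnv (P : SP) : Bool :=
  keepsEnv P && !(P.writesW 5 || P.writesW 23 || P.writesW 24 || P.writesW 25 || P.writesW 26)

lemma LevelEnv.frame {i xa xl ya yl : ℕ} {P : SP} {s' : Mem} (h : LevelEnv S s i xa xl ya yl)
    (hf : Frame P s s') (hp : keepsLevelEnv P = true := by rfl) :
    LevelEnv S s' i xa xl ya yl := by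
  simp only [keepsLevelEnv, Bool.and_eq_true, Bool.not_eq_true', Bool.or_eq_false_iff] at hp
  obtain ⟨h0, ⟨⟨⟨h1, h2⟩, h3⟩, h4⟩, h5⟩ := hp
  exact ⟨h.env.frame hf h0, by rw [hf.1 _ h1, h.w5], by rw [hf.1 _ h2, h.w23],
    by rw [hf.1 _ h3, h.w24], by rw [hf.1 _ h4, h.w25], by rw [hf.1 _ h5, h.w26]⟩

lemma LevelEnv.setW {i xa xl ya yl : ℕ} (h : LevelEnv S s i xa xl ya yl) {t j v : ℕ}
    (ht : decide (5 < t ∧ (t < 23 ∨ 26 < t)) = true := by rfl) :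
    LevelEnv S (s.setW t j v) i xa xl ya yl := by
  have ht := of_decide_eq_true ht
  refine ⟨h.env.setW (by simp; omega), ?_, ?_, ?_, ?_, ?_⟩
  · rw [Mem.setW_w_of_ne _ _ _ (by omega), h.w5]
  · rw [Mem.setW_w_of_ne _ _ _ (by omega), h.w23]
  · rw [Mem.setW_w_of_ne _ _ _ (by omega), h.w24]
  · rw [Mem.setW_w_of_ne _ _ _ (by omega), h.w25]
  · rw [Mem.setW_w_of_ne _ _ _ (by omega), h.w26]

/-- Rows and pointers other than those of row `ya` are as in `s₀`, and the scalar `12` tells whether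
row `ya` is empty. -/
structure Rows (S : Scene) (s₀ s : Mem) (ya : ℕ) : Prop where
  row : ∀ ρ ≠ ya, S.row s ρ = S.row s₀ ρ
  ptr : ∀ ρ ≠ ya, ∀ d < S.k, ∀ g < S.slots, ∀ c < S.k, S.ptr s ρ d g c = S.ptr s₀ ρ d g c
  flag : s.w 12 0 = 0 ↔ ∀ c < S.k, ∀ g < S.slots, S.row s ya c g = ∅

lemma Rows.congr {s' : Mem} {ya : ℕ} (h : Rows S s₀ s ya) (h7 : s'.r 7 = s.r 7)
    (h8 : s'.r 8 = s.r 8) (h22 : s'.w 22 = s.w 22) (h12 : s'.w 12 = s.w 12) : Rows S s₀ s' ya := by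
  refine ⟨?_, ?_, ?_⟩
  · rw [row_congr h7 h8]; exact h.row
  · rw [ptr_congr h22]; exact h.ptr
  · rw [row_congr h7 h8, h12]; exact h.flag

lemma Rows.insert {s' : Mem} {ya c T : ℕ} {W : Set ℝ} (h : Rows S s₀ s ya) (hc : c < S.k)
    (hT : T < S.slots) (hW : W.Nonempty) (h22 : s'.w 22 = s.w 22) (h12 : s'.w 12 0 = 1)
    (hy : S.row s' ya = Scene.addTo (S.row s ya) c T W)
    (hr : ∀ ρ ≠ ya, S.row s' ρ = S.row s ρ) : Rows S s₀ s' ya := by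
  refine ⟨fun ρ hρ => by rw [hr ρ hρ, h.row ρ hρ], ?_, ?_⟩
  · rw [ptr_congr h22]; exact h.ptr
  · rw [h12]
    refine iff_of_false (by omega) fun he => ?_
    have := he c hc T hT
    rw [hy, Scene.addTo_self] at this
    exact hW.ne_empty (Set.union_empty_iff.1 this).2

/-- The loop rule for a loop over the orientations. -/
lemma wp_loop_orientations (hZ : SizesOK S Z) (hE : Env S s) {t : ℕ} {P : SP} (I : ℕ → Mem → Prop)
    (ht : P.writesW t = false) (ht0 : (SP.loop t (.var 0) 1 1 0 P).writesW 0 = false)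
    (h0 : I 0 (s.setW t 0 0))
    (hstep : ∀ i < S.k, ∀ s', s'.w t 0 = i → Frame (.loop t (.var 0) 1 1 0 P) s s' → I i s' →
      wp Z P (fun s'' => I (i + 1) (s''.setW t 0 (i + 1))) s')
    (hend : ∀ s', Frame (.loop t (.var 0) 1 1 0 P) s s' → I S.k s' → Q s') :
    wp Z (.loop t (.var 0) 1 1 0 P) Q s :=
  wp_loop Z I S.k hE.k (by rw [hZ.k]; simp) (hZ.k_lt.le.trans hZ.radix_le) ht
    (by
      intro t' ht'
      simp only [WE.reads, WE.var, Bool.or_eq_true, beq_iff_eq] at ht'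
      rcases ht' with rfl | h
      · exact ht0
      · cases h) h0 hstep fun s' _ => hend s'

/-- The loop rule for a loop over the slots. -/
lemma wp_loop_slots (hZ : SizesOK S Z) (hE : Env S s) {t : ℕ} {P : SP} (I : ℕ → Mem → Prop)
    (ht : P.writesW t = false) (ht4 : (SP.loop t (.var 4) 6 0 1 P).writesW 4 = false)
    (h0 : I 0 (s.setW t 0 0))
    (hstep : ∀ i < S.slots, ∀ s', s'.w t 0 = i → Frame (.loop t (.var 4) 6 0 1 P) s s' → I i s' →
      wp Z P (fun s'' => I (i + 1) (s''.setW t 0 (i + 1))) s')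
    (hend : ∀ s', Frame (.loop t (.var 4) 6 0 1 P) s s' → I S.slots s' → Q s') :
    wp Z (.loop t (.var 4) 6 0 1 P) Q s :=
  wp_loop Z I S.slots hE.slots (by have := hZ.npos; rw [hZ.n]; simp [Scene.slots]; omega)
    (hZ.G_lt.le.trans hZ.radix_le) ht
    (by
      intro t' ht'
      simp only [WE.reads, WE.var, Bool.or_eq_true, beq_iff_eq] at ht'
      rcases ht' with rfl | h
      · exact ht4
      · cases h) h0 hstep fun s' _ => hend s'

lemma wp_coneAt (hS : S.Valid) (hZ : SizesOK S Z) (hE : Env S s) {ρ : ℕ}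
    (hi : s.w 5 0 ≤ S.n) (hd : s.w 7 0 < S.k) (hg : s.w 8 0 < S.slots)
    (hc : s.w 9 0 < S.k) (hr : s.w ρ 0 < 16 * S.k * S.n)
    (h : ∀ s', Frame (coneAt ρ) s s' →
      Constrained S (s.w 5 0) (S.row s (s.w ρ 0) (s.w 7 0) (s.w 8 0)) (s.w 7 0) (s.w 9 0) s' →
      window s' = S.cone (s.w 5 0) (S.row s (s.w ρ 0) (s.w 7 0) (s.w 8 0)) (s.w 7 0) (s.w 9 0) →
      Q s') :
    wp Z (coneAt ρ) Q s := by
  refine wp_mono Z (fun s' hs' => h s' hs'.2 hs'.1.1 hs'.1.2) (wp_frame Z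
    (Q := fun s' =>
      Constrained S (s.w 5 0) (S.row s (s.w ρ 0) (s.w 7 0) (s.w 8 0)) (s.w 7 0) (s.w 9 0) s' ∧
      window s' = S.cone (s.w 5 0) (S.row s (s.w ρ 0) (s.w 7 0) (s.w 8 0)) (s.w 7 0) (s.w 9 0)) ?_)
  have hk := hZ.k_lt
  have hG : S.slots < _ := hZ.G_lt
  have hx := hZ.idx3_le hr (hd.trans hk) (hg.trans hG)
  simp only [coneAt, wp_block_cons, wp_setw, WE.eval_var, eval_e3, hE.radix]
  refine ⟨hx, wp_coneProg hS hZ hE.setW ?_ ?_ ?_ fun s' f' hcon hw => ?_⟩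
  · simpa using hi
  · simpa using hd
  · simpa using hc
  · simp only [Mem.setW_w_self, Mem.setW_w_of_ne, ne_eq, Nat.reduceEqDiff,
      not_false_eq_true] at hcon hw
    rw [row_of_lt hd hg]
    exact ⟨hcon, hw⟩

/-- Row `ya` holds the rays from the slots of row `xa` in `D`. -/
def Filled (S : Scene) (s₀ : Mem) (i xa : ℕ) (D : ℕ → ℕ → Prop) (s : Mem) (ya : ℕ) : Prop :=
  ∀ c g, S.row s ya c g = {τ | D c g ∧ τ ∈ S.cone i (S.row s₀ xa c g) c c}

lemma wp_pushAll (hS : S.Valid) (hZ : SizesOK S Z) {i xa xl ya yl : ℕ}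
    (hE : LevelEnv S s i xa xl ya yl) (hi : i ≤ S.n) (hxa : xa < 16 * S.k * S.n)
    (hya : ya < 16 * S.k * S.n) (hne : xa ≠ ya) (hempty : S.row s ya = fun _ _ => ∅)
    (hflag : s.w 12 0 = 0)
    (h : ∀ s', Frame pushAll s s' → Rows S s s' ya →
      (S.row s' ya = fun c g => S.cone i (S.row s xa c g) c c) → Q s') :
    wp Z pushAll Q s := by
  have hk := hZ.k_lt
  have hG : S.slots < _ := hZ.G_lt
  refine wp_mono Z (fun s' hs' => h s' hs'.2 hs'.1.1 hs'.1.2) (wp_frame Z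
    (Q := fun s' => Rows S s s' ya ∧ S.row s' ya = fun c g => S.cone i (S.row s xa c g) c c) ?_)
  refine wp_loop_orientations hZ hE.env (fun d s' => Rows S s s' ya ∧
    Filled S s i xa (fun c g => c < d ∧ g < S.slots) s' ya) rfl rfl ?_ ?_ ?_
  · refine ⟨⟨fun _ _ => rfl, fun _ _ _ _ _ _ _ _ => rfl, ?_⟩, fun c g => ?_⟩
    all_goals rw [row_setW]
    · have : (s.setW 7 0 0).w 12 0 = 0 := by simpa using hflag
      rw [this]
      refine iff_of_true rfl fun c _ g _ => ?_
      exact congrFun (congrFun hempty c) g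
    · simpa using congrFun (congrFun hempty c) g
  · rintro d hd s1 hd1 f1 ⟨r1, F1⟩
    have E1 := hE.frame f1
    refine wp_loop_slots hZ E1.env (fun g s' => Rows S s s' ya ∧
      Filled S s i xa (fun c g' => (c < d ∧ g' < S.slots) ∨ (c = d ∧ g' < g)) s' ya) rfl rfl ?_ ?_ ?_
    · refine ⟨r1.congr rfl rfl (by simp) (by simp), fun c g => ?_⟩
      simpa using F1 c g
    · rintro g hg s2 hg2 f2 ⟨r2, F2⟩
      have E2 := E1.frame f2
      have hd2 : s2.w 7 0 = d := by rw [f2.w 7, hd1]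
      have hxa2 : S.row s2 xa = S.row s xa := r2.row xa hne
      simp only [wp_block_cons, wp_setw, WE.eval_var]
      refine ⟨by rw [hd2]; exact (hd.trans hk).le.trans hZ.radix_le, by
        simp [hg2]; exact (hg.trans hG).le.trans hZ.radix_le, ?_⟩
      have E3 : LevelEnv S ((s2.setW 9 0 (s2.w 7 0)).setW 14 0 ((s2.setW 9 0 (s2.w 7 0)).w 8 0))
        i xa xl ya yl := E2.setW.setW
      have R3 : Rows S s ((s2.setW 9 0 (s2.w 7 0)).setW 14 0 ((s2.setW 9 0 (s2.w 7 0)).w 8 0)) ya :=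
        r2.congr rfl rfl (by simp) (by simp)
      refine wp_coneAt hS hZ E3.env (by rw [E3.w5]; exact hi) (by simpa [hd2] using hd)
        (by simpa [hg2] using hg) (by simpa [hd2] using hd) (by rw [E3.w23]; exact hxa)
        fun s3 f3 hcon hw => ?_
      simp only [E3.w5, E3.w23] at hw
      simp [hd2, hg2, hxa2] at hw
      have E4 := E3.frame f3
      have R4 := R3.congr (f3.r 7) (f3.r 8) (f3.w 22) (f3.w 12)
      have e9 : s3.w 9 0 = d := by rw [f3.w 9]; simp [hd2]
      have e14 : s3.w 14 0 = g := by rw [f3.w 14]; simp [hg2]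
      have er : S.row s3 ya = S.row s2 ya := by rw [row_congr (f3.r 7) (f3.r 8)]; rfl
      have upd : ∀ c g', ((c < d ∧ g' < S.slots) ∨ (c = d ∧ g' < g + 1)) ↔
          ((c < d ∧ g' < S.slots) ∨ (c = d ∧ g' < g)) ∨ (c = d ∧ g' = g) := by intros; omega
      refine ⟨by simp, fun he => ?_, fun he => ?_⟩
      · refine ⟨R4.congr rfl rfl (by simp) (by simp), fun c g' => ?_⟩
        have hw0 : S.cone i (S.row s xa d g) d d = ∅ := by
          rw [← hw]; exact Set.Icc_eq_empty (not_le.2 he)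
        rw [row_setW, er, F2 c g']
        ext τ
        simp only [upd, Set.mem_ofPred_eq]
        constructor
        · exact fun h => ⟨Or.inl h.1, h.2⟩
        · rintro ⟨h1 | ⟨rfl, rfl⟩, h2⟩
          · exact ⟨h1, h2⟩
          · rw [hw0] at h2; exact h2.elim
      · have hwn : (window s3).Nonempty := Set.nonempty_Icc.2 (not_lt.1 he)
        refine wp_insert hZ E4.env (by rw [e9]; exact hd) (by rw [e14]; exact hg)
          (by rw [E4.w25]; exact hya) hwn (Or.inl ?_) fun s4 f4 h12 hrow hrow' => ?_
        · rw [E4.w25, e9, e14, er, F2]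
          simp
        · rw [E4.w25, e9, e14] at hrow
          rw [E4.w25] at hrow'
          have R5 := R4.insert hd hg hwn (f4.w 22) h12 hrow hrow'
          refine ⟨R5.congr rfl rfl (by simp) (by simp), fun c g' => ?_⟩
          rw [row_setW, hrow, er, hw]
          ext τ
          simp only [upd, Set.mem_ofPred_eq]
          by_cases hcg : c = d ∧ g' = g
          · obtain ⟨rfl, rfl⟩ := hcg
            rw [Scene.addTo_self, F2]
            simp
          · rw [Scene.addTo_of_ne _ _ hcg, F2]
            simp [hcg]
    · rintro s2 f2 ⟨r2, F2⟩
      refine ⟨r2.congr rfl rfl (by simp) (by simp), fun c g => ?_⟩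
      refine (F2 c g).trans ?_
      congr 1
      funext τ
      refine congrArg (· ∧ _) (propext ?_)
      omega
  · rintro s1 f1 ⟨r1, F1⟩
    refine ⟨r1, ?_⟩
    funext c g
    rw [F1]
    by_cases hb : c < S.k ∧ g < S.slots
    · simp [hb]
    · simp [hb, Scene.row, Scene.cone]

end

end Algo
end LinkTour

/-! ### Correctness of the computation of a level -/

namespace LinkTour
open RealRAM
namespace Algo

section
variable {S : Scene} {Z : Sizes} {s s₀ : Mem} {Q : Mem → Prop}

/-- Invariant of the computation of row `ya`, when the triples in `Done` have been treated. -/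
structure TInv (S : Scene) (s₀ : Mem) (i m xa xl ya yl : ℕ) (Done Done' : ℕ → ℕ → ℕ → Prop)
    (s : Mem) : Prop where
  env : LevelEnv S s i xa xl ya yl
  rows : Rows S s₀ s ya
  finv : S.FInv S.slots i m (S.row s₀ xa) (S.row s₀ yl) Done' (S.row s ya)
  turn : ∀ d < S.k, ∀ g < S.slots, ∀ c < S.k, Done d g c →
    ∃ g' < S.slots, S.cone i (S.row s₀ xl d g) d c ⊆ S.row s ya c g'
  absorb : ∀ d < S.k, ∀ g < S.slots, ∀ c < S.k, Done d g c →
    S.row s₀ yl d g ⊆ S.row s ya c (S.ptr s ya d g c) ∧ S.ptr s ya d g c < 2 * i + 3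

/-- The treatment of the triple `(d, g, c)`. -/
structure AtTriple (s : Mem) (d g c : ℕ) : Prop where
  w7 : s.w 7 0 = d
  w8 : s.w 8 0 = g
  w9 : s.w 9 0 = c

/-- The statement does not write to the cells described by `AtTriple`. -/
def keepsTriple (P : SP) : Bool := !(P.writesW 7 || P.writesW 8 || P.writesW 9)

lemma AtTriple.frame {d g c : ℕ} {P : SP} {s' : Mem} (h : AtTriple s d g c)
    (hf : Frame P s s') (hp : keepsTriple P = true := by rfl) : AtTriple s' d g c := by
  simp only [keepsTriple, Bool.not_eq_true', Bool.or_eq_false_iff] at hp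
  exact ⟨by rw [hf.1 _ hp.1.1, h.w7], by rw [hf.1 _ hp.1.2, h.w8], by rw [hf.1 _ hp.2, h.w9]⟩

lemma AtTriple.setW {d g c : ℕ} (h : AtTriple s d g c) {t j v : ℕ}
    (ht : decide (9 < t) = true := by rfl) : AtTriple (s.setW t j v) d g c := by
  have ht := of_decide_eq_true ht
  refine ⟨?_, ?_, ?_⟩
  · rw [Mem.setW_w_of_ne _ _ _ (by omega), h.w7]
  · rw [Mem.setW_w_of_ne _ _ _ (by omega), h.w8]
  · rw [Mem.setW_w_of_ne _ _ _ (by omega), h.w9]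

variable {i m xa xl ya yl : ℕ} {Done Done' Done'' : ℕ → ℕ → ℕ → Prop}

lemma TInv.congr {s' : Mem} (h : TInv S s₀ i m xa xl ya yl Done Done' s)
    (hE : LevelEnv S s' i xa xl ya yl) (h7 : s'.r 7 = s.r 7)
    (h8 : s'.r 8 = s.r 8) (h22 : s'.w 22 = s.w 22) (h12 : s'.w 12 = s.w 12) :
    TInv S s₀ i m xa xl ya yl Done Done' s' := by
  refine ⟨hE, h.rows.congr h7 h8 h22 h12, ?_, ?_, ?_⟩
  · rw [row_congr h7 h8]; exact h.finv
  · rw [row_congr h7 h8]; exact h.turn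
  · rw [row_congr h7 h8, ptr_congr h22]; exact h.absorb

/-- Insertion of a set into a slot maintains the invariant. -/
lemma TInv.insert {s' : Mem} (h : TInv S s₀ i m xa xl ya yl Done Done' s)
    (hE : LevelEnv S s' i xa xl ya yl) {c T : ℕ} {W : Set ℝ} (hc : c < S.k) (hT : T < S.slots)
    (hW : W.Nonempty) (hF : S.FInv S.slots i m (S.row s₀ xa) (S.row s₀ yl) Done''
      (Scene.addTo (S.row s ya) c T W)) (h22 : s'.w 22 = s.w 22) (h12 : s'.w 12 0 = 1)
    (hy : S.row s' ya = Scene.addTo (S.row s ya) c T W)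
    (hr : ∀ ρ ≠ ya, S.row s' ρ = S.row s ρ) :
    TInv S s₀ i m xa xl ya yl Done Done'' s' := by
  refine ⟨hE, h.rows.insert hc hT hW h22 h12 hy hr, by rw [hy]; exact hF, ?_, ?_⟩
  · intro d hd g hg c' hc' hD
    obtain ⟨g', hg', h1⟩ := h.turn d hd g hg c' hc' hD
    exact ⟨g', hg', h1.trans (by rw [hy]; exact Scene.subset_addTo _ _ _ _ _ _)⟩
  · intro d hd g hg c' hc' hD
    rw [ptr_congr h22]
    obtain ⟨h1, h2⟩ := h.absorb d hd g hg c' hc' hD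
    exact ⟨h1.trans (by rw [hy]; exact Scene.subset_addTo _ _ _ _ _ _), h2⟩

/-- What is assumed about the rows from which row `ya` is computed. -/
structure LevelPre (S : Scene) (Z : Sizes) (s₀ : Mem) (i m xa xl ya yl : ℕ) : Prop where
  valid : S.Valid
  sizes : SizesOK S Z
  hyp : S.LevelHyp S.slots i m (S.row s₀ xa) (S.row s₀ xl) (S.row s₀ yl) (S.ptr s₀ xa)
  xa_lt : xa < 16 * S.k * S.n
  xl_lt : xl < 16 * S.k * S.n
  ya_lt : ya < 16 * S.k * S.n
  yl_lt : yl < 16 * S.k * S.n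
  xa_ne : xa ≠ ya
  xl_ne : xl ≠ ya
  yl_ne : yl ≠ ya

lemma mem_Icc_left_iff {a b : ℝ} (h : (Set.Icc a b).Nonempty) (hs : Set.Icc a b ⊆ Set.Icc 1 2) :
    (1 : ℝ) ∈ Set.Icc a b ↔ a ≤ 1 :=
  ⟨fun h => h.1, fun h1 => ⟨h1, (hs (Set.right_mem_Icc.2 (Set.nonempty_Icc.1 h))).1⟩⟩

lemma mem_Icc_right_iff {a b : ℝ} (h : (Set.Icc a b).Nonempty) (hs : Set.Icc a b ⊆ Set.Icc 1 2) :
    (2 : ℝ) ∈ Set.Icc a b ↔ 2 ≤ b :=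
  ⟨fun h => h.2, fun h1 => ⟨(hs (Set.left_mem_Icc.2 (Set.nonempty_Icc.1 h))).2, h1⟩⟩

lemma wp_turnStep (L : LevelPre S Z s₀ i m xa xl ya yl) {d g c : ℕ} (hd : d < S.k)
    (hg : g < S.slots) (hc : c < S.k) (hA : AtTriple s d g c)
    (H : TInv S s₀ i m xa xl ya yl Done Done s)
    (h : ∀ s', Frame turnStep s s' → TInv S s₀ i m xa xl ya yl Done Done s' →
      s'.w 14 0 < 2 * i + 3 → S.cone i (S.row s₀ xl d g) d c ⊆ S.row s' ya c (s'.w 14 0) → Q s') :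
    wp Z turnStep Q s := by
  have hk := L.sizes.k_lt
  have hG : S.slots < _ := L.sizes.G_lt
  have hMV := L.sizes.radix_le
  have hi := L.hyp.hi
  refine wp_mono Z (fun s' hs' => h s' hs'.2 hs'.1.1 hs'.1.2.1 hs'.1.2.2) (wp_frame Z
    (Q := fun s' => TInv S s₀ i m xa xl ya yl Done Done s' ∧
      s'.w 14 0 < 2 * i + 3 ∧ S.cone i (S.row s₀ xl d g) d c ⊆ S.row s' ya c (s'.w 14 0)) ?_)
  simp only [turnStep, wp_block_cons]
  have E := H.env
  refine wp_coneAt L.valid L.sizes E.env (by rw [E.w5]; exact hi)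
    (by rw [hA.w7]; exact hd) (by rw [hA.w8]; exact hg) (by rw [hA.w9]; exact hc)
    (by rw [E.w24]; exact L.xl_lt) fun s1 f1 _ hw => ?_
  rw [E.w5, E.w24, hA.w7, hA.w8, hA.w9, H.rows.row xl L.xl_ne] at hw
  have A1 := hA.frame f1
  have H1 := H.congr (E.frame f1) (f1.r 7) (f1.r 8) (f1.w 22) (f1.w 12)
  have E1 := H1.env
  have hptr : s1.w 22 (idx4 (16 * S.k * S.n) xa d g c) = S.ptr s₀ xa d g c := by
    rw [← H1.rows.ptr xa L.xa_ne d hd g hg c hc]; rfl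
  have hΦ := L.hyp.ptr d hd g hg c hc
  simp [E1.env.radix, E1.w23, E1.w5, A1.w7, A1.w8, A1.w9, hptr]
  refine ⟨by simp only [Scene.slots] at hG; omega, fun he => ?_, fun he => ?_⟩
  · have : S.cone i (S.row s₀ xl d g) d c = ∅ := by
      rw [← hw]; exact Set.Icc_eq_empty (not_le.2 he)
    refine ⟨H1.congr E1.setW rfl rfl (by simp) (by simp), by omega, by simp [this]⟩
  have hne : (window s1).Nonempty := Set.nonempty_Icc.2 he
  have hsub : window s1 ⊆ Set.Icc 1 2 := by rw [hw]; exact Scene.cone_subset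
  have e1 := mem_Icc_left_iff hne hsub
  have e2 := mem_Icc_right_iff hne hsub
  change (1 : ℝ) ∈ window s1 ↔ _ at e1
  change (2 : ℝ) ∈ window s1 ↔ _ at e2
  -- the common part of the three cases
  have key : ∀ s2, s2.r = s1.r → s2.w 22 = s1.w 22 → s2.w 12 = s1.w 12 →
      LevelEnv S s2 i xa xl ya yl → AtTriple s2 d g c →
      ((s2.w 14 0 = 2 * i + 1 ∧ 1 ∈ window s1) ∨ (s2.w 14 0 = 2 * i + 2 ∧ 2 ∈ window s1) ∨
        (s2.w 14 0 = S.ptr s₀ xa d g c ∧ 1 ∉ window s1 ∧ 2 ∉ window s1)) →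
      wp Z insert (fun s' => TInv S s₀ i m xa xl ya yl Done Done s' ∧
        s'.w 14 0 < 2 * i + 3 ∧ S.cone i (S.row s₀ xl d g) d c ⊆ S.row s' ya c (s'.w 14 0)) s2 := by
    intro s2 hr h22 h12 E2 A2 hT
    have H2 := H1.congr E2 (by rw [hr]) (by rw [hr]) h22 h12
    have hw2 : window s2 = S.cone i (S.row s₀ xl d g) d c := by rw [← hw]; simp only [window, hr]
    rw [hw] at hT
    obtain ⟨hT1, hT2, hT3⟩ := L.hyp.turn H2.finv (fun _ _ _ h => h) hd hg hc (hw ▸ hne) hT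
    have hT4 : s2.w 14 0 < S.slots := by simp only [Scene.slots]; omega
    refine wp_insert L.sizes E2.env (by rw [A2.w9]; exact hc) hT4 (by rw [E2.w25]; exact L.ya_lt)
      (by rw [hw2, ← hw]; exact hne) (by rw [E2.w25, A2.w9, hw2]; exact hT2)
      fun s3 f3 h12 hrow hrow' => ?_
    rw [E2.w25, A2.w9, hw2] at hrow
    rw [E2.w25] at hrow'
    refine ⟨H2.insert (E2.frame f3) hc hT4 (hw ▸ hne) hT3 (f3.w 22) h12 hrow hrow', ?_, ?_⟩
    · rw [f3.w 14]; exact hT1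
    · rw [f3.w 14, hrow, Scene.addTo_self]; exact Set.subset_union_right
  refine ⟨fun h1 => ⟨fun h2 => ?_, fun h2 => ⟨?_, ?_⟩⟩, fun h1 => ⟨?_, ?_⟩⟩
  · refine key _ rfl (by simp) (by simp) E1.setW A1.setW (Or.inr (Or.inr ⟨by simp, ?_, ?_⟩))
    · rw [e1]; linarith
    · rw [e2]; linarith
  · simp only [Scene.slots] at hG; omega
  · exact key _ rfl (by simp) (by simp) E1.setW.setW A1.setW.setW (Or.inr (Or.inl ⟨by simp, e2.2 h2⟩))
  · simp only [Scene.slots] at hG; omega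
  · exact key _ rfl (by simp) (by simp) E1.setW.setW A1.setW.setW (Or.inl ⟨by simp, e1.2 h1⟩)

lemma oppTest_eq (hE : Env S s) {d c : ℕ} (hd : d < S.k) (hc : c < S.k)
    (h7 : s.w 7 0 = d) (h9 : s.w 9 0 = c) : 0 < oppTest.eval s ↔ S.dir d ≠ -S.dir c := by
  simp only [oppTest, RE.eval_add, RE.eval_mul, RE.eval_get, WE.eval_var, h7, h9, hE.dx d hd,
    hE.dy d hd, hE.dx c hc, hE.dy c hc]
  rw [← not_iff_not, not_not, not_lt]
  constructor
  · intro h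
    refine Prod.ext ?_ ?_ <;> simp only [Prod.fst_neg, Prod.snd_neg] <;> nlinarith
  · intro h
    rw [h]
    simp

lemma wp_absorbStep (L : LevelPre S Z s₀ i m xa xl ya yl) {d g c : ℕ} (hd : d < S.k)
    (hg : g < S.slots) (hc : c < S.k) (hA : AtTriple s d g c)
    (H : TInv S s₀ i m xa xl ya yl Done Done s) (hD : ∀ d g c, Done d g c → Done' d g c)
    (hnd : ¬ Done d g c) (hd' : Done' d g c) (hT0 : s.w 14 0 < 2 * i + 3)
    (hT1 : S.cone i (S.row s₀ xl d g) d c ⊆ S.row s ya c (s.w 14 0))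
    (h : ∀ s', Frame absorbStep s s' → TInv S s₀ i m xa xl ya yl Done Done' s' →
      (∃ g' < S.slots, S.cone i (S.row s₀ xl d g) d c ⊆ S.row s' ya c g') →
      s'.w 14 0 < 2 * i + 3 → S.row s₀ yl d g ⊆ S.row s' ya c (s'.w 14 0) → Q s') :
    wp Z absorbStep Q s := by
  have hk := L.sizes.k_lt
  have hG : S.slots < _ := L.sizes.G_lt
  have hMV := L.sizes.radix_le
  have hi := L.hyp.hi
  refine wp_mono Z (fun s' hs' => h s' hs'.2 hs'.1.1 hs'.1.2.1 hs'.1.2.2.1 hs'.1.2.2.2) (wp_frame Z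
    (Q := fun s' => TInv S s₀ i m xa xl ya yl Done Done' s' ∧
      (∃ g' < S.slots, S.cone i (S.row s₀ xl d g) d c ⊆ S.row s' ya c g') ∧
      s'.w 14 0 < 2 * i + 3 ∧ S.row s₀ yl d g ⊆ S.row s' ya c (s'.w 14 0)) ?_)
  have E := H.env
  have hx := L.sizes.idx3_le L.yl_lt (hd.trans hk) (hg.trans hG)
  have hyl : S.row s yl d g = S.row s₀ yl d g := by rw [H.rows.row yl L.yl_ne]
  rw [row_of_lt hd hg] at hyl
  simp only [absorbStep, wp_block_cons, wp_setw, WE.eval_var, eval_e3, E.env.radix, E.w26, hA.w7,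
    hA.w8]
  refine ⟨hx, ?_⟩
  set x := idx3 (16 * S.k * S.n) yl d g
  simp only [wp_setr, RE.safe_add, RE.safe_get, RE.safe_lit_1, RE.eval_add, RE.eval_get,
    RE.eval_lit_1, WE.eval_var, Mem.setW_w_self, Mem.setW_r]
  refine ⟨⟨by simp, trivial⟩, by simp, by simp, by simp, ?_⟩
  simp only [RE.eval_get, WE.eval_var, WE.eval_lit_0, Mem.setR_w, Mem.setW_w_self,
    Mem.setR_r_of_ne, Mem.setW_r, ne_eq, Nat.reduceEqDiff, not_false_eq_true]
  obtain ⟨s1, hs1⟩ : ∃ s1, s1 = ((s.setW 13 0 x).setR 12 0 (s.r 7 x + 1)).setR 13 0 (s.r 8 x) :=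
    ⟨_, rfl⟩
  rw [← hs1]
  have hw : window s1 = S.row s₀ yl d g := by rw [← hyl, hs1]; simp [window, slot]
  have E1 : LevelEnv S s1 i xa xl ya yl := by
    rw [hs1]
    exact ⟨E.env.setW.setR.setR, by simp [E.w5], by simp [E.w23], by simp [E.w24], by simp [E.w25],
      by simp [E.w26]⟩
  have A1 : AtTriple s1 d g c := by rw [hs1]; exact ⟨by simp [hA.w7], by simp [hA.w8], by simp [hA.w9]⟩
  have H1 : TInv S s₀ i m xa xl ya yl Done Done s1 :=
    H.congr E1 (by simp [hs1]) (by simp [hs1]) (by simp [hs1]) (by simp [hs1])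
  have h14 : s1.w 14 = s.w 14 := by simp [hs1]
  rw [← row_congr (s := s) (s' := s1) (by simp [hs1]) (by simp [hs1]), ← h14] at hT1
  rw [← h14] at hT0
  clear_value x
  clear hs1 h14
  have opp := fun s2 (hE2 : Env S s2) (A2 : AtTriple s2 d g c) =>
    oppTest_eq hE2 hd hc A2.w7 A2.w9
  have hG' : S.slots = 2 * S.n + 4 := rfl
  have mono : ∀ {s' : Mem}, TInv S s₀ i m xa xl ya yl Done Done s' →
      TInv S s₀ i m xa xl ya yl Done Done' s' := fun h =>
    ⟨h.env, h.rows, h.finv.mono hD, h.turn, h.absorb⟩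
  refine ⟨by simp, fun he => ?_, fun he => ?_⟩
  · have h0 : S.row s₀ yl d g = ∅ := by
      rw [← hw]; exact Set.Icc_eq_empty (not_le.2 he)
    exact ⟨mono H1, ⟨_, by omega, hT1⟩, hT0, by simp [h0]⟩
  have hne : (window s1).Nonempty := Set.nonempty_Icc.2 (not_lt.1 he)
  have hsub : window s1 ⊆ Set.Icc 1 2 := by
    rw [hw]; exact fun τ hτ => (L.hyp.reachY hd hg hτ).1
  have e1 := mem_Icc_left_iff hne hsub
  have e2 := mem_Icc_right_iff hne hsub
  change (1 : ℝ) ∈ window s1 ↔ _ at e1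
  change (2 : ℝ) ∈ window s1 ↔ _ at e2
  have key : ∀ s2, s2.r = s1.r → s2.w 22 = s1.w 22 → s2.w 12 = s1.w 12 →
      LevelEnv S s2 i xa xl ya yl → AtTriple s2 d g c →
      ((s2.w 14 0 = 2 * i + 1 ∧ 1 ∈ window s1) ∨ (s2.w 14 0 = 2 * i + 2 ∧ 2 ∈ window s1) ∨
        (s2.w 14 0 = g ∧ S.dir d = -S.dir c ∧ 1 ∉ window s1 ∧ 2 ∉ window s1)) →
      wp Z insert (fun s' => TInv S s₀ i m xa xl ya yl Done Done' s' ∧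
      (∃ g' < S.slots, S.cone i (S.row s₀ xl d g) d c ⊆ S.row s' ya c g') ∧
      s'.w 14 0 < 2 * i + 3 ∧ S.row s₀ yl d g ⊆ S.row s' ya c (s'.w 14 0)) s2 := by
    intro s2 hr h22 h12 E2 A2 hT
    have H2 := H1.congr E2 (by rw [hr]) (by rw [hr]) h22 h12
    have hw2 : window s2 = S.row s₀ yl d g := by rw [← hw]; simp only [window, hr]
    rw [hw] at hT
    obtain ⟨hT1', hT2, hT3⟩ :=
      L.hyp.absorb L.valid H2.finv hD hd hg hc hnd hd' (hw ▸ hne) hT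
    have hT4 : s2.w 14 0 < S.slots := by omega
    refine wp_insert L.sizes E2.env (by rw [A2.w9]; exact hc) hT4 (by rw [E2.w25]; exact L.ya_lt)
      (by rw [hw2, ← hw]; exact hne) (by rw [E2.w25, A2.w9, hw2]; exact hT2)
      fun s3 f3 h12 hrow hrow' => ?_
    rw [E2.w25, A2.w9, hw2] at hrow
    rw [E2.w25] at hrow'
    refine ⟨H2.insert (E2.frame f3) hc hT4 (hw ▸ hne) hT3 (f3.w 22) h12 hrow hrow',
      ⟨s1.w 14 0, by omega, ?_⟩, ?_, ?_⟩
    · rw [hrow, row_congr (s := s1) (s' := s2) (by rw [hr]) (by rw [hr])]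
      exact hT1.trans (Scene.subset_addTo _ _ _ _ _ _)
    · rw [f3.w 14]; exact hT1'
    · rw [f3.w 14, hrow, Scene.addTo_self]; exact Set.subset_union_right
  have opp1 := opp (s1.setW 16 0 1) E1.env.setW A1.setW
  simp [E1.w5, A1.w8, opp1]
  refine ⟨by omega, fun h1 => ⟨fun h2 => ⟨?_, fun hop => ?_, fun hop => ⟨?_, ?_⟩⟩,
    fun h2 => ⟨?_, ?_⟩⟩, fun h1 => ⟨?_, ?_⟩⟩
  · simp [oppTest]
  · have n1 : (1 : ℝ) ∉ window s1 := by rw [e1]; linarith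
    have n2 : (2 : ℝ) ∉ window s1 := by rw [e2]; linarith
    refine ⟨mono (H1.congr E1.setW.setW rfl rfl (by simp) (by simp)), ⟨_, by omega, hT1⟩, hT0, ?_⟩
    rw [hw] at n1 n2
    exact (L.hyp.subset_turn L.valid hd hg hc hop n1 n2).trans hT1
  · omega
  · refine key _ rfl (by simp) (by simp) E1.setW.setW A1.setW.setW
      (Or.inr (Or.inr ⟨by simp, hop, ?_, ?_⟩))
    · rw [e1]; linarith
    · rw [e2]; linarith
  · omega
  · exact key _ rfl (by simp) (by simp) E1.setW.setW A1.setW.setW (Or.inr (Or.inl ⟨by simp, e2.2 h2⟩))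
  · omega
  · exact key _ rfl (by simp) (by simp) E1.setW.setW A1.setW.setW (Or.inl ⟨by simp, e1.2 h1⟩)

/-- The triples that precede `(d₀, g₀, c₀)` lexicographically. -/
def Before (d₀ g₀ c₀ : ℕ) (d g c : ℕ) : Prop :=
  d < d₀ ∨ (d = d₀ ∧ (g < g₀ ∨ (g = g₀ ∧ c < c₀)))

/-- What the computation of row `ya` achieves. -/
structure LevelPost (S : Scene) (s₀ : Mem) (i m xa xl ya yl : ℕ) (s : Mem) : Prop where
  rows : Rows S s₀ s ya
  desc : S.Desc S.slots (i + 1) (m + 1) (S.row s ya)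
  sub : ∀ d < S.k, ∀ g < S.slots, ∀ c < S.k, S.row s₀ yl d g ⊆ S.row s ya c (S.ptr s ya d g c)
  ptr : ∀ d < S.k, ∀ g < S.slots, ∀ c < S.k, S.ptr s ya d g c < 2 * i + 3
  fresh : ∀ c < S.k, ∀ g < S.slots, 2 * i + 3 ≤ g → S.row s ya c g = ∅
  star : (∀ d < S.k, ∀ g < S.slots, S.row s₀ yl d g = ∅) → ∀ c < S.k, ∀ g < S.slots,
    1 ∈ S.row s ya c g ∨ 2 ∈ S.row s ya c g ∨ S.row s ya c g ⊆ S.cone i (S.row s₀ xa c g) c c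

lemma wp_triple (L : LevelPre S Z s₀ i m xa xl ya yl) {d g c : ℕ} (hd : d < S.k)
    (hg : g < S.slots) (hc : c < S.k) (hA : AtTriple s d g c)
    (H : TInv S s₀ i m xa xl ya yl (Before d g c) (Before d g c) s)
    (h : ∀ s', TInv S s₀ i m xa xl ya yl (Before d g (c + 1)) (Before d g (c + 1)) s' → Q s') :
    wp Z (.block [turnStep, absorbStep,
      .wset 22 (e4 (.var 25) (.var 7) (.var 8) (.var 9)) (.var 14)]) Q s := by
  simp only [wp_block_cons]
  refine wp_turnStep L hd hg hc hA H fun s1 f1 H1 h1 h1' => ?_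
  have A1 := hA.frame f1
  have hk := L.sizes.k_lt
  have hG : S.slots < _ := L.sizes.G_lt
  have hG' : S.slots = 2 * S.n + 4 := rfl
  have hi := L.hyp.hi
  have hMV := L.sizes.radix_le
  refine wp_absorbStep (Done' := Before d g (c + 1)) L hd hg hc A1 H1
    (fun d' g' c' h => by unfold Before at *; omega) (by unfold Before; omega)
    (by unfold Before; omega) h1 h1' fun s2 f2 H2 h2 h3 h4 => ?_
  have A2 := A1.frame f2
  simp only [wp_block_one, wp_wset, WE.eval_var, eval_e4, H2.env.env.radix, H2.env.w25, A2.w7, A2.w8, A2.w9]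
  refine ⟨by omega, h _ ?_⟩
  have hp : ∀ ρ, ∀ d' < S.k, ∀ g' < S.slots, ∀ c' < S.k, ¬ (ρ = ya ∧ d' = d ∧ g' = g ∧ c' = c) →
      S.ptr (s2.setW 22 (idx4 (16 * S.k * S.n) ya d g c) (s2.w 14 0)) ρ d' g' c' =
        S.ptr s2 ρ d' g' c' := by
    intro ρ d' hd' g' hg' c' hc' hne
    simp only [Scene.ptr, Mem.setW_w_same]
    rw [if_neg]
    rwa [idx4_inj (by omega) (by omega) (by omega) (by omega) (by omega) (by omega)]
  have hp' : S.ptr (s2.setW 22 (idx4 (16 * S.k * S.n) ya d g c) (s2.w 14 0)) ya d g c =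
      s2.w 14 0 := by simp [Scene.ptr]
  refine ⟨H2.env.setW, ⟨H2.rows.row, ?_, ?_⟩, H2.finv, ?_, ?_⟩
  · intro ρ hρ d' hd' g' hg' c' hc'
    rw [hp ρ d' hd' g' hg' c' hc' (by tauto), H2.rows.ptr ρ hρ d' hd' g' hg' c' hc']
  · simpa using H2.rows.flag
  · intro d' hd' g' hg' c' hc' hB
    by_cases he : d' = d ∧ g' = g ∧ c' = c
    · obtain ⟨rfl, rfl, rfl⟩ := he
      exact h2
    · exact H2.turn d' hd' g' hg' c' hc' (by unfold Before at *; omega)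
  · intro d' hd' g' hg' c' hc' hB
    by_cases he : d' = d ∧ g' = g ∧ c' = c
    · obtain ⟨rfl, rfl, rfl⟩ := he
      rw [hp']
      exact ⟨h4, h3⟩
    · rw [hp ya d' hd' g' hg' c' hc' (by tauto)]
      exact H2.absorb d' hd' g' hg' c' hc' (by unfold Before at *; omega)

lemma TInv.cast (H : TInv S s₀ i m xa xl ya yl Done Done s)
    (hD : ∀ d < S.k, ∀ g < S.slots, ∀ c < S.k, Done' d g c → Done d g c)
    (hD' : ∀ d g c, Done d g c → Done' d g c) :
    TInv S s₀ i m xa xl ya yl Done' Done' s :=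
  ⟨H.env, H.rows, H.finv.mono hD', fun d hd g hg c hc h => H.turn d hd g hg c hc (hD d hd g hg c hc h),
    fun d hd g hg c hc h => H.absorb d hd g hg c hc (hD d hd g hg c hc h)⟩

lemma wp_level (L : LevelPre S Z s i m xa xl ya yl) (hE : LevelEnv S s i xa xl ya yl)
    (hempty : S.row s ya = fun _ _ => ∅)
    (h : ∀ s', Frame level s s' → LevelPost S s i m xa xl ya yl s' → Q s') :
    wp Z level Q s := by
  refine wp_mono Z (fun s' hs' => h s' hs'.2 hs'.1) (wp_frame Z ?_)
  simp only [level, wp_block_cons, wp_setw, WE.eval_lit_0]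
  refine ⟨by omega, ?_⟩
  have hp : S.ptr (s.setW 12 0 0) = S.ptr s := ptr_congr (by simp)
  have L' : LevelPre S Z (s.setW 12 0 0) i m xa xl ya yl :=
    { L with hyp := by rw [hp]; exact L.hyp }
  have hpost : ∀ s', LevelPost S (s.setW 12 0 0) i m xa xl ya yl s' →
      LevelPost S s i m xa xl ya yl s' := fun s' h =>
    ⟨⟨h.rows.row, by rw [← hp]; exact h.rows.ptr, h.rows.flag⟩, h.desc, h.sub, h.ptr, h.fresh, h.star⟩
  change wp Z (.seq pushAll _) _ _
  refine wp_mono Z hpost ?_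
  have hE' : LevelEnv S (s.setW 12 0 0) i xa xl ya yl := hE.setW
  replace hempty : S.row (s.setW 12 0 0) ya = fun _ _ => ∅ := hempty
  have h12 : (s.setW 12 0 0).w 12 0 = 0 := by simp
  generalize s.setW 12 0 0 = s₀ at *
  refine wp_pushAll L.valid L.sizes hE' L.hyp.hi L.xa_lt L.ya_lt L.xa_ne hempty h12
    fun s1 f1 R1 h1 => ?_
  have H1 : TInv S s₀ i m xa xl ya yl (Before 0 0 0) (Before 0 0 0) s1 := by
    refine ⟨hE'.frame f1, R1, ?_, ?_, ?_⟩
    · rw [h1]; exact L'.hyp.init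
    · intro d _ g _ c _ hB; exfalso; unfold Before at hB; omega
    · intro d _ g _ c _ hB; exfalso; unfold Before at hB; omega
  refine wp_loop_orientations L.sizes H1.env.env
    (fun d s' => TInv S s₀ i m xa xl ya yl (Before d 0 0) (Before d 0 0) s') rfl rfl
    (H1.congr H1.env.setW rfl rfl (by simp) (by simp)) ?_ ?_
  · intro d hd s2 hd2 f2 H2
    refine wp_loop_slots L.sizes H2.env.env
      (fun g s' => TInv S s₀ i m xa xl ya yl (Before d g 0) (Before d g 0) s') rfl rfl
      (H2.congr H2.env.setW rfl rfl (by simp) (by simp)) ?_ ?_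
    · intro g hg s3 hg3 f3 H3
      refine wp_loop_orientations L.sizes H3.env.env
        (fun c s' => TInv S s₀ i m xa xl ya yl (Before d g c) (Before d g c) s') rfl rfl
        (H3.congr H3.env.setW rfl rfl (by simp) (by simp)) ?_ ?_
      · intro c hc s4 hc4 f4 H4
        refine wp_triple L' hd hg hc ⟨by rw [f4.w 7, f3.w 7, hd2], by rw [f4.w 8, hg3], hc4⟩ H4
          fun s5 H5 => ?_
        exact H5.congr H5.env.setW rfl rfl (by simp) (by simp)
      · intro s4 f4 H4
        refine (H4.cast (Done' := Before d (g + 1) 0) ?_ ?_).congr H4.env.setW rfl rfl (by simp)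
          (by simp)
        all_goals intros; unfold Before at *; omega
    · intro s3 f3 H3
      refine (H3.cast (Done' := Before (d + 1) 0 0) ?_ ?_).congr H3.env.setW rfl rfl (by simp)
          (by simp)
      all_goals intros; unfold Before at *; omega
  · intro s2 f2 H2
    have hall : ∀ d < S.k, ∀ g < S.slots, ∀ c < S.k, Before S.k 0 0 d g c := fun d hd g _ c _ =>
      Or.inl hd
    have hG' : S.slots = 2 * S.n + 4 := rfl
    have hi := L.hyp.hi
    refine ⟨H2.rows, ?_, ?_, ?_, H2.finv.fresh, H2.finv.star_succ⟩
    · refine L'.hyp.desc L.valid H2.finv ?_ ?_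
      · exact fun d hd g hg c hc => H2.turn d hd g hg c hc (hall d hd g hg c hc)
      · intro d hd g hg c hc
        obtain ⟨h1, h2⟩ := H2.absorb d hd g hg c hc (hall d hd g hg c hc)
        exact ⟨_, by omega, h1⟩
    · exact fun d hd g hg c hc => (H2.absorb d hd g hg c hc (hall d hd g hg c hc)).1
    · exact fun d hd g hg c hc => (H2.absorb d hd g hg c hc (hall d hd g hg c hc)).2

end
end Algo
end LinkTour

/-! ### The forward computation -/

namespace LinkTour
open RealRAM
namespace Algo

/-- The rows `R 0, …, R 3` describe the points of segment `i` that are reached with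
`mu i - 1, …, mu i + 2` links. -/
structure Layer (S : Scene) (s : Mem) (i : ℕ) (R : ℕ → ℕ) : Prop where
  zero : R 0 = 0
  lt : ∀ a ≤ 3, R a < 4 * i + 4
  desc : ∀ a ≤ 3, S.Desc S.slots i (S.mu i + a - 1) (S.row s (R a))
  sub : ∀ a < 3, ∀ d < S.k, ∀ g < S.slots, ∀ c < S.k,
    S.row s (R a) d g ⊆ S.row s (R (a + 1)) c (S.ptr s (R (a + 1)) d g c)
  ptr : ∀ a < 3, ∀ d < S.k, ∀ g < S.slots, ∀ c < S.k, S.ptr s (R (a + 1)) d g c < 2 * i + 1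
  fresh : ∀ a ≤ 3, ∀ c < S.k, ∀ g < S.slots, 2 * i + 1 ≤ g → S.row s (R a) c g = ∅

/-- The relation between the rows for segments `i` and `i + 1` that the computation of row `ya` for
`m + 1` links establishes. -/
structure LevelOut (S : Scene) (s : Mem) (i m xa ya yl : ℕ) : Prop where
  desc : S.Desc S.slots (i + 1) (m + 1) (S.row s ya)
  sub : ∀ d < S.k, ∀ g < S.slots, ∀ c < S.k, S.row s yl d g ⊆ S.row s ya c (S.ptr s ya d g c)
  ptr : ∀ d < S.k, ∀ g < S.slots, ∀ c < S.k, S.ptr s ya d g c < 2 * i + 3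
  fresh : ∀ c < S.k, ∀ g < S.slots, 2 * i + 3 ≤ g → S.row s ya c g = ∅
  star : (∀ d < S.k, ∀ g < S.slots, S.row s yl d g = ∅) → ∀ c < S.k, ∀ g < S.slots,
    1 ∈ S.row s ya c g ∨ 2 ∈ S.row s ya c g ∨ S.row s ya c g ⊆ S.cone i (S.row s xa c g) c c

/-- The rows and pointers with numbers in `D` are the same in both memories. -/
def SameRows (S : Scene) (s s' : Mem) (D : ℕ → Prop) : Prop :=
  ∀ ρ, D ρ → S.row s' ρ = S.row s ρ ∧
    ∀ d < S.k, ∀ g < S.slots, ∀ c < S.k, S.ptr s' ρ d g c = S.ptr s ρ d g c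

section
variable {S : Scene} {Z : Sizes} {s s' : Mem} {Q : Mem → Prop}

lemma Rows.same {ya : ℕ} (h : Rows S s s' ya) : SameRows S s s' (· ≠ ya) :=
  fun ρ hρ => ⟨h.row ρ hρ, h.ptr ρ hρ⟩

lemma SameRows.mono {D D' : ℕ → Prop} (h : SameRows S s s' D) (hD : ∀ ρ, D' ρ → D ρ) :
    SameRows S s s' D' := fun ρ hρ => h ρ (hD ρ hρ)

lemma SameRows.of_eq {D : ℕ → Prop} (h7 : s'.r 7 = s.r 7) (h8 : s'.r 8 = s.r 8)
    (h22 : s'.w 22 = s.w 22) : SameRows S s s' D := fun ρ _ =>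
  ⟨by rw [row_congr h7 h8], fun _ _ _ _ _ _ => by rw [ptr_congr h22]⟩

lemma SameRows.trans {s'' : Mem} {D : ℕ → Prop} (h : SameRows S s s' D) (h' : SameRows S s' s'' D) :
    SameRows S s s'' D := fun ρ hρ =>
  ⟨by rw [(h' ρ hρ).1, (h ρ hρ).1], fun d hd g hg c hc => by
    rw [(h' ρ hρ).2 d hd g hg c hc, (h ρ hρ).2 d hd g hg c hc]⟩

lemma Layer.congr {i : ℕ} {R R' : ℕ → ℕ} (h : Layer S s i R)
    (hs : SameRows S s s' (· < 4 * i + 4)) (hR : ∀ a ≤ 3, R' a = R a) : Layer S s' i R' := by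
  have e : ∀ a ≤ 3, S.row s' (R' a) = S.row s (R a) := fun a ha => by
    rw [hR a ha, (hs _ (h.lt a ha)).1]
  have e' : ∀ a < 3, ∀ d < S.k, ∀ g < S.slots, ∀ c < S.k,
      S.ptr s' (R' (a + 1)) d g c = S.ptr s (R (a + 1)) d g c := fun a ha d hd g hg c hc => by
    rw [hR _ ha, (hs _ (h.lt (a + 1) ha)).2 d hd g hg c hc]
  refine ⟨by rw [hR 0 (by omega), h.zero], fun a ha => by rw [hR a ha]; exact h.lt a ha,
    fun a ha => by rw [e a ha]; exact h.desc a ha, ?_, ?_,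
    fun a ha => by rw [e a ha]; exact h.fresh a ha⟩
  · intro a ha d hd g hg c hc
    rw [e a ha.le, e (a + 1) ha, e' a ha d hd g hg c hc]
    exact h.sub a ha d hd g hg c hc
  · intro a ha d hd g hg c hc
    rw [e' a ha d hd g hg c hc]
    exact h.ptr a ha d hd g hg c hc

lemma LevelOut.congr {i m xa ya yl : ℕ} {D : ℕ → Prop} (h : LevelOut S s i m xa ya yl)
    (hs : SameRows S s s' D) (hxa : D xa) (hya : D ya) (hyl : D yl) :
    LevelOut S s' i m xa ya yl := by
  have e1 := (hs xa hxa).1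
  have e2 := (hs ya hya).1
  have e3 := (hs yl hyl).1
  refine ⟨by rw [e2]; exact h.desc, ?_, ?_, by rw [e2]; exact h.fresh, by
    rw [e1, e2, e3]; exact h.star⟩
  · intro d hd g hg c hc
    rw [e2, e3, (hs ya hya).2 d hd g hg c hc]
    exact h.sub d hd g hg c hc
  · intro d hd g hg c hc
    rw [(hs ya hya).2 d hd g hg c hc]
    exact h.ptr d hd g hg c hc

end

/-- Computes row `4 * (i + 1) + b + 1` for segment `i + 1` and `mu i + b` links, where `i` is in
scalar `5`. -/
def levelAt (b : ℕ) : SP := .block [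
  .setw 23 (.get 20 (4 * .var 5 + .const (b + 1))), .setw 24 (.get 20 (4 * .var 5 + .const b)),
  .setw 25 (4 * .var 5 + .const (b + 5)), .setw 26 (4 * .var 5 + .const (b + 4)), level]

section
variable {S : Scene} {Z : Sizes} {s s' : Mem} {Q : Mem → Prop}

lemma wp_levelAt (hS : S.Valid) (hZ : SizesOK S Z) (hE : Env S s) {i b : ℕ} (h5 : s.w 5 0 = i)
    (hi : i ≤ S.n) (hb : b < 3) (hL : Layer S s i fun a => s.w 20 (4 * i + a))
    (hempty : S.row s (4 * i + (b + 5)) = fun _ _ => ∅)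
    (hY : S.Desc S.slots (i + 1) (S.mu i + b - 1) (S.row s (4 * i + (b + 4))))
    (hstar : ∀ d < S.k, ∀ g < S.slots, 1 ∈ S.row s (4 * i + (b + 4)) d g ∨
      2 ∈ S.row s (4 * i + (b + 4)) d g ∨ S.row s (4 * i + (b + 4)) d g ⊆
        S.cone i (S.row s (s.w 20 (4 * i + b)) d g) d d)
    (h : ∀ s', Frame (levelAt b) s s' → Rows S s s' (4 * i + (b + 5)) →
      LevelOut S s' i (S.mu i + b - 1) (s.w 20 (4 * i + (b + 1))) (4 * i + (b + 5))
        (4 * i + (b + 4)) → Q s') :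
    wp Z (levelAt b) Q s := by
  refine wp_mono Z (fun s' hs' => h s' hs'.2 hs'.1.1 hs'.1.2) (wp_frame Z
    (Q := fun s' => Rows S s s' (4 * i + (b + 5)) ∧
      LevelOut S s' i (S.mu i + b - 1) (s.w 20 (4 * i + (b + 1))) (4 * i + (b + 5))
        (4 * i + (b + 4))) ?_)
  have hk := hZ.k_lt
  have hM := hZ.row_lt
  have hMV := hZ.radix_le
  have hmu := hS.mu_pos i
  have l1 := hL.lt (b + 1) hb
  have l2 := hL.lt b hb.le
  simp [levelAt, h5]
  refine ⟨by omega, by omega, by omega, by omega, ?_⟩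
  obtain ⟨s1, hs1⟩ : ∃ s1, s1 = (((s.setW 23 0 (s.w 20 (4 * i + (b + 1)))).setW 24 0
    (s.w 20 (4 * i + b))).setW 25 0 (4 * i + (b + 5))).setW 26 0 (4 * i + (b + 4)) := ⟨_, rfl⟩
  rw [← hs1]
  have hrow : S.row s1 = S.row s := row_congr (by simp [hs1]) (by simp [hs1])
  have hptr : S.ptr s1 = S.ptr s := ptr_congr (by simp [hs1])
  refine wp_level (xa := s.w 20 (4 * i + (b + 1))) (xl := s.w 20 (4 * i + b))
    (ya := 4 * i + (b + 5)) (yl := 4 * i + (b + 4)) (i := i) (m := S.mu i + b - 1) ?_ ?_ ?_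
    fun s2 f2 H2 => ⟨⟨?_, ?_, H2.rows.flag⟩, H2.desc, ?_, H2.ptr, H2.fresh, ?_⟩
  · refine ⟨hS, hZ, ?_, by omega, by omega, by omega, by omega, by omega, by omega, by omega⟩
    rw [hrow, hptr]
    refine ⟨hi, by simp only [Scene.slots]; omega, ?_, hL.desc b hb.le, hY,
      hL.sub b hb, hL.ptr b hb, hL.fresh (b + 1) hb, hL.fresh b hb.le, hstar⟩
    have := hL.desc (b + 1) hb
    rwa [show S.mu i + (b + 1) - 1 = S.mu i + b - 1 + 1 by omega] at this
  · refine ⟨?_, by simp [hs1, h5], by simp [hs1], by simp [hs1], by simp [hs1], by simp [hs1]⟩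
    rw [hs1]
    exact hE.setW.setW.setW.setW
  · rw [hrow, hempty]
  · intro ρ hρ; rw [H2.rows.row ρ hρ, hrow]
  · intro ρ hρ; rw [← hptr]; exact H2.rows.ptr ρ hρ
  · rw [H2.rows.row (4 * i + (b + 4)) (by omega)]; exact H2.sub
  · rw [H2.rows.row (4 * i + (b + 4)) (by omega), H2.rows.row (s.w 20 (4 * i + (b + 1))) (by omega)]
    exact H2.star

end

end Algo
end LinkTour

namespace LinkTour
open RealRAM

lemma Scene.Desc.empty_iff {S : Scene} (hS : S.Valid) {G i m : ℕ} {X : ℕ → ℕ → Set ℝ}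
    (h : S.Desc G i m X) : (∀ c < S.k, ∀ g < G, X c g = ∅) ↔ m < S.mu i := by
  constructor
  · intro he
    by_contra hm
    obtain ⟨c, q, hq⟩ := hS.exists_reach_mu i
    obtain ⟨τ, hτ, rfl⟩ := hq.mem_seg
    obtain ⟨g, hg, h1⟩ := (h c hq.lt_k τ).2 ⟨hτ, hq.mono (not_lt.1 hm)⟩
    rw [he c hq.lt_k g hg] at h1
    exact h1
  · intro hm c hc g hg
    refine Set.eq_empty_of_forall_notMem fun τ hτ => ?_
    have := S.mu_le ((h c hc τ).1 ⟨g, hg, hτ⟩).2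
    omega

lemma Scene.Desc.of_empty {S : Scene} {G i m : ℕ} {X : ℕ → ℕ → Set ℝ} (hm : m < S.mu i)
    (h : ∀ c g, X c g = ∅) : S.Desc G i m X := by
  intro c hc τ
  constructor
  · rintro ⟨g, -, hg⟩; rw [h] at hg; exact hg.elim
  · rintro ⟨-, hr⟩
    have := S.mu_le hr
    omega

namespace Algo

/-- Row `0` is empty, and row `1` contains the whole segment in slot `0`. -/
structure Constants (S : Scene) (s : Mem) : Prop where
  row_zero : S.row s 0 = fun _ _ => ∅
  row_one : ∀ c < S.k, S.row s 1 c 0 = Set.Icc 1 2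
  row_one' : ∀ c < S.k, ∀ g < S.slots, 1 ≤ g → S.row s 1 c g = ∅
  ptr_one : ∀ d < S.k, ∀ g < S.slots, ∀ c < S.k, S.ptr s 1 d g c = 0

section
variable {S : Scene} {Z : Sizes} {s s' : Mem} {Q : Mem → Prop}

lemma Constants.congr {D : ℕ → Prop} (h : Constants S s) (hs : SameRows S s s' D) (h0 : D 0)
    (h1 : D 1) : Constants S s' := by
  refine ⟨by rw [(hs 0 h0).1, h.row_zero], by rw [(hs 1 h1).1]; exact h.row_one,
    by rw [(hs 1 h1).1]; exact h.row_one', fun d hd g hg c hc => ?_⟩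
  rw [(hs 1 h1).2 d hd g hg c hc, h.ptr_one d hd g hg c hc]

lemma Constants.desc {i m : ℕ} (h : Constants S s)
    (hf : ∀ c < S.k, ∀ q ∈ S.seg i, S.Reach m i c q) : S.Desc S.slots i m (S.row s 1) := by
  intro c hc τ
  constructor
  · rintro ⟨g, hg, hτ⟩
    rcases Nat.eq_zero_or_pos g with rfl | hg0
    · rw [h.row_one c hc] at hτ
      exact ⟨hτ, hf c hc _ ⟨τ, hτ, rfl⟩⟩
    · rw [h.row_one' c hc g hg hg0] at hτ
      exact hτ.elim
  · rintro ⟨hτ, -⟩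
    exact ⟨0, by simp [Scene.slots], by rw [h.row_one c hc]; exact hτ⟩

lemma Layer.first (hS : S.Valid) (h : Constants S s) {R : ℕ → ℕ} (h0 : R 0 = 0)
    (h1 : ∀ a < 3, R (a + 1) = 1) : Layer S s 0 R := by
  have hfull : ∀ a, ∀ c < S.k, ∀ q ∈ S.seg 0, S.Reach (a + 1) 0 c q := by
    rintro a c hc q ⟨τ, -, rfl⟩
    have : S.pt 0 τ = S.pt 0 1 := by simp [Scene.pt, hS.vec_zero]
    rw [this]
    exact (Scene.Reach.start hc).mono (by omega)
  have hdesc : ∀ a ≤ 3, S.Desc S.slots 0 (S.mu 0 + a - 1) (S.row s (R a)) := by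
    intro a ha
    rcases a with _ | a
    · rw [h0]
      exact Scene.Desc.of_empty (by rw [hS.mu_zero]; omega) fun c g => by rw [h.row_zero]
    · rw [h1 a ha, hS.mu_zero, show 1 + (a + 1) - 1 = a + 1 by omega]
      exact h.desc (hfull a)
  refine ⟨h0, ?_, hdesc, ?_, ?_, ?_⟩
  · intro a ha
    rcases a with _ | a
    · omega
    · rw [h1 a ha]; omega
  · intro a ha d hd g hg c hc
    rw [h1 a ha, h.ptr_one d hd g hg c hc, h.row_one c hc]
    exact fun τ hτ => ((hdesc a ha.le d hd τ).1 ⟨g, hg, hτ⟩).1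
  · intro a ha d hd g hg c hc
    rw [h1 a ha, h.ptr_one d hd g hg c hc]
    omega
  · intro a ha c hc g hg hg1
    rcases a with _ | a
    · rw [h0, h.row_zero]
    · rw [h1 a ha, h.row_one' c hc g hg hg1]

/-- The rows for the next segment, given the increment `δ` of the number of links. -/
lemma Layer.next (hS : S.Valid) (h : Constants S s) {i δ : ℕ} (hi : i ≤ S.n) (hδ : δ ≤ 2)
    (hmu : S.mu (i + 1) = S.mu i + δ) {xa : ℕ → ℕ}
    (hO : ∀ b < 3, b ≤ δ + 1 →
      LevelOut S s i (S.mu i + b - 1) (xa b) (4 * i + (b + 5)) (4 * i + (b + 4)))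
    {R : ℕ → ℕ} (h0 : R 0 = 0) (h1 : R 1 = 4 * i + (δ + 5))
    (h2 : R 2 = if δ < 2 then 4 * i + (δ + 6) else 1) (h3 : R 3 = 1) : Layer S s (i + 1) R := by
  have hpos := hS.mu_pos i
  have full2 : ∀ c < S.k, ∀ q ∈ S.seg (i + 1), S.Reach (S.mu (i + 1) + 2) (i + 1) c q :=
    fun c hc q hq => hS.full_two (by omega) hc hq
  have d1 : S.Desc S.slots (i + 1) (S.mu (i + 1)) (S.row s (R 1)) := by
    have := (hO δ (by omega) (by omega)).desc
    rwa [h1, hmu, show S.mu i + δ = S.mu i + δ - 1 + 1 by omega]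
  have d2 : S.Desc S.slots (i + 1) (S.mu (i + 1) + 1) (S.row s (R 2)) := by
    rw [h2]
    split_ifs with h
    · have := (hO (δ + 1) (by omega) (by omega)).desc
      rwa [hmu, show S.mu i + δ + 1 = S.mu i + (δ + 1) - 1 + 1 by omega]
    · refine Constants.desc ‹_› fun c hc q hq => ?_
      obtain ⟨d, hd⟩ := hS.full_zero (by rw [hmu]; omega) hq
      exact hd.deg hc
  have hdesc : ∀ a ≤ 3, S.Desc S.slots (i + 1) (S.mu (i + 1) + a - 1) (S.row s (R a)) := by
    intro a ha
    interval_cases a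
    · rw [h0]
      exact Scene.Desc.of_empty (by omega) fun c g => by rw [h.row_zero]
    · exact d1
    · exact d2
    · rw [h3]
      exact h.desc full2
  have hsub : ∀ a ≤ 3, ∀ d < S.k, ∀ g < S.slots, S.row s (R a) d g ⊆ Set.Icc 1 2 :=
    fun a ha d hd g hg τ hτ => ((hdesc a ha d hd τ).1 ⟨g, hg, hτ⟩).1
  refine ⟨h0, ?_, hdesc, ?_, ?_, ?_⟩
  · intro a ha
    interval_cases a
    · omega
    · omega
    · rw [h2]; split_ifs <;> omega
    · omega
  · intro a ha d hd g hg c hc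
    interval_cases a
    · rw [h0, h.row_zero]
      exact Set.empty_subset _
    · rw [h2]
      split_ifs with hδ2
      · rw [h1]
        exact (hO (δ + 1) (by omega) (by omega)).sub d hd g hg c hc
      · rw [h.ptr_one d hd g hg c hc, h.row_one c hc]
        exact hsub 1 (by omega) d hd g hg
    · rw [h3, h.ptr_one d hd g hg c hc, h.row_one c hc]
      exact hsub 2 (by omega) d hd g hg
  · intro a ha d hd g hg c hc
    interval_cases a
    · rw [h1]
      exact (hO δ (by omega) (by omega)).ptr d hd g hg c hc
    · rw [h2]
      split_ifs with hδ2
      · exact (hO (δ + 1) (by omega) (by omega)).ptr d hd g hg c hc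
      · rw [h.ptr_one d hd g hg c hc]
        omega
    · rw [h3, h.ptr_one d hd g hg c hc]
      omega
  · intro a ha c hc g hg hg1
    interval_cases a
    · rw [h0, h.row_zero]
    · rw [h1]
      exact (hO δ (by omega) (by omega)).fresh c hc g hg hg1
    · rw [h2]
      split_ifs with hδ2
      · exact (hO (δ + 1) (by omega) (by omega)).fresh c hc g hg hg1
      · exact h.row_one' c hc g hg (by omega)
    · rw [h3]
      exact h.row_one' c hc g hg (by omega)

end

/-- Saves the nonemptiness flag in scalar `t`. -/
def saveFlag (t : ℕ) : SP := .ite (.wlt 0 (.var 12)) (.setw t 1) (.setw t 0)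

/-- Computes the increment of the number of links from segment `i` to segment `i + 1` and the rows
for segment `i + 1`. -/
def step : SP := .block [
  levelAt 0, saveFlag 17, levelAt 1, saveFlag 18, .setw 19 0,
  .ite (.wlt 0 (.var 17)) .skip
    (.block [levelAt 2, .ite (.wlt 0 (.var 18)) (.setw 19 1) (.setw 19 2)]),
  .wset 20 (4 * .var 5 + 5) (4 * .var 5 + .var 19 + 5),
  .ite (.wlt (.var 19) 2) (.wset 20 (4 * .var 5 + .const 6) (4 * .var 5 + .var 19 + .const 6))
    (.wset 20 (4 * .var 5 + .const 6) 1),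
  .wset 20 (4 * .var 5 + .const 7) 1,
  .wset 21 (.var 5 + 1) (.var 19), .setw 27 (.var 27 + .var 19)]

/-- Computes the rows for all segments. -/
def forward : SP := .block [
  .wset 20 1 1, .wset 20 2 1, .wset 20 3 1, .setw 27 1,
  .loop 9 (.var 0) 1 1 0 (.rset 8 (e3 1 (.var 9) 0) 2),
  .loop 5 (.var 1 + 1) 2 0 1 step]

section
variable {S : Scene} {Z : Sizes} {s s' : Mem} {Q : Mem → Prop}

/-- The rows for the segments up to number `j` have been computed. -/
structure Fwd (S : Scene) (s : Mem) (j : ℕ) : Prop where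
  env : Env S s
  const : Constants S s
  layer : ∀ i ≤ j, Layer S s i fun a => s.w 20 (4 * i + a)
  delta : ∀ i < j, S.mu (i + 1) = S.mu i + s.w 21 (i + 1)
  links : s.w 27 0 = S.mu j
  empty : ∀ ρ, 4 * j + 4 ≤ ρ → S.row s ρ = fun _ _ => ∅
  zero : ∀ i, s.w 20 (4 * i) = 0

lemma mu_le_linear (hS : S.Valid) (i : ℕ) : S.mu i ≤ 2 * i + 1 := by
  induction i with
  | zero => rw [hS.mu_zero]
  | succ i ih => have := hS.mu_succ_le i; omega

lemma wp_saveFlag (hV : 1 ≤ Z.V) {t : ℕ}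
    (h : ∀ v, (v = 0 ↔ s.w 12 0 = 0) → Q (s.setW t 0 v)) : wp Z (saveFlag t) Q s := by
  simp only [saveFlag, wp_ite, TE.safe_wlt, TE.holds_wlt, WE.eval_lit_0, WE.eval_var, wp_setw,
    WE.eval_lit_1, true_and, zero_le]
  exact ⟨fun h0 => ⟨hV, h 1 (by omega)⟩, fun h0 => h 0 (by omega)⟩

/-- What is known in the middle of the computation of the rows for segment `i + 1`, which starts
from memory `s₀`. -/
structure Mid (S : Scene) (i : ℕ) (s₀ s : Mem) : Prop where
  env : Env S s
  seg : s.w 5 0 = i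
  w20 : s.w 20 = s₀.w 20
  w21 : s.w 21 = s₀.w 21
  w27 : s.w 27 = s₀.w 27
  same : SameRows S s₀ s (· < 4 * i + 5)
  empty : ∀ ρ, 4 * i + 8 ≤ ρ → S.row s ρ = fun _ _ => ∅

lemma Mid.setW {i : ℕ} {s₀ : Mem} (h : Mid S i s₀ s) {t v : ℕ}
    (ht : decide (t = 17 ∨ t = 18 ∨ t = 19) = true := by rfl) : Mid S i s₀ (s.setW t 0 v) := by
  have ht := of_decide_eq_true ht
  have hw : ∀ t' ≠ t, (s.setW t 0 v).w t' = s.w t' := fun t' h => Mem.setW_w_of_ne _ _ _ h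
  refine ⟨h.env.setW (by simp; omega), by rw [hw 5 (by omega), h.seg], by
    rw [hw 20 (by omega), h.w20], by rw [hw 21 (by omega), h.w21], by
    rw [hw 27 (by omega), h.w27], h.same.trans (SameRows.of_eq rfl rfl (hw 22 (by omega))), h.empty⟩

/-- The rows that have been computed so far for segment `i + 1`. -/
def Out (S : Scene) (i : ℕ) (s₀ s : Mem) (b : ℕ) : Prop :=
  LevelOut S s i (S.mu i + b - 1) (s₀.w 20 (4 * i + (b + 1))) (4 * i + (b + 5)) (4 * i + (b + 4))

lemma Mid.levelAt (hS : S.Valid) (hZ : SizesOK S Z) {i b : ℕ} (hi : i ≤ S.n) (hb : b < 3)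
    {s₀ : Mem} (hL : Layer S s₀ i fun a => s₀.w 20 (4 * i + a)) (h : Mid S i s₀ s)
    (hempty : S.row s (4 * i + (b + 5)) = fun _ _ => ∅)
    (hY : S.Desc S.slots (i + 1) (S.mu i + b - 1) (S.row s (4 * i + (b + 4))))
    (hstar : ∀ d < S.k, ∀ g < S.slots, 1 ∈ S.row s (4 * i + (b + 4)) d g ∨
      2 ∈ S.row s (4 * i + (b + 4)) d g ∨ S.row s (4 * i + (b + 4)) d g ⊆
        S.cone i (S.row s (s₀.w 20 (4 * i + b)) d g) d d)
    (hO : ∀ b' < b, Out S i s₀ s b')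
    (hQ : ∀ s', Mid S i s₀ s' → Frame (Algo.levelAt b) s s' →
      SameRows S s s' (· ≠ 4 * i + (b + 5)) → (∀ b' < b + 1, Out S i s₀ s' b') →
      (s'.w 12 0 = 0 ↔ S.mu i + b < S.mu (i + 1)) → Q s')
    (hk : (keepsEnv (Algo.levelAt b) && !((Algo.levelAt b).writesW 5 ||
      (Algo.levelAt b).writesW 20 || (Algo.levelAt b).writesW 21 ||
      (Algo.levelAt b).writesW 27)) = true := by rfl) :
    wp Z (Algo.levelAt b) Q s := by
  have hmu := hS.mu_pos i
  have hl := hL.lt (b + 1) hb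
  simp only [Bool.and_eq_true, Bool.not_eq_true', Bool.or_eq_false_iff] at hk
  refine wp_levelAt hS hZ h.env h.seg hi hb
    (hL.congr (h.same.mono fun ρ hρ => by omega) fun a _ => by rw [h.w20]) hempty hY ?_
    fun s' f' R' O' => hQ s' ?_ f' R'.same ?_ ?_
  · rwa [h.w20]
  · refine ⟨h.env.frame f' hk.1, by rw [f'.1 _ hk.2.1.1.1, h.seg], by rw [f'.1 _ hk.2.1.1.2, h.w20],
      by rw [f'.1 _ hk.2.1.2, h.w21], by rw [f'.1 _ hk.2.2, h.w27],
      h.same.trans (R'.same.mono fun ρ hρ => by omega), fun ρ hρ => ?_⟩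
    rw [R'.row ρ (by omega), h.empty ρ hρ]
  · intro b' hb'
    rcases Nat.lt_succ_iff_lt_or_eq.1 hb' with h1 | rfl
    · have := hL.lt (b' + 1) (by omega)
      exact (hO b' h1).congr R'.same (by omega) (by omega) (by omega)
    · rw [h.w20] at O'
      exact O'
  · rw [R'.flag, O'.desc.empty_iff hS, show S.mu i + b - 1 + 1 = S.mu i + b by omega]

lemma wp_step (hS : S.Valid) (hZ : SizesOK S Z) {i : ℕ} (hi : i ≤ S.n) (h5 : s.w 5 0 = i)
    (hF : Fwd S s i) (h : ∀ s', Frame step s s' → Fwd S s' (i + 1) → Q s') : wp Z step Q s := by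
  refine wp_mono Z (fun s' hs' => h s' hs'.2 hs'.1) (wp_frame Z ?_)
  have hM := hZ.row_lt
  have hMV := hZ.radix_le
  have hpos := hS.mu_pos i
  have hlin := mu_le_linear hS i
  have hLi := hF.layer i le_rfl
  have m1 := hS.mu_succ_le i
  have m2 := hS.mu_le_succ i
  have hl := hLi.lt
  simp only [step, wp_block_cons]
  have e4 : S.row s (4 * i + 4) = fun _ _ => ∅ := hF.empty _ (by omega)
  have M0 : Mid S i s s := ⟨hF.env, h5, rfl, rfl, rfl, SameRows.of_eq rfl rfl rfl,
    fun ρ hρ => hF.empty ρ (by omega)⟩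
  have hem0 : ∀ ρ, 4 * i + 4 ≤ ρ → S.row s ρ = fun _ _ => ∅ := hF.empty
  refine M0.levelAt hS hZ hi (b := 0) (by omega) hLi (hF.empty _ (by omega)) ?_ ?_ (by simp)
    fun s1 M1 f1 S1 O1 b1 => ?_
  · exact Scene.Desc.of_empty (by omega) fun c g => by rw [e4]
  · intro d _ g _
    rw [e4]
    exact Or.inr (Or.inr (Set.empty_subset _))
  have e4' : S.row s1 (4 * i + 4) = fun _ _ => ∅ := by rw [(S1 _ (by omega)).1, e4]
  refine wp_saveFlag (by omega) fun v1 hv1 => ?_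
  have M1' : Mid S i s (s1.setW 17 0 v1) := M1.setW
  have O1' := O1 0 (by omega)
  refine M1'.levelAt hS hZ hi (b := 1) (by omega) hLi ?_ ?_ ?_ ?_ fun s2 M2 f2 S2 O2 b2 => ?_
  · rw [row_setW, (S1 _ (by omega)).1, hF.empty _ (by omega)]
  · have := O1'.desc
    rwa [show S.mu i + 0 - 1 + 1 = S.mu i + 1 - 1 by omega] at this
  · intro d hd g hg
    exact O1'.star (by intro d _ g _; change S.row s1 (4 * i + 4) d g = ∅; rw [e4']) d hd g hg
  · intro b' hb'
    obtain rfl : b' = 0 := by omega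
    exact O1'.congr (D := fun _ => True) (SameRows.of_eq rfl rfl (by simp)) trivial trivial trivial
  have w17 : s2.w 17 0 = v1 := by rw [f2.w 17]; simp
  refine wp_saveFlag (by omega) fun v2 hv2 => ?_
  have M2' : Mid S i s ((s2.setW 18 0 v2).setW 19 0 0) := M2.setW.setW
  refine ⟨by simp, ?_⟩
  simp only [WE.eval_lit_0]
  -- the state after the increment has been found
  have key : ∀ s3, Mid S i s s3 → s3.w 19 0 ≤ 2 → S.mu (i + 1) = S.mu i + s3.w 19 0 →
      (∀ b' < 3, b' ≤ s3.w 19 0 + 1 → Out S i s s3 b') →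
      wp Z (.block [.wset 20 (4 * .var 5 + 5) (4 * .var 5 + .var 19 + 5),
        .ite (.wlt (.var 19) 2) (.wset 20 (4 * .var 5 + .const 6) (4 * .var 5 + .var 19 + .const 6))
          (.wset 20 (4 * .var 5 + .const 6) 1),
        .wset 20 (4 * .var 5 + .const 7) 1,
        .wset 21 (.var 5 + 1) (.var 19), .setw 27 (.var 27 + .var 19)])
        (fun s' => Fwd S s' (i + 1)) s3 := by
    intro s3 M3 hδ hmu hO
    have h19 : s3.w 19 0 < 2 → s3.w 19 0 ≤ 1 := fun h => by omega
    simp only [wp_block_cons, wp_block_one, wp_wset, wp_ite, wp_setw, WE.eval_add, WE.eval_mul,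
      WE.eval_var, WE.eval_const, WE.eval_lit_1, WE.eval_lit_2, WE.eval_lit_4, WE.eval_lit_5,
      TE.safe_wlt, TE.holds_wlt, Mem.setW_w_of_ne, ne_eq, Nat.reduceEqDiff, not_false_eq_true,
      M3.seg, true_and]
    have hlink : s3.w 27 0 = S.mu i := by rw [M3.w27, hF.links]
    have fin : ∀ x : ℕ, x = (if s3.w 19 0 < 2 then 4 * i + (s3.w 19 0 + 6) else 1) →
        Fwd S (((((s3.setW 20 (4 * i + 5) (4 * i + s3.w 19 0 + 5)).setW 20 (4 * i + 6) x).setW 20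
          (4 * i + 7) 1).setW 21 (i + 1) (s3.w 19 0)).setW 27 0 (s3.w 27 0 + s3.w 19 0)) (i + 1) := by
      intro x hx
      obtain ⟨s4, hs4⟩ : ∃ s4, s4 = ((((s3.setW 20 (4 * i + 5) (4 * i + s3.w 19 0 + 5)).setW 20
        (4 * i + 6) x).setW 20 (4 * i + 7) 1).setW 21 (i + 1) (s3.w 19 0)).setW 27 0
          (s3.w 27 0 + s3.w 19 0) := ⟨_, rfl⟩
      rw [← hs4]
      have same3 : ∀ D, SameRows S s3 s4 D := fun D =>
        SameRows.of_eq (by simp [hs4]) (by simp [hs4]) (by simp [hs4])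
      have same4 : SameRows S s s4 (· < 4 * i + 5) := M3.same.trans (same3 _)
      have w20 : ∀ j, s4.w 20 j = if j = 4 * i + 7 then 1 else if j = 4 * i + 6 then x else
          if j = 4 * i + 5 then 4 * i + s3.w 19 0 + 5 else s.w 20 j := by
        intro j
        simp [hs4, Mem.setW_w_same, M3.w20]
      have w21 : ∀ j, s4.w 21 j = if j = i + 1 then s3.w 19 0 else s.w 21 j := by
        intro j
        simp [hs4, Mem.setW_w_same, M3.w21]
      have hC : Constants S s4 := hF.const.congr same4 (by omega) (by omega)
      have hz : ∀ j, s4.w 20 (4 * j) = 0 := fun j => by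
        rw [w20, if_neg (by omega), if_neg (by omega), if_neg (by omega), hF.zero]
      refine ⟨?_, hC, ?_, ?_, ?_, ?_, hz⟩
      · rw [hs4]
        exact M3.env.setW.setW.setW.setW.setW
      · intro i' hi'
        rcases Nat.lt_succ_iff_lt_or_eq.1 (Nat.lt_succ_of_le hi') with h1 | rfl
        · refine (hF.layer i' (by omega)).congr (same4.mono fun ρ hρ => by omega) fun a ha => ?_
          rw [w20, if_neg (by omega), if_neg (by omega), if_neg (by omega)]
        · refine Layer.next hS hC hi hδ hmu (xa := fun b => s.w 20 (4 * i + (b + 1)))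
            (fun b hb hb' => (hO b hb hb').congr (same3 fun _ => True) trivial trivial trivial)
            (hz (i + 1)) ?_ ?_ ?_
          · rw [w20, if_neg (by omega), if_neg (by omega), if_pos (by omega)]
            omega
          · rw [w20, if_neg (by omega), if_pos (by omega), hx]
          · rw [w20, if_pos (by omega)]
      · intro i' hi'
        rw [w21]
        split_ifs with h1
        · obtain rfl : i' = i := by omega
          exact hmu
        · exact hF.delta i' (by omega)
      · rw [hmu]
        simp [hs4, hlink]
      · intro ρ hρ
        rw [(same3 (fun _ => True) ρ trivial).1]
        exact M3.empty ρ (by omega)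
    refine ⟨by omega, fun h1 => ⟨by omega, by omega, by omega, by omega, ?_⟩,
      fun h1 => ⟨by omega, by omega, by omega, by omega, ?_⟩⟩
    · refine fin _ ?_
      rw [if_pos h1]
      omega
    · refine fin _ ?_
      rw [if_neg h1]
  have h17 : ((s2.setW 18 0 v2).setW 19 0 0).w 17 0 = v1 := by simpa using w17
  have O2' : ∀ b' < 2, Out S i s ((s2.setW 18 0 v2).setW 19 0 0) b' := fun b' hb' =>
    (O2 b' hb').congr (D := fun _ => True) (SameRows.of_eq rfl rfl (by simp)) trivial trivial trivial
  refine ⟨trivial, fun hpos1 => ?_, fun hpos1 => ?_⟩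
  · simp only [TE.holds_wlt, WE.eval_lit_0, WE.eval_var, h17] at hpos1
    have h19 : ((s2.setW 18 0 v2).setW 19 0 0).w 19 0 = 0 := by simp
    refine key _ M2' (by omega) ?_ fun b' _ hb' => O2' b' (by omega)
    rw [h19]
    have : ¬ S.mu i + 0 < S.mu (i + 1) := by rw [← b1]; omega
    omega
  · simp only [TE.holds_wlt, WE.eval_lit_0, WE.eval_var, h17] at hpos1
    have hlt : S.mu i + 0 < S.mu (i + 1) := by rw [← b1, ← hv1]; omega
    have O21 := O2' 1 (by omega)
    have O20 := O2' 0 (by omega)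
    simp only [wp_block_cons]
    refine M2'.levelAt hS hZ hi (b := 2) (by omega) hLi ?_ ?_ ?_ O2' fun s3 M3 f3 S3 O3 b3 => ?_
    · rw [row_setW, row_setW, (S2 _ (by omega)).1, row_setW, (S1 _ (by omega)).1,
        hF.empty _ (by omega)]
    · have := O21.desc
      rwa [show S.mu i + 1 - 1 + 1 = S.mu i + 2 - 1 by omega] at this
    · refine O21.star ?_
      exact (O20.desc.empty_iff hS).2 (by omega)
    · have w18 : s3.w 18 0 = v2 := by rw [f3.w 18]; simp
      have hmid : ∀ v, ∀ b' < 3, Out S i s (s3.setW 19 0 v) b' := fun v b' hb' =>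
        (O3 b' hb').congr (D := fun _ => True) (SameRows.of_eq rfl rfl (by simp)) trivial trivial
          trivial
      refine ⟨trivial, fun h18 => ⟨by simp; omega, ?_⟩, fun h18 => ⟨by simp; omega, ?_⟩⟩ <;>
        simp only [TE.holds_wlt, WE.eval_lit_0, WE.eval_var, w18] at h18
      · refine key _ M3.setW (by simp) ?_ fun b' hb' _ => hmid _ b' hb'
        have : ¬ S.mu i + 1 < S.mu (i + 1) := by rw [← b2, ← hv2]; omega
        simp
        omega
      · refine key _ M3.setW (by simp) ?_ fun b' hb' _ => hmid _ b' hb'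
        have : S.mu i + 1 < S.mu (i + 1) := by rw [← b2, ← hv2]; omega
        simp
        omega

lemma Fwd.congr {j : ℕ} (h : Fwd S s j) (hE : Env S s') (h7 : s'.r 7 = s.r 7)
    (h8 : s'.r 8 = s.r 8) (h20 : s'.w 20 = s.w 20) (h21 : s'.w 21 = s.w 21)
    (h22 : s'.w 22 = s.w 22) (h27 : s'.w 27 = s.w 27) : Fwd S s' j := by
  have hs : ∀ D, SameRows S s s' D := fun D => SameRows.of_eq h7 h8 h22
  exact ⟨hE, h.const.congr (hs fun _ => True) trivial trivial,
    fun i hi => (h.layer i hi).congr (hs _) fun a _ => by rw [h20], by rw [h21]; exact h.delta,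
    by rw [h27]; exact h.links, by rw [row_congr h7 h8]; exact h.empty, by rw [h20]; exact h.zero⟩

lemma wp_forward (hS : S.Valid) (hZ : SizesOK S Z) (hE : Env S s) (h7 : ∀ j, s.r 7 j = 0)
    (h8 : ∀ j, s.r 8 j = 0) (h20 : ∀ j, s.w 20 j = 0) (h22 : ∀ j, s.w 22 j = 0)
    (h : ∀ s', Frame forward s s' → Fwd S s' (S.n + 1) → Q s') : wp Z forward Q s := by
  refine wp_mono Z (fun s' hs' => h s' hs'.2 hs'.1) (wp_frame Z ?_)
  have hM := hZ.row_lt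
  have hMV := hZ.radix_le
  have hk := hZ.k_lt
  have hG : S.slots < _ := hZ.G_lt
  have hn := hZ.npos
  simp only [forward, wp_block_cons, wp_wset, WE.eval_lit_1, WE.eval_lit_2, WE.eval_lit_3, wp_setw]
  refine ⟨by omega, by omega, by omega, by omega, ?_⟩
  have E0 : Env S ((((s.setW 20 1 1).setW 20 2 1).setW 20 3 1).setW 27 0 1) := hE.setW.setW.setW.setW
  obtain ⟨s0, hs0⟩ : ∃ s0, s0 = (((s.setW 20 1 1).setW 20 2 1).setW 20 3 1).setW 27 0 1 := ⟨_, rfl⟩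
  rw [← hs0] at E0 ⊢
  have w20 : ∀ j, s0.w 20 j = if j = 3 then 1 else if j = 2 then 1 else if j = 1 then 1 else 0 := by
    intro j
    simp [hs0, Mem.setW_w_same, h20]
  have w27 : s0.w 27 0 = 1 := by simp [hs0]
  have w22 : ∀ j, s0.w 22 j = 0 := by simp [hs0, h22]
  have r7 : ∀ j, s0.r 7 j = 0 := by simp [hs0, h7]
  have r8 : ∀ j, s0.r 8 j = 0 := by simp [hs0, h8]
  clear hs0
  refine wp_loop_orientations hZ E0 (fun c s' => s'.r 8 = fun x =>
    if ∃ c' < c, x = idx3 (16 * S.k * S.n) 1 c' 0 then 2 else 0) rfl rfl ?_ ?_ ?_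
  · funext x
    simp [r8]
  · intro c hc s1 hc1 f1 h1
    have w3 : s1.w 3 0 = 16 * S.k * S.n := by rw [f1.w 3, E0.radix]
    simp only [wp_rset, RE.safe_lit_2, RE.eval_lit_2, eval_e3, WE.eval_lit_1, WE.eval_lit_0,
      WE.eval_var, hc1, w3, true_and]
    refine ⟨by simp, ?_⟩
    funext x
    rw [Mem.setW_r, Mem.setR_r_same, h1]
    by_cases hx : x = idx3 (16 * S.k * S.n) 1 c 0
    · rw [if_pos hx, if_pos ⟨c, by omega, hx⟩]
    · rw [if_neg hx]
      refine if_congr ?_ rfl rfl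
      constructor
      · rintro ⟨c', h2, h3⟩
        exact ⟨c', by omega, h3⟩
      · rintro ⟨c', h2, h3⟩
        refine ⟨c', ?_, h3⟩
        rcases Nat.lt_succ_iff_lt_or_eq.1 h2 with h4 | rfl
        exacts [h4, absurd h3 hx]
  intro s1 f1 h1
  have E1 := E0.frame f1
  have hrow : ∀ ρ, ∀ c < S.k, ∀ g < S.slots,
      S.row s1 ρ c g = if ρ = 1 ∧ g = 0 then Set.Icc 1 2 else ∅ := by
    intro ρ c hc g hg
    rw [row_of_lt hc hg, slot, f1.r 7, r7, h1]
    by_cases he : ρ = 1 ∧ g = 0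
    · obtain ⟨rfl, rfl⟩ := he
      rw [if_pos ⟨rfl, rfl⟩]
      simp only
      rw [if_pos ⟨c, hc, rfl⟩]
      norm_num
    · rw [if_neg he]
      simp only
      rw [if_neg]
      · norm_num
      · rintro ⟨c', hc', h3⟩
        have := (idx3_inj (by omega) (by omega) (by omega) (by omega)).1 h3
        exact he ⟨this.1, this.2.2⟩
  have hrow0 : ∀ ρ ≠ 1, S.row s1 ρ = fun _ _ => ∅ := by
    intro ρ hρ
    funext c g
    by_cases hb : c < S.k ∧ g < S.slots
    · rw [hrow ρ c hb.1 g hb.2, if_neg (by tauto)]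
    · rw [Scene.row, if_neg hb]
  have hC : Constants S s1 := by
    refine ⟨hrow0 0 (by omega), ?_, ?_, ?_⟩
    · intro c hc
      rw [hrow 1 c hc 0 (by simp [Scene.slots]), if_pos ⟨rfl, rfl⟩]
    · intro c hc g hg hg1
      rw [hrow 1 c hc g hg, if_neg (by omega)]
    · intro d _ g _ c _
      rw [Scene.ptr, f1.w 22, w22]
  have w20' : s1.w 20 = s0.w 20 := f1.w 20
  have F1 : Fwd S s1 0 := by
    refine ⟨E1, hC, ?_, by simp, ?_, fun ρ hρ => hrow0 ρ (by omega), ?_⟩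
    · intro i hi
      obtain rfl : i = 0 := by omega
      refine Layer.first hS hC ?_ fun a ha => ?_
      · rw [w20', w20]; norm_num
      · rw [w20', w20]
        interval_cases a <;> norm_num
    · rw [f1.w 27, w27, hS.mu_zero]
    · intro i
      rw [w20', w20, if_neg (by omega), if_neg (by omega), if_neg (by omega)]
  refine wp_loop Z (fun j s' => Fwd S s' j) (S.n + 1) (by simp [E1.n]) (by rw [hZ.n]; simp; omega)
    (by omega) rfl ?_ ?_ ?_ ?_
  · intro t' ht'
    change (WE.op .add (.get 1 (.const 0)) (.const 1)).reads t' = true at ht'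
    simp only [WE.reads, Bool.or_eq_true, beq_iff_eq] at ht'
    rcases ht' with (rfl | h) | h
    · rfl
    · cases h
    · cases h
  · exact F1.congr E1.setW rfl rfl (by simp) (by simp) (by simp) (by simp)
  · intro i hi s2 h5 f2 F2
    refine wp_step hS hZ (by omega) h5 F2 fun s3 f3 F3 => ?_
    exact F3.congr F3.env.setW rfl rfl (by simp) (by simp) (by simp) (by simp)
  · exact fun s2 _ f2 F2 => F2

end
end Algo
end LinkTour

/-! ### Search for a predecessor -/

namespace LinkTour
open RealRAM
namespace Algo

/-- Looks for a slot of the row in scalar `24` that contains the parameter in scalar `23`. -/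
def searchHere : SP :=
  .loop 7 (.var 0) 1 1 0 (.loop 8 (.var 4) 6 0 1 (.block [
    .setw 13 (e3 (.var 24) (.var 7) (.var 8)),
    .ite (.wlt 0 (.var 32)) .skip
      (.ite (.rlt (.var 23) (.get 7 (.var 13) + 1)) .skip
        (.ite (.rlt (.get 8 (.var 13)) (.var 23)) .skip (.block [.setw 33 (.var 7), .setw 32 1])))]))

/-- Computes a solution of the constraints for the first parameter in scalar `23`. -/
def solve : SP := .block [
  .setr 24 (0 - (.get 11 0 + .get 9 0 * .var 23)),
  .loop 10 5 5 0 0 (.ite (.rlt 0 (.get 10 (.var 10)))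
    (.block [
      .setr 16 ((0 - (.get 11 (.var 10) + .get 9 (.var 10) * .var 23)) / .get 10 (.var 10)),
      .ite (.rlt (.var 24) (.var 16)) (.setr 24 (.var 16)) .skip])
    .skip)]

/-- Looks for a slot of the row in scalar `24` from which the point with the parameter in scalar `23`
can be reached.  If scalar `17` is `1`, then only straight connections are considered. -/
def searchCone : SP :=
  .loop 7 (.var 0) 1 1 0 (.loop 8 (.var 4) 6 0 1 (
    .ite (.wlt 0 (.var 32)) .skip
      (.ite (.wlt (.var 17 * ((.var 7 - .var 9) + (.var 9 - .var 7))) 1)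
        (.block [coneAt 24,
          .ite (.rlt (.var 23) (.var 12)) .skip
            (.ite (.rlt (.var 13) (.var 23)) .skip
              (.block [solve, .setw 33 (.var 7), .setw 32 1]))])
        .skip)))

section
variable {S : Scene} {Z : Sizes} {s s' : Mem} {Q : Mem → Prop}

/-- Outcome of a search among the pairs in `D`: if scalar `32` is `0`, then no pair satisfies `p`;
otherwise a pair with `d` in scalar `33` does. -/
def Outcome (S : Scene) (D : ℕ → ℕ → Prop) (p : ℕ → ℕ → Prop) (p' : ℕ → ℕ → ℝ → Prop) (s : Mem) :
    Prop :=
  (s.w 32 0 = 0 → ∀ d < S.k, ∀ g < S.slots, D d g → ¬ p d g) ∧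
  (s.w 32 0 ≠ 0 → s.w 33 0 < S.k ∧ ∃ g < S.slots, p' (s.w 33 0) g (s.r 24 0))

lemma Frame.loop {t cf ka na : ℕ} {b : WE} {P : SP} {s₁ s₂ s₃ : Mem}
    (h : Frame (.loop t b cf ka na P) s₁ s₂) (h' : Frame P s₂ s₃) :
    Frame (.loop t b cf ka na P) s₁ s₃ := by
  refine ⟨fun t' ht => ?_, fun t' ht => ?_⟩
  · rw [← h.1 t' ht]
    simp only [SP.writesW, Bool.or_eq_false_iff] at ht
    exact h'.1 t' ht.2
  · rw [← h.2 t' ht]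
    exact h'.2 t' ht

/-- The rule for a double loop that searches all pairs. -/
lemma wp_search (hZ : SizesOK S Z) (hE : Env S s) {P : SP} {p : ℕ → ℕ → Prop}
    {p' : ℕ → ℕ → ℝ → Prop}
    (h7 : P.writesW 7 = false) (h8 : P.writesW 8 = false) (h0 : P.writesW 0 = false)
    (h4 : P.writesW 4 = false) (hk : keepsEnv P = true) (h32 : s.w 32 0 = 0)
    (hstep : ∀ d < S.k, ∀ g < S.slots, ∀ s',
      Frame (.loop 7 (.var 0) 1 1 0 (.loop 8 (.var 4) 6 0 1 P)) s s' → s'.w 7 0 = d → s'.w 8 0 = g →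
      (s'.w 32 0 ≠ 0 → s'.w 33 0 < S.k ∧ ∃ g < S.slots, p' (s'.w 33 0) g (s'.r 24 0)) →
      wp Z P (fun s'' => (s''.w 32 0 = 0 → s'.w 32 0 = 0 ∧ ¬ p d g) ∧
        (s''.w 32 0 ≠ 0 → s''.w 33 0 < S.k ∧ ∃ g < S.slots, p' (s''.w 33 0) g (s''.r 24 0))) s')
    (h : ∀ s', Frame (.loop 7 (.var 0) 1 1 0 (.loop 8 (.var 4) 6 0 1 P)) s s' →
      Outcome S (fun _ _ => True) p p' s' → Q s') :
    wp Z (.loop 7 (.var 0) 1 1 0 (.loop 8 (.var 4) 6 0 1 P)) Q s := by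
  refine wp_mono Z (fun s' hs' => h s' hs'.2 hs'.1) (wp_frame Z ?_)
  have hw : ∀ (s : Mem) (t v : ℕ), t = 7 ∨ t = 8 → (s.setW t 0 v).w 32 = s.w 32 ∧
      (s.setW t 0 v).w 33 = s.w 33 := fun s t v ht =>
    ⟨Mem.setW_w_of_ne _ _ _ (by omega), Mem.setW_w_of_ne _ _ _ (by omega)⟩
  have cast : ∀ {D D' : ℕ → ℕ → Prop} {s' : Mem} {t v : ℕ}, (t = 7 ∨ t = 8) →
      (∀ d < S.k, ∀ g < S.slots, D' d g → D d g) → Outcome S D p p' s' →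
      Outcome S D' p p' (s'.setW t 0 v) := by
    intro D D' s' t v ht hD ho
    unfold Outcome
    rw [(hw _ _ _ ht).1, (hw _ _ _ ht).2]
    exact ⟨fun h d hd g hg h' => ho.1 h d hd g hg (hD d hd g hg h'), ho.2⟩
  refine wp_loop_orientations hZ hE (fun d s' => Outcome S (fun d' _ => d' < d) p p' s')
    (by simp [SP.writesW, h7]) (by simp [SP.writesW, h0]) ?_ ?_ ?_
  · refine cast (D := fun _ _ => False) (Or.inl rfl) (fun d _ g _ h => by omega)
      ⟨fun _ _ _ _ _ h => h.elim, fun h => absurd h32 h⟩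
  · intro d hd s1 hd1 f1 I1
    have E1 := hE.frame f1 (by
      simp only [keepsEnv, Bool.not_eq_true', Bool.or_eq_false_iff] at hk
      simp [keepsEnv, SP.writesW, SP.writesR, hk])
    refine wp_loop_slots hZ E1
      (fun g s' => Outcome S (fun d' g' => d' < d ∨ (d' = d ∧ g' < g)) p p' s')
      h8 (by simp [SP.writesW, h4]) ?_ ?_ ?_
    · exact cast (Or.inr rfl) (fun d' _ g' _ h => by omega) I1
    · intro g hg s2 hg2 f2 I2
      have hd2 : s2.w 7 0 = d := by rw [f2.1 7 (by simp [SP.writesW, h7]), hd1]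
      refine wp_mono Z ?_ (hstep d hd g hg s2 (Frame.loop f1 f2) hd2 hg2 I2.2)
      rintro s3 ⟨h5, h6⟩
      refine cast (D := fun d' g' => d' < d ∨ (d' = d ∧ g' < g + 1)) (Or.inr rfl)
        (fun _ _ _ _ h => h) ⟨fun h' d' hd' g' hg' hD => ?_, h6⟩
      obtain ⟨h7', h8'⟩ := h5 h'
      by_cases he : d' = d ∧ g' = g
      · obtain ⟨rfl, rfl⟩ := he
        exact h8'
      · exact I2.1 h7' d' hd' g' hg' (by omega)
    · intro s2 f2 I2
      exact cast (Or.inl rfl) (fun d' _ g' hg' h => by omega) I2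
  · intro s1 f1 I1
    exact ⟨fun h d hd g hg _ => I1.1 h d hd g hg hd, I1.2⟩

lemma wp_searchHere (hZ : SizesOK S Z) (hE : Env S s) (h32 : s.w 32 0 = 0)
    (hr : s.w 24 0 < 16 * S.k * S.n)
    (h : ∀ s', Frame searchHere s s' → Outcome S (fun _ _ => True)
      (fun d g => s.r 23 0 ∈ S.row s (s.w 24 0) d g)
      (fun d g _ => s.r 23 0 ∈ S.row s (s.w 24 0) d g) s' → Q s') :
    wp Z searchHere Q s := by
  have hk := hZ.k_lt
  have hG : S.slots < _ := hZ.G_lt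
  have hMV := hZ.radix_le
  refine wp_search hZ hE (p' := fun d g _ => s.r 23 0 ∈ S.row s (s.w 24 0) d g) rfl rfl rfl rfl rfl
    h32 ?_ h
  intro d hd g hg s1 f1 h7 h8 hI
  have E1 := hE.frame f1
  have w24 : s1.w 24 = s.w 24 := f1.w 24
  have r23 : s1.r 23 = s.r 23 := f1.r 23
  have hx := hZ.idx3_le hr (hd.trans hk) (hg.trans hG)
  have hrow : S.row s (s.w 24 0) d g = slot s1 (idx3 (16 * S.k * S.n) (s.w 24 0) d g) := by
    rw [row_of_lt hd hg, slot, slot, f1.r 7, f1.r 8]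
  simp [h7, h8, E1.radix, w24, r23, hrow]
  simp only [slot, Set.mem_Icc]
  refine ⟨hx, fun h1 => ⟨fun h2 => by omega, fun h2 => hI h2⟩, fun h1 => ⟨fun h2 =>
    ⟨fun _ => ⟨h1, fun h3 => absurd h3.1 (not_le.2 h2)⟩, fun h3 => absurd h1 h3⟩, fun h2 => ⟨fun h3 =>
    ⟨fun _ => ⟨h1, fun h4 => absurd h4.2 (not_le.2 h3)⟩, fun h4 => absurd h1 h4⟩, fun h3 => ⟨by omega, by omega, ?_⟩⟩⟩⟩
  refine ⟨hd, g, hg, ?_⟩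
  rw [hrow]
  exact ⟨h2, h3⟩

lemma wp_solve (hV : 5 ≤ Z.V) (hlow : s.r 10 0 = 1)
    (hsol : ∃ σ, ∀ j < 5, constraint s (s.r 23 0) σ j)
    (h : ∀ s', Frame solve s s' → (∀ j < 5, constraint s (s.r 23 0) (s'.r 24 0) j) → Q s') :
    wp Z solve Q s := by
  refine wp_mono Z (fun s' hs' => h s' hs'.2 hs'.1) (wp_frame Z ?_)
  refine ⟨by simp, by simp, ?_⟩
  have hv : (0 - (RE.get 11 0 + RE.get 9 0 * RE.var 23) : RE).eval s =
      -(s.r 11 0 + s.r 9 0 * s.r 23 0) := by simp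
  rw [hv]
  refine wp_loop Z (fun j s' =>
    (∀ j' < j, 0 < s.r 10 j' → -(s.r 11 j' + s.r 9 j' * s.r 23 0) / s.r 10 j' ≤ s'.r 24 0) ∧
    ∃ j < 5, 0 < s.r 10 j ∧ s'.r 24 0 = -(s.r 11 j + s.r 9 j * s.r 23 0) / s.r 10 j)
    5 rfl (by simp) hV rfl (by simp [WE.reads, show (5 : WE) = .const 5 from rfl]) ?_ ?_ ?_
  · refine ⟨fun j hj => by omega, 0, by omega, by simp [hlow], ?_⟩
    rw [hlow]
    simp
  · rintro j hj s1 hj1 f1 ⟨I1, I2⟩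
    have r9 : s1.r 9 = s.r 9 := f1.r 9
    have r10 : s1.r 10 = s.r 10 := f1.r 10
    have r11 : s1.r 11 = s.r 11 := f1.r 11
    have r23 : s1.r 23 = s.r 23 := f1.r 23
    have split : ∀ {p : ℕ → Prop}, (∀ j' < j, p j') → p j → ∀ j' < j + 1, p j' := by
      intro p h1 h2 j' hj'
      rcases Nat.lt_succ_iff_lt_or_eq.1 hj' with h3 | rfl
      exacts [h1 j' h3, h2]
    have hz : ∀ x : ℝ, (0 - x) = -x := fun x => by ring
    simp only [wp_ite, TE.safe_rlt, RE.safe_lit_0, RE.safe_get, TE.holds_rlt, RE.eval_lit_0,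
      RE.eval_get, WE.eval_var, hj1, r10, wp_block_cons, wp_block_one, wp_setr, RE.safe_div,
      RE.safe_sub, RE.safe_add, RE.safe_mul, RE.safe_var, RE.eval_div, RE.eval_sub, RE.eval_add,
      RE.eval_mul, RE.eval_var, r9, r11, r23, wp_skip, Mem.setR_r_self, hz]
    refine ⟨⟨trivial, by simp⟩, fun hp => ⟨⟨by simp, by simp, hp.ne'⟩, by simp, ⟨by simp, by simp⟩,
      fun hlt => ⟨by simp, by simp, ?_⟩, fun hle => ?_⟩, fun hn => ⟨?_, I2⟩⟩
    · simp only [Mem.setR_r_of_ne, ne_eq, Nat.reduceEqDiff, not_false_eq_true] at hlt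
      refine ⟨split (fun j' hj' h1 => ?_) fun _ => by simp, j, by omega, hp, by simp⟩
      simp only [Mem.setR_r_self, Mem.setW_r]
      exact (I1 j' hj' h1).trans hlt.le
    · simp only [Mem.setR_r_of_ne, ne_eq, Nat.reduceEqDiff, not_false_eq_true, not_lt] at hle
      refine ⟨split (fun j' hj' h1 => ?_) fun _ => by simpa using hle, by simpa using I2⟩
      simpa using I1 j' hj' h1
    · exact split I1 fun h1 => absurd h1 hn
  · rintro s1 - f1 ⟨I1, I2⟩
    exact largest_lower_bound (N := 5) (fun j => s.r 10 j) (fun j => s.r 11 j + s.r 9 j * s.r 23 0)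
      (s1.r 24 0) I1 I2 hsol

/-- Whether the orientations `d` and `c` are admitted by the setting of scalar `17`. -/
def Admitted (s : Mem) (d c : ℕ) : Prop := s.w 17 0 = 0 ∨ d = c

lemma wp_searchCone (hS : S.Valid) (hZ : SizesOK S Z) (hE : Env S s) (h32 : s.w 32 0 = 0)
    (hr : s.w 24 0 < 16 * S.k * S.n) (hi : s.w 5 0 ≤ S.n) (hc : s.w 9 0 < S.k)
    (h : ∀ s', Frame searchCone s s' → Outcome S (fun _ _ => True)
      (fun d g => Admitted s d (s.w 9 0) ∧
        s.r 23 0 ∈ S.cone (s.w 5 0) (S.row s (s.w 24 0) d g) d (s.w 9 0))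
      (fun d g σ => Admitted s d (s.w 9 0) ∧ σ ∈ S.row s (s.w 24 0) d g ∧
        InCone (S.dir d) (S.dir (s.w 9 0))
          (S.pt (s.w 5 0 + 1) (s.r 23 0) - S.pt (s.w 5 0) σ)) s' → Q s') :
    wp Z searchCone Q s := by
  have hk := hZ.k_lt
  have hG : S.slots < _ := hZ.G_lt
  have hMV := hZ.radix_le
  refine wp_search hZ hE (p' := fun d g σ => Admitted s d (s.w 9 0) ∧ σ ∈ S.row s (s.w 24 0) d g ∧
        InCone (S.dir d) (S.dir (s.w 9 0))
          (S.pt (s.w 5 0 + 1) (s.r 23 0) - S.pt (s.w 5 0) σ)) rfl rfl rfl rfl rfl h32 ?_ h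
  intro d hd g hg s1 f1 h7 h8 hI
  have E1 := hE.frame f1
  have w24 : s1.w 24 = s.w 24 := f1.w 24
  have w5 : s1.w 5 = s.w 5 := f1.w 5
  have w9 : s1.w 9 = s.w 9 := f1.w 9
  have w17 : s1.w 17 = s.w 17 := f1.w 17
  have r23 : s1.r 23 = s.r 23 := f1.r 23
  have hrow : S.row s1 = S.row s := row_congr (f1.r 7) (f1.r 8)
  have hadm : s.w 17 0 * ((d - s.w 9 0) + (s.w 9 0 - d)) < 1 ↔ Admitted s d (s.w 9 0) := by
    rw [Nat.lt_one_iff, Nat.mul_eq_zero, Admitted]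
    exact or_congr Iff.rfl ⟨fun h => by omega, fun h => by omega⟩
  simp only [wp_ite, TE.safe_wlt, TE.holds_wlt, WE.eval_lit_0, WE.eval_var, wp_skip, WE.eval_mul,
    WE.eval_add, WE.eval_sub, WE.eval_lit_1, w17, w9, h7, hadm, true_and]
  refine ⟨fun h1 => ⟨fun h2 => by omega, fun h2 => hI h2⟩, fun h1 => ⟨fun hA => ?_, fun hA =>
    ⟨fun _ => ⟨by omega, fun h => hA h.1⟩, fun h2 => hI h2⟩⟩⟩
  simp only [wp_block_cons]
  refine wp_coneAt hS hZ E1 (by rw [w5]; exact hi) (by rw [h7]; exact hd) (by rw [h8]; exact hg)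
    (by rw [w9]; exact hc) (by rw [w24]; exact hr) fun s2 f2 hcon hw => ?_
  rw [w5, w24, w9, h7, h8, hrow] at hcon hw
  have r23' : s2.r 23 = s.r 23 := by rw [f2.r 23, r23]
  have w32 : s2.w 32 0 = 0 := by rw [f2.w 32]; omega
  have hw' : s.r 23 0 ∈ S.cone (s.w 5 0) (S.row s (s.w 24 0) d g) d (s.w 9 0) ↔
      s2.r 12 0 ≤ s.r 23 0 ∧ s.r 23 0 ≤ s2.r 13 0 := by rw [← hw]; rfl
  have w7' : s2.w 7 0 = d := by rw [f2.w 7, h7]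
  simp only [wp_block_one, wp_ite, TE.safe_rlt, TE.holds_rlt, RE.safe_var, RE.eval_var, wp_skip,
    r23', w32, hw', not_lt]
  refine ⟨by simp, fun h2 => ⟨fun _ => ⟨by omega, fun h3 => by linarith [h3.2.1]⟩, fun h3 =>
    absurd rfl h3⟩, fun h2 => ⟨by simp, fun h3 => ⟨fun _ => ⟨by omega, fun h4 =>
    by linarith [h4.2.2]⟩, fun h4 => absurd rfl h4⟩, fun h3 => ?_⟩⟩
  have hmem := hw'.2 ⟨h2, h3⟩
  obtain ⟨-, σ, hσ⟩ := hmem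
  simp only [wp_block_cons]
  refine wp_solve (by have := hZ.npos; have := hZ.row_lt; omega) hcon.low
    ⟨σ, by rw [r23']; exact (hcon.iff _ _).2 hσ⟩ fun s3 f3 h4 => ?_
  rw [r23'] at h4
  have h5 := (hcon.iff _ _).1 h4
  have w7'' : s3.w 7 0 = d := by rw [f3.w 7, w7']
  simp [w7'']
  exact ⟨by omega, by omega, hd, g, hg, hA, h5⟩

end
end Algo
end LinkTour

/-! ### Construction of the path by backtracking -/

namespace LinkTour
open RealRAM

namespace Scene
variable {S : Scene}

/-- A point of segment `i + 1` that cannot be reached with one link less is reached from segment `i`,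
either directly or by a turn that the cone of the two orientations describes. -/
lemma Valid.predecessor (hS : S.Valid) {m i c : ℕ} {q : Plane} (h : S.Reach m (i + 1) c q)
    (hD : ∀ d, ¬ S.Reach (m - 1) (i + 1) d q) :
    (∃ σ ∈ Set.Icc (1 : ℝ) 2, S.Reach m i c (S.pt i σ) ∧
      InCone (S.dir c) (S.dir c) (q - S.pt i σ)) ∨
    ∃ d < S.k, ∃ σ ∈ Set.Icc (1 : ℝ) 2, S.Reach (m - 1) i d (S.pt i σ) ∧
      InCone (S.dir d) (S.dir c) (q - S.pt i σ) := by
  cases h with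
  | push hp hα h hq =>
    obtain ⟨σ, hσ, rfl⟩ := hp.mem_seg
    refine Or.inl ⟨σ, hσ, hp, ?_⟩
    rw [h, add_sub_cancel_left]
    exact inCone_ray hα
  | @turn m _ d _ p _ α β hp hc hα hβ h hq =>
    obtain ⟨σ, hσ, rfl⟩ := hp.mem_seg
    by_cases hdc : det2 (S.dir d) (S.dir c) = 0
    · rcases hS.par d hp.lt_k c hc hdc with he | he
      · refine Or.inl ⟨σ, hσ, ?_, ?_⟩
        · have : d = c := hS.inj d hp.lt_k c hc he
          subst this
          exact hp.mono (by omega)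
        · rw [h, he, show S.pt i σ + α • S.dir c + β • S.dir c - S.pt i σ = (α + β) • S.dir c by
            rw [add_smul]; abel]
          exact inCone_ray (by linarith)
      · rcases le_total α β with hab | hab
        · refine Or.inr ⟨d, hp.lt_k, σ, hσ, hp, ?_⟩
          rw [h, he, show S.pt i σ + α • -S.dir c + β • S.dir c - S.pt i σ = (β - α) • S.dir c by
            rw [sub_smul, smul_neg]; abel]
          exact inCone_ray (by linarith)
        · refine absurd ?_ (hD d)
          refine Reach.push (α := α - β) hp (by linarith) ?_ hq
          have : S.dir c = -S.dir d := by rw [he, neg_neg]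
          rw [h, this, sub_smul, smul_neg]
          abel
    · refine Or.inr ⟨d, hp.lt_k, σ, hσ, hp, α, β, hα, hβ, fun h0 => absurd h0 hdc, ?_⟩
      rw [h]
      abel
  | deg hq hc => exact absurd hq (hD _)

/-- The vertices `v m, …, v M` complete each path with `m` links to the point with parameter `τ` on
segment `i`, of which the last has orientation `c`, to a path with `M` links to the point `t` on the
last segment.  There is such a path, and `a` tells how far `m` is above the minimum. -/
structure Trace (S : Scene) (M c₀ : ℕ) (t : Plane) (i a c : ℕ) (τ : ℝ) (m : ℕ) (v : ℕ → Plane) :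
    Prop where
  seg_le : i ≤ S.n + 1
  pos : 1 ≤ a
  le_three : a ≤ 3
  links : m + 1 = S.mu i + a
  links_le : m ≤ M
  mem : τ ∈ Set.Icc (1 : ℝ) 2
  reach : S.Reach m i c (S.pt i τ)
  last : v M = t
  pre : ∀ u, S.Pre m i c (S.pt i τ) u → S.Pre M (S.n + 1) c₀ t fun j => if j < m then u j else v j

variable {M c₀ : ℕ} {t : Plane} {i a c : ℕ} {τ : ℝ} {m : ℕ} {v : ℕ → Plane}

/-- Adding a vertex. -/
lemma Trace.pre_update (T : S.Trace M c₀ t i a c τ m v) (hm : 1 ≤ m) {z : Plane} {u : ℕ → Plane}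
    (h : S.Pre m i c (S.pt i τ) (Function.update u (m - 1) z)) :
    S.Pre M (S.n + 1) c₀ t fun j => if j < m - 1 then u j else Function.update v (m - 1) z j := by
  refine (T.pre _ h).congr fun j _ => ?_
  by_cases h1 : j < m - 1
  · rw [if_pos h1, if_pos (by omega), Function.update_of_ne (by omega)]
  · rw [if_neg h1]
    by_cases h2 : j = m - 1
    · subst h2
      rw [if_pos (by omega)]
      simp
    · rw [if_neg (by omega), Function.update_of_ne h2]

/-- If the same point is reached with one link less, then the link can be degenerate. -/
lemma Trace.stay (T : S.Trace M c₀ t i a c τ m v) (ha : 2 ≤ a) {d : ℕ}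
    (h : S.Reach (m - 1) i d (S.pt i τ)) :
    S.Trace M c₀ t i (a - 1) d τ (m - 1) (Function.update v (m - 1) (S.pt i τ)) := by
  have h1 := h.pos
  have h2 := T.links
  have h3 := T.links_le
  have h4 := T.le_three
  refine ⟨T.seg_le, by omega, by omega, by omega, by omega, T.mem, h, ?_, fun u hu => ?_⟩
  · rw [Function.update_of_ne (by omega), T.last]
  · refine T.pre_update (by omega) ?_
    have := hu.link (q := S.pt i τ) T.reach.lt_k le_rfl (by simp)
    rwa [show m - 1 + 1 = m by omega] at this

/-- The last link goes on backwards to a point of the previous segment. -/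
lemma Trace.straight (T : S.Trace M c₀ t (i + 1) a c τ m v) {δ : ℕ}
    (hδ : S.mu (i + 1) = S.mu i + δ) (ha : a + δ ≤ 3) {σ : ℝ} (hσ : σ ∈ Set.Icc (1 : ℝ) 2)
    (h : S.Reach m i c (S.pt i σ))
    (hc : InCone (S.dir c) (S.dir c) (S.pt (i + 1) τ - S.pt i σ)) :
    S.Trace M c₀ t i (a + δ) c σ m v := by
  have h1 := T.links
  have h2 := T.pos
  have h3 := T.seg_le
  obtain ⟨α, β, hα, hβ, h0, he⟩ := hc
  rw [h0 (det2_self _), zero_smul, zero_add, sub_eq_iff_eq_add'] at he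
  refine ⟨by omega, by omega, ha, by omega, T.links_le, hσ, h, T.last, fun u hu => T.pre u ?_⟩
  exact (hu.extend hβ he).visit ⟨τ, T.mem, rfl⟩

/-- The last link starts at a turn after the visit of a point of the previous segment. -/
lemma Trace.turn (T : S.Trace M c₀ t (i + 1) a c τ m v) {δ d : ℕ}
    (hδ : S.mu (i + 1) = S.mu i + δ) (ha : a + δ ≤ 3) (ha' : 2 ≤ a + δ) {σ : ℝ}
    (hσ : σ ∈ Set.Icc (1 : ℝ) 2) (h : S.Reach (m - 1) i d (S.pt i σ)) {α : ℝ}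
    (hα : det2 (S.dir d) (S.dir c) ≠ 0 →
      α = det2 (S.pt (i + 1) τ - S.pt i σ) (S.dir c) / det2 (S.dir d) (S.dir c))
    (hα0 : det2 (S.dir d) (S.dir c) = 0 → α = 0)
    (hc : InCone (S.dir d) (S.dir c) (S.pt (i + 1) τ - S.pt i σ)) :
    S.Trace M c₀ t i (a + δ - 1) d σ (m - 1)
      (Function.update v (m - 1) (S.pt i σ + α • S.dir d)) := by
  have h1 := T.links
  have h2 := T.pos
  have h3 := T.seg_le
  have h4 := T.links_le
  have h5 := h.pos
  obtain ⟨α', β, hα', hβ, h0, he⟩ := hc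
  obtain rfl : α = α' := by
    by_cases hD : det2 (S.dir d) (S.dir c) = 0
    · rw [h0 hD, hα0 hD]
    · rw [hα hD, he, det2_comb_left, mul_div_cancel_right₀ _ hD]
  refine ⟨by omega, by omega, by omega, by omega, by omega, hσ, h, ?_, fun u hu => ?_⟩
  · rw [Function.update_of_ne (by omega), T.last]
  · refine T.pre_update (by omega) ?_
    have := (hu.extend hα' rfl).link (q := S.pt (i + 1) τ) T.reach.lt_k hβ (by
      rw [add_assoc, ← he]; abel)
    rw [show m - 1 + 1 = m by omega] at this
    exact this.visit ⟨τ, T.mem, rfl⟩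

end Scene

namespace Algo

/-- Backtracking step to the same segment with one link less. -/
def stay : SP := .block [
  .setw 31 (.var 31 - 1),
  .rset 30 (.var 31) (.get 3 (.var 28) + .var 23 * .get 5 (.var 28)),
  .rset 31 (.var 31) (.get 4 (.var 28) + .var 23 * .get 6 (.var 28)),
  .setw 29 (.var 29 - 1), .setw 30 (.var 33)]

/-- Backtracking step along the current link to the previous segment. -/
def straight : SP := .block [.setw 28 (.var 5), .setw 29 (.var 18), .setr 23 (.var 24)]

/-- Computes the length of the link before the last. -/
def turnLength : SP := .block [
  .setr 17 (.get 3 (.var 5) + .var 24 * .get 5 (.var 5)),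
  .setr 18 (.get 4 (.var 5) + .var 24 * .get 6 (.var 5)),
  .setr 19 (.get 3 (.var 28) + .var 23 * .get 5 (.var 28) - .var 17),
  .setr 20 (.get 4 (.var 28) + .var 23 * .get 6 (.var 28) - .var 18),
  .setr 14 (.get 1 (.var 33) * .get 2 (.var 30) - .get 2 (.var 33) * .get 1 (.var 30)),
  .setr 15 0,
  .ite (.rlt 0 (.var 14 * .var 14))
    (.setr 15 ((.var 19 * .get 2 (.var 30) - .var 20 * .get 1 (.var 30)) / .var 14)) .skip]

/-- Backtracking step to the previous segment with a vertex in between. -/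
def turn : SP := .block [turnLength,
  .setw 31 (.var 31 - 1),
  .rset 30 (.var 31) (.var 17 + .var 15 * .get 1 (.var 33)),
  .rset 31 (.var 31) (.var 18 + .var 15 * .get 2 (.var 33)),
  .setw 28 (.var 5), .setw 29 (.var 18 - 1), .setw 30 (.var 33), .setr 23 (.var 24)]

/-- Backtracking step to the previous segment. -/
def leave : SP := .block [
  .setw 5 (.var 28 - 1), .setw 18 (.var 29 + .get 21 (.var 28)), .setw 9 (.var 30),
  .setw 24 (.get 20 (4 * .var 5 + .var 18)), .setw 17 1, searchCone,
  .ite (.wlt 0 (.var 32)) straight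
    (.block [.setw 17 0, .setw 24 (.get 20 (4 * .var 5 + .var 18 - 1)), searchCone, turn])]

/-- A backtracking step, which does nothing when the start has been reached. -/
def round : SP := .ite (.wlt 1 (4 * .var 28 + .var 29)) (.block [
  .setw 32 0,
  .ite (.wlt 1 (.var 29))
    (.block [.setw 24 (.get 20 (4 * .var 28 + .var 29 - 1)), searchHere]) .skip,
  .ite (.wlt 0 (.var 32)) stay leave]) .skip

/-- The vertices found so far. -/
def vertex (s : Mem) (j : ℕ) : Plane := (s.r 30 j, s.r 31 j)

/-- The state of the backtracking. -/
structure Back (S : Scene) (M c₀ : ℕ) (t : Plane) (i a c : ℕ) (τ : ℝ) (m : ℕ) (s : Mem) :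
    Prop where
  fwd : Fwd S s (S.n + 1)
  w28 : s.w 28 0 = i
  w29 : s.w 29 0 = a
  w30 : s.w 30 0 = c
  w31 : s.w 31 0 = m
  r23 : s.r 23 0 = τ
  trace : S.Trace M c₀ t i a c τ m (vertex s)

section
variable {S : Scene} {Z : Sizes} {s s' : Mem} {Q : Mem → Prop} {M c₀ : ℕ} {t : Plane} {i a c : ℕ}
  {τ : ℝ} {m : ℕ}

lemma Fwd.env_setR {j : ℕ} (h : Fwd S s j) {t i : ℕ} {v : ℝ}
    (ht : decide (8 < t) = true := by rfl) : Fwd S (s.setR t i v) j := by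
  have ht := of_decide_eq_true ht
  refine h.congr (h.env.setR (by simp; omega)) ?_ ?_ rfl rfl rfl rfl <;>
  exact Mem.setR_r_of_ne _ _ _ (by omega)

lemma Fwd.setW {j : ℕ} (h : Fwd S s j) {t i v : ℕ}
    (ht : decide (4 < t ∧ (t < 20 ∨ 22 < t) ∧ t ≠ 27) = true := by rfl) : Fwd S (s.setW t i v) j := by
  have ht := of_decide_eq_true ht
  refine h.congr (h.env.setW (by simp; omega)) rfl rfl ?_ ?_ ?_ ?_ <;>
  exact Mem.setW_w_of_ne _ _ _ (by omega)

lemma Back.facts (hS : S.Valid) (hZ : SizesOK S Z) (B : Back S M c₀ t i a c τ m s) :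
    m + 4 * S.n + 4 ≤ 4 * S.n + Z.V ∧ 4 * S.n + 8 ≤ Z.V ∧ S.k ≤ Z.V := by
  have hi := B.trace.seg_le
  have h1 := B.trace.le_three
  have h2 := B.trace.links
  have h3 := hZ.row_lt
  have h4 := hZ.radix_le
  have h5 := mu_le_linear hS i
  have hk := hZ.k_lt
  omega

lemma wp_stay (hS : S.Valid) (hZ : SizesOK S Z) (B : Back S M c₀ t i a c τ m s) (ha : 2 ≤ a)
    (h33 : s.w 33 0 < S.k) (hr : S.Reach (m - 1) i (s.w 33 0) (S.pt i τ))
    (h : ∀ s', Back S M c₀ t i (a - 1) (s.w 33 0) τ (m - 1) s' → Q s') : wp Z stay Q s := by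
  obtain ⟨h1, h2, h3⟩ := B.facts hS hZ
  have h4 := B.trace.le_three
  have hi := B.trace.seg_le
  have E := B.fwd.env
  simp [stay, B.w28, B.w29, B.w31, B.r23, E.ox i hi, E.oy i hi, E.vx i hi, E.vy i hi]
  refine ⟨by omega, by omega, by omega, h _ ⟨?_, ?_, ?_, ?_, ?_, ?_, ?_⟩⟩
  · exact B.fwd.setW.env_setR.env_setR.setW.setW
  · simp [B.w28]
  · simp
  · simp
  · simp
  · simp [B.r23]
  · convert B.trace.stay ha hr using 1
    funext j
    simp only [vertex, Function.update_apply, Mem.setW_r, Mem.setR_r_same, Mem.setR_r_of_ne, ne_eq,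
      Nat.reduceEqDiff, not_false_eq_true]
    split_ifs <;> rfl

lemma wp_straight (hS : S.Valid) (hZ : SizesOK S Z) (B : Back S M c₀ t (i + 1) a c τ m s)
    (h5 : s.w 5 0 = i) (h18 : s.w 18 0 = a + s.w 21 (i + 1)) (ha : a + s.w 21 (i + 1) ≤ 3)
    (hσ : s.r 24 0 ∈ Set.Icc (1 : ℝ) 2) (hr : S.Reach m i c (S.pt i (s.r 24 0)))
    (hc : InCone (S.dir c) (S.dir c) (S.pt (i + 1) τ - S.pt i (s.r 24 0)))
    (h : ∀ s', Back S M c₀ t i (a + s.w 21 (i + 1)) c (s.r 24 0) m s' → Q s') :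
    wp Z straight Q s := by
  obtain ⟨h1, h2, h3⟩ := B.facts hS hZ
  have hi := B.trace.seg_le
  simp [straight, h5, h18]
  refine ⟨by omega, by omega, h _ ⟨?_, ?_, ?_, ?_, ?_, ?_, ?_⟩⟩
  · exact B.fwd.setW.setW.env_setR
  · simp
  · simp
  · simp [B.w30]
  · simp [B.w31]
  · simp
  · exact B.trace.straight (B.fwd.delta i (by omega)) ha hσ hr hc

lemma wp_turn (hS : S.Valid) (hZ : SizesOK S Z) (B : Back S M c₀ t (i + 1) a c τ m s)
    (h5 : s.w 5 0 = i) (h18 : s.w 18 0 = a + s.w 21 (i + 1)) (ha : a + s.w 21 (i + 1) ≤ 3)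
    (ha' : 2 ≤ a + s.w 21 (i + 1)) (h33 : s.w 33 0 < S.k) (hσ : s.r 24 0 ∈ Set.Icc (1 : ℝ) 2)
    (hr : S.Reach (m - 1) i (s.w 33 0) (S.pt i (s.r 24 0)))
    (hc : InCone (S.dir (s.w 33 0)) (S.dir c) (S.pt (i + 1) τ - S.pt i (s.r 24 0)))
    (h : ∀ s', Back S M c₀ t i (a + s.w 21 (i + 1) - 1) (s.w 33 0) (s.r 24 0) (m - 1) s' → Q s') :
    wp Z turn Q s := by
  obtain ⟨h1, h2, h3⟩ := B.facts hS hZ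
  have hi := B.trace.seg_le
  have hi' : i ≤ S.n + 1 := by omega
  have hck := B.trace.reach.lt_k
  have E := B.fwd.env
  simp only [turn, wp_block_cons]
  refine wp_mono (P := turnLength) Z ?_ (wp_frame Z (Q := fun s2 =>
      s2.r 17 0 = (S.pt i (s.r 24 0)).1 ∧ s2.r 18 0 = (S.pt i (s.r 24 0)).2 ∧
      (det2 (S.dir (s.w 33 0)) (S.dir c) ≠ 0 → s2.r 15 0 =
        det2 (S.pt (i + 1) τ - S.pt i (s.r 24 0)) (S.dir c) / det2 (S.dir (s.w 33 0)) (S.dir c)) ∧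
      (det2 (S.dir (s.w 33 0)) (S.dir c) = 0 → s2.r 15 0 = 0)) ?_)
  · rintro s2 ⟨⟨h17, h18', hα, hα0⟩, f⟩
    have hw : s2.w = s.w := by funext t'; exact f.1 t' (by rfl)
    have h24 : s2.r 24 = s.r 24 := f.r 24
    have hF : Fwd S s2 (S.n + 1) :=
      B.fwd.congr (E.frame f) (f.r 7) (f.r 8) (f.w 20) (f.w 21) (f.w 22) (f.w 27)
    have h30 : s2.r 30 = s.r 30 := f.r 30
    have h31 : s2.r 31 = s.r 31 := f.r 31
    have E2 := hF.env
    simp [hw, B.w31, h17, h18', h24, h5, h18, E2.dx _ h33, E2.dy _ h33]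
    refine ⟨by omega, by omega, by omega, by omega, h _ ⟨?_, ?_, ?_, ?_, ?_, ?_, ?_⟩⟩
    · exact hF.setW.env_setR.env_setR.setW.setW.setW.env_setR
    · simp
    · simp
    · simp
    · simp
    · simp
    · convert B.trace.turn (B.fwd.delta i (by omega)) ha ha' hσ hr hα hα0 hc using 1
      funext j
      simp only [vertex, Function.update_apply, Mem.setW_r, Mem.setR_r_same, Mem.setR_r_of_ne, ne_eq,
        Nat.reduceEqDiff, not_false_eq_true, h30, h31]
      split_ifs <;> rfl
  · simp [turnLength, h5, B.w28, B.w30, B.r23, E.ox _ hi, E.oy _ hi, E.vx _ hi, E.vy _ hi,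
      E.ox _ hi', E.oy _ hi', E.vx _ hi', E.vy _ hi', E.dx _ h33, E.dy _ h33, E.dx _ hck, E.dy _ hck]
    have hdet : det2 (S.dir (s.w 33 0)) (S.dir c) = (S.dir (s.w 33 0)).1 * (S.dir c).2 -
      (S.dir (s.w 33 0)).2 * (S.dir c).1 := rfl
    rw [← hdet]
    have e1 : (S.org i).1 + s.r 24 0 * (S.vec i).1 = (S.pt i (s.r 24 0)).1 := rfl
    have e2 : (S.org i).2 + s.r 24 0 * (S.vec i).2 = (S.pt i (s.r 24 0)).2 := rfl
    exact ⟨fun hp => ⟨hp, e1, e2, fun _ => rfl, fun h0 => absurd h0 hp⟩,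
      fun hn => ⟨e1, e2, fun hp => absurd hn hp⟩⟩

end
end Algo
end LinkTour

namespace LinkTour
open RealRAM
namespace Algo
section
variable {S : Scene} {Z : Sizes} {s s' : Mem} {Q : Mem → Prop} {M c₀ : ℕ} {t : Plane} {i a c : ℕ}
  {τ : ℝ} {m : ℕ}

lemma Back.congr (B : Back S M c₀ t i a c τ m s) (hF : Fwd S s' (S.n + 1))
    (h28 : s'.w 28 = s.w 28) (h29 : s'.w 29 = s.w 29) (h30 : s'.w 30 = s.w 30)
    (h31 : s'.w 31 = s.w 31) (h23 : s'.r 23 = s.r 23) (r30 : s'.r 30 = s.r 30)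
    (r31 : s'.r 31 = s.r 31) : Back S M c₀ t i a c τ m s' := by
  refine ⟨hF, by rw [h28, B.w28], by rw [h29, B.w29], by rw [h30, B.w30], by rw [h31, B.w31],
    by rw [h23, B.r23], ?_⟩
  convert B.trace using 1
  funext j
  simp [vertex, r30, r31]

lemma Back.setW (B : Back S M c₀ t i a c τ m s) {t' i' v : ℕ}
    (ht : decide (4 < t' ∧ (t' < 20 ∨ 22 < t' ∧ t' < 27 ∨ 31 < t')) = true := by rfl) :
    Back S M c₀ t i a c τ m (s.setW t' i' v) := by
  have ht := of_decide_eq_true ht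
  refine B.congr (B.fwd.setW (by simp; omega)) ?_ ?_ ?_ ?_ rfl rfl rfl <;>
  exact Mem.setW_w_of_ne _ _ _ (by omega)

lemma Back.searchHere (B : Back S M c₀ t i a c τ m s) (f : Frame searchHere s s') :
    Back S M c₀ t i a c τ m s' :=
  B.congr (B.fwd.congr (B.fwd.env.frame f) (f.r 7) (f.r 8) (f.w 20) (f.w 21) (f.w 22) (f.w 27))
    (f.w 28) (f.w 29) (f.w 30) (f.w 31) (f.r 23) (f.r 30) (f.r 31)

lemma Back.searchCone (B : Back S M c₀ t i a c τ m s) (f : Frame searchCone s s') :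
    Back S M c₀ t i a c τ m s' :=
  B.congr (B.fwd.congr (B.fwd.env.frame f) (f.r 7) (f.r 8) (f.w 20) (f.w 21) (f.w 22) (f.w 27))
    (f.w 28) (f.w 29) (f.w 30) (f.w 31) (f.r 23) (f.r 30) (f.r 31)

/-- A step to the previous segment is possible when the current point is not reached with one link
less. -/
lemma wp_leave (hS : S.Valid) (hZ : SizesOK S Z) (B : Back S M c₀ t (i + 1) a c τ m s)
    (ha : a + (S.mu (i + 1) - S.mu i) ≤ 3) (hD : ∀ d, ¬ S.Reach (m - 1) (i + 1) d (S.pt (i + 1) τ))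
    (h32 : s.w 32 0 = 0)
    (h : ∀ s' a' c' τ' m', a' ≤ 3 → Back S M c₀ t i a' c' τ' m' s' → Q s') :
    wp Z leave Q s := by
  obtain ⟨h1, h2, h3⟩ := B.facts hS hZ
  have hi := B.trace.seg_le
  have hM := hZ.row_lt
  have hδ := B.fwd.delta i (by omega)
  have ha1 := B.trace.pos
  have hm := B.trace.links
  have hck := B.trace.reach.lt_k
  have hL := B.fwd.layer i (by omega)
  have hmu := hS.mu_pos i
  have hlt := hL.lt (a + s.w 21 (i + 1)) (by omega)
  have hlt' := hL.lt (a + s.w 21 (i + 1) - 1) (by omega)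
  have hde := hL.desc (a + s.w 21 (i + 1)) (by omega)
  have hde' := hL.desc (a + s.w 21 (i + 1) - 1) (by omega)
  rw [show S.mu i + (a + s.w 21 (i + 1)) - 1 = m by omega] at hde
  rw [show S.mu i + (a + s.w 21 (i + 1) - 1) - 1 = m - 1 by omega] at hde'
  have main := hS.predecessor B.trace.reach hD
  simp [leave, B.w28, B.w29, B.w30]
  refine ⟨by omega, by omega, by omega, by omega, by omega, ?_⟩
  have B1 := (((((B.setW (t' := 5) (i' := 0) (v := i)).setW (t' := 18) (i' := 0)
    (v := a + s.w 21 (i + 1))).setW (t' := 9) (i' := 0) (v := c)).setW (t' := 24) (i' := 0)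
    (v := s.w 20 (4 * i + (a + s.w 21 (i + 1))))).setW (t' := 17) (i' := 0) (v := 1))
  refine wp_searchCone hS hZ B1.fwd.env (by simpa using h32) (by simp; omega) (by simp; omega)
    (by simpa using hck) fun s2 f2 O2 => ?_
  have B2 := B1.searchCone f2
  have e5 : s2.w 5 0 = i := by rw [f2.w 5]; simp
  have e9 : s2.w 9 0 = c := by rw [f2.w 9]; simp
  have e18 : s2.w 18 0 = a + s.w 21 (i + 1) := by rw [f2.w 18]; simp
  have e20 : s2.w 20 = s.w 20 := by rw [f2.w 20]; funext j; simp
  have e21 : s2.w 21 = s.w 21 := by rw [f2.w 21]; funext j; simp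
  have er : S.row s2 = S.row s := by
    rw [row_congr (f2.r 7) (f2.r 8)]; simp [row_setW]
  have w30 := B.r23
  simp [Outcome, Admitted, row_setW, B.r23] at O2
  obtain ⟨O2, O2'⟩ := O2
  simp only [wp_block_one, wp_ite, TE.safe_wlt, TE.holds_wlt, WE.eval_lit_0, WE.eval_var]
  refine ⟨by simp, fun hp => ?_, fun hn => ?_⟩
  · obtain ⟨-, g, hg, he, hσ, hc⟩ := O2' (by omega)
    rw [he] at hσ hc
    obtain ⟨hσ1, hσ2⟩ := (hde c hck _).1 ⟨g, hg, hσ⟩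
    refine wp_straight hS hZ B2 e5 (by rw [e18, e21]) (by rw [e21]; omega) hσ1 hσ2 hc fun s3 B3 => ?_
    exact h _ _ _ _ _ (by rw [e21]; omega) B3
  · have hno := O2 (by omega)
    have main' : ∃ d < S.k, ∃ σ ∈ Set.Icc (1 : ℝ) 2, S.Reach (m - 1) i d (S.pt i σ) ∧
        InCone (S.dir d) (S.dir c) (S.pt (i + 1) τ - S.pt i σ) := by
      refine main.resolve_left ?_
      rintro ⟨σ, hσ1, hσ2, hσ3⟩
      obtain ⟨g, hg, h5⟩ := (hde c hck σ).2 ⟨hσ1, hσ2⟩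
      exact hno c hck g hg rfl ⟨B.trace.mem, σ, h5, hσ3⟩
    obtain ⟨d, hd, σ, hσ1, hσ2, hσ3⟩ := main'
    have ha' : a + s.w 21 (i + 1) ≤ 3 := by omega
    have h2a : 2 ≤ a + s.w 21 (i + 1) := by
      have := S.mu_le hσ2
      omega
    rw [← Nat.add_sub_assoc (by omega)] at hde' hlt'
    simp [e5, e18, e20]
    refine ⟨by omega, ?_⟩
    have B3 := (B2.setW (t' := 17) (i' := 0) (v := 0)).setW (t' := 24) (i' := 0)
      (v := s.w 20 (4 * i + (a + s.w 21 (i + 1)) - 1))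
    refine wp_searchCone hS hZ B3.fwd.env (by simp; omega) (by simp; omega) (by simp [e5]; omega)
      (by simp [e9, hck]) fun s4 f4 O4 => ?_
    have B4 := B3.searchCone f4
    simp [Outcome, Admitted, row_setW, e9, e5, er, B2.r23] at O4
    obtain ⟨O4, O4'⟩ := O4
    have hne : s4.w 32 0 ≠ 0 := by
      intro h0
      obtain ⟨g, hg, h5⟩ := (hde' d hd σ).2 ⟨hσ1, hσ2⟩
      exact O4 h0 d hd g hg ⟨B.trace.mem, σ, h5, hσ3⟩
    obtain ⟨hk4, g, hg, hσ, hc⟩ := O4' hne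
    obtain ⟨hσ1, hσ2⟩ := (hde' _ hk4 _).1 ⟨g, hg, hσ⟩
    have e21' : s4.w 21 = s.w 21 := by rw [f4.w 21, ← e21]; funext j; simp
    refine wp_turn hS hZ B4 (by rw [f4.w 5]; simp [e5]) (by rw [f4.w 18, e21']; simp [e18])
      (by rw [e21']; exact ha') (by rw [e21']; exact h2a) hk4 hσ1 hσ2 hc fun s5 B5 => ?_
    exact h _ _ _ _ _ (by rw [e21']; exact (Nat.sub_le _ _).trans ha') B5

/-- Each backtracking step decreases `3 i + a` until the first segment and one link are left. -/
lemma wp_round (hS : S.Valid) (hZ : SizesOK S Z) (B : Back S M c₀ t i a c τ m s)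
    (h : ∀ s' i' a' c' τ' m', 3 * i' + a' < 3 * i + a ∨ 3 * i' + a' ≤ 1 →
      Back S M c₀ t i' a' c' τ' m' s' → Q s') : wp Z round Q s := by
  obtain ⟨h1, h2, h3⟩ := B.facts hS hZ
  have hi := B.trace.seg_le
  have hM := hZ.row_lt
  have ha := B.trace.pos
  have ha3 := B.trace.le_three
  have hm := B.trace.links
  have hck := B.trace.reach.lt_k
  have hL := B.fwd.layer i (by omega)
  have hmu := hS.mu_pos i
  simp [round, B.w28, B.w29]
  refine ⟨fun hlt => ?_, fun hle => h s i a c τ m (by omega) B⟩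
  have B1 : Back S M c₀ t i a c τ m (s.setW 32 0 0) := B.setW
  -- the choice between the two kinds of steps
  have key : ∀ s2, Back S M c₀ t i a c τ m s2 →
      (s2.w 32 0 = 0 → ∀ d, ¬ S.Reach (m - 1) i d (S.pt i τ)) →
      (s2.w 32 0 ≠ 0 → 2 ≤ a ∧ s2.w 33 0 < S.k ∧ S.Reach (m - 1) i (s2.w 33 0) (S.pt i τ)) →
      wp Z (.ite (.wlt 0 (.var 32)) stay leave) Q s2 := by
    intro s2 B2 hno hyes
    simp only [wp_ite, TE.safe_wlt, TE.holds_wlt, WE.eval_lit_0, WE.eval_var]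
    refine ⟨by simp, fun hp => ?_, fun hn => ?_⟩
    · obtain ⟨h4, h5, h6⟩ := hyes (by omega)
      exact wp_stay hS hZ B2 h4 h5 h6 fun s3 B3 => h _ _ _ _ _ _ (by omega) B3
    · have h0 : s2.w 32 0 = 0 := by omega
      have hD := hno h0
      rcases i with _ | i
      · refine absurd ?_ (hD c)
        obtain ⟨-, hr⟩ : True ∧ S.pt 0 τ = S.pt 0 1 := ⟨trivial, by simp [Scene.pt, hS.vec_zero]⟩
        rw [hr]
        exact (Scene.Reach.start hck).mono (by omega)
      · have hq : S.pt (i + 1) τ ∈ S.seg (i + 1) := ⟨τ, B.trace.mem, rfl⟩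
        refine wp_leave hS hZ B2 ?_ hD h0 fun s3 a' c' τ' m' ha' B3 =>
          h s3 i a' c' τ' m' (by omega) B3
        by_contra hlt3
        have := hS.mu_succ_le i
        by_cases ha2 : 3 ≤ a
        · obtain ⟨d, hd⟩ := hS.full_one hi hq
          exact hD d (hd.mono (by omega))
        · obtain ⟨d, hd⟩ := hS.full_zero (i := i) (by omega) hq
          exact hD d (hd.mono (by omega))
  refine ⟨fun h1a => ?_, fun h1a => ?_⟩
  · have hlt' := hL.lt (a - 1) (by omega)
    have hde := hL.desc (a - 1) (by omega)
    rw [← Nat.add_sub_assoc (by omega)] at hlt'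
    simp only [← Nat.add_sub_assoc (show 1 ≤ a by omega)] at hde
    rw [show S.mu i + a - 1 - 1 = m - 1 by omega] at hde
    refine ⟨by omega, ?_⟩
    have B2 := B1.setW (t' := 24) (i' := 0) (v := s.w 20 (4 * i + a - 1))
    refine wp_searchHere hZ B2.fwd.env (by simp) (by simp; omega) fun s3 f3 O3 => ?_
    have B3 := B2.searchHere f3
    simp [Outcome, row_setW, B.r23] at O3
    rw [wp_block_one]
    refine key s3 B3 (fun h0 d hd => ?_) fun h0 => ?_
    · obtain ⟨g, hg, h5⟩ := (hde d hd.lt_k τ).2 ⟨B.trace.mem, hd⟩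
      exact O3.1 h0 d hd.lt_k g hg h5
    · obtain ⟨h5, g, hg, h6⟩ := O3.2 h0
      exact ⟨h1a, h5, ((hde _ h5 τ).1 ⟨g, hg, h6⟩).2⟩
  · simpa using key _ B1 (fun _ d hd => by have := S.mu_le hd; omega) (by simp)

end
end Algo
end LinkTour

namespace LinkTour
open RealRAM
namespace Algo

/-- Chooses the last link of the path. -/
def lastLink : SP := .block [
  .setw 28 (.var 1 + 1), .setw 29 1, .setw 31 (.var 27), .setr 23 1, .setw 32 0,
  .rset 30 (.var 31) (.get 3 (.var 28) + .get 5 (.var 28)),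
  .rset 31 (.var 31) (.get 4 (.var 28) + .get 6 (.var 28)),
  .setw 24 (.get 20 (4 * .var 28 + .var 29)), searchHere, .setw 30 (.var 33)]

/-- Computes the vertices of a shortest path. -/
def backtrack : SP := .block [
  lastLink, .loop 34 (3 * .var 1 + 3) 6 0 1 round,
  .rset 30 0 (.get 3 0), .rset 31 0 (.get 4 0)]

/-- Copies the result to its place. -/
def output : SP := .block [
  .loop 35 (.var 27 + 1) 6 0 1 (.block [
    .rset 0 (2 * .var 35) (.get 30 (.var 35)), .rset 0 (2 * .var 35 + 1) (.get 31 (.var 35))]),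
  .setw 0 (.var 27)]

section
variable {S : Scene} {Z : Sizes} {s s' : Mem} {Q : Mem → Prop}

lemma wp_lastLink (hS : S.Valid) (hZ : SizesOK S Z) (hF : Fwd S s (S.n + 1))
    (hv : S.vec (S.n + 1) = 0)
    (h : ∀ s' c, Back S (S.mu (S.n + 1)) c (S.pt (S.n + 1) 1) (S.n + 1) 1 c 1 (S.mu (S.n + 1)) s' →
      Q s') : wp Z lastLink Q s := by
  have hM := hZ.row_lt
  have hMV := hZ.radix_le
  have hlin := mu_le_linear hS (S.n + 1)
  have hL := hF.layer (S.n + 1) le_rfl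
  have hlt := hL.lt 1 (by omega)
  have hde := hL.desc 1 (by omega)
  rw [Nat.add_sub_cancel] at hde
  have E := hF.env
  simp [lastLink, E.n, hF.links, E.ox _ le_rfl, E.oy _ le_rfl, E.vx _ le_rfl, E.vy _ le_rfl]
  refine ⟨by omega, by omega, by omega, by omega, ?_⟩
  have F1 := ((((((((hF.setW (t := 28) (i := 0) (v := S.n + 1)).setW (t := 29) (i := 0)
    (v := 1)).setW (t := 31) (i := 0) (v := S.mu (S.n + 1))).env_setR (t := 23) (i := 0)
    (v := 1)).setW (t := 32) (i := 0) (v := 0)).env_setR (t := 30) (i := S.mu (S.n + 1))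
    (v := (S.org (S.n + 1)).1 + (S.vec (S.n + 1)).1)).env_setR (t := 31) (i := S.mu (S.n + 1))
    (v := (S.org (S.n + 1)).2 + (S.vec (S.n + 1)).2)).setW (t := 24) (i := 0)
    (v := s.w 20 (4 * (S.n + 1) + 1)))
  refine wp_searchHere hZ F1.env (by simp) (by simp; omega) fun s2 f2 O2 => ?_
  have F2 : Fwd S s2 (S.n + 1) :=
    F1.congr (F1.env.frame f2) (f2.r 7) (f2.r 8) (f2.w 20) (f2.w 21) (f2.w 22) (f2.w 27)
  have w28 : s2.w 28 0 = S.n + 1 := by rw [f2.w 28]; simp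
  have w29 : s2.w 29 0 = 1 := by rw [f2.w 29]; simp
  have w31 : s2.w 31 0 = S.mu (S.n + 1) := by rw [f2.w 31]; simp
  have r23 : s2.r 23 0 = 1 := by rw [f2.r 23]; simp
  have r30 : s2.r 30 (S.mu (S.n + 1)) = (S.pt (S.n + 1) 1).1 := by
    rw [f2.r 30]; simp [Scene.pt]
  have r31 : s2.r 31 (S.mu (S.n + 1)) = (S.pt (S.n + 1) 1).2 := by
    rw [f2.r 31]; simp [Scene.pt]
  have hrow : ∀ s' : Mem, s'.r 7 = s.r 7 → s'.r 8 = s.r 8 → S.row s' = S.row s :=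
    fun _ h h' => row_congr h h'
  simp [Outcome, row_setW] at O2
  rw [hrow _ (by simp) (by simp)] at O2
  have hpt : ∀ τ, S.pt (S.n + 1) τ = S.pt (S.n + 1) 1 := fun τ => by simp [Scene.pt, hv]
  have hne : s2.w 32 0 ≠ 0 := by
    intro h0
    obtain ⟨c, q, hq⟩ := hS.exists_reach_mu (S.n + 1)
    obtain ⟨τ, -, rfl⟩ := hq.mem_seg
    rw [hpt] at hq
    obtain ⟨g, hg, h1⟩ := (hde c hq.lt_k 1).2 ⟨by norm_num, hq⟩
    exact O2.1 h0 c hq.lt_k g hg h1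
  obtain ⟨hk, g, hg, h1⟩ := O2.2 hne
  obtain ⟨h2, h3⟩ := (hde _ hk 1).1 ⟨g, hg, h1⟩
  have hkM := hZ.k_lt
  simp
  refine ⟨by omega, h _ (s2.w 33 0) ⟨F2.setW, by simp [w28], by simp [w29], by simp, by simp [w31],
    by simp [r23], le_rfl, le_rfl, by omega, rfl, le_rfl, h2, h3, ?_, fun u hu => ?_⟩⟩
  · simp [vertex, r30, r31]
  · exact hu.congr fun j hj => by simp [hj]

lemma wp_backtrack (hS : S.Valid) (hZ : SizesOK S Z) (hF : Fwd S s (S.n + 1))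
    (hv : S.vec (S.n + 1) = 0)
    (h : ∀ s' c, Fwd S s' (S.n + 1) →
      S.Pre (S.mu (S.n + 1)) (S.n + 1) c (S.pt (S.n + 1) 1) (vertex s') →
      vertex s' (S.mu (S.n + 1)) = S.pt (S.n + 1) 1 → Q s') : wp Z backtrack Q s := by
  have hM := hZ.row_lt
  have hMV := hZ.radix_le
  have hn := hZ.npos
  simp only [backtrack, wp_block_cons]
  refine wp_lastLink hS hZ hF hv fun s1 c₀ B1 => ?_
  refine wp_loop Z (fun j s' => ∃ i a c τ m, Back S (S.mu (S.n + 1)) c₀ (S.pt (S.n + 1) 1) i a c τ m s' ∧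
    (3 * i + a + j ≤ 3 * S.n + 4 ∨ 3 * i + a ≤ 1)) (3 * S.n + 3) (by simp [B1.fwd.env.n])
    (by rw [hZ.n]; simp; omega) (by omega) rfl ?_ ?_ ?_ ?_
  · intro t' ht'
    change (WE.op .add (.op .mul (.const 3) (.get 1 (.const 0))) (.const 3)).reads t' = true at ht'
    simp [WE.reads] at ht'
    subst ht'
    rfl
  · exact ⟨_, _, _, _, _, B1.setW, Or.inl (by omega)⟩
  · rintro j hj s2 - - ⟨i, a, c, τ, m, B2, h2⟩
    refine wp_round hS hZ B2 fun s3 i' a' c' τ' m' h3 B3 => ⟨i', a', c', τ', m', B3.setW, by omega⟩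
  · rintro s2 - - ⟨i, a, c, τ, m, B2, h2⟩
    have ha := B2.trace.pos
    obtain rfl : i = 0 := by omega
    obtain rfl : a = 1 := by omega
    have hm := B2.trace.links
    rw [hS.mu_zero] at hm
    obtain rfl : m = 1 := by omega
    have E := B2.fwd.env
    have hmu := hS.mu_pos (S.n + 1)
    have h0 : ∀ τ, S.pt 0 τ = S.pt 0 1 := fun τ => by simp [Scene.pt, hS.vec_zero]
    have e0 : S.pt 0 1 = S.org 0 := by simp [Scene.pt, hS.vec_zero]
    have hpre := B2.trace.pre (fun _ => S.pt 0 1) (by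
      rw [h0]; exact Scene.Pre.start B2.trace.reach.lt_k rfl)
    simp [E.ox 0 (by omega), E.oy 0 (by omega)]
    have hvx : vertex ((s2.setR 30 0 (S.org 0).1).setR 31 0 (S.org 0).2) =
        fun j => if j < 1 then S.pt 0 1 else vertex s2 j := by
      funext j
      simp only [vertex, Mem.setR_r_same, Mem.setR_r_of_ne, ne_eq, Nat.reduceEqDiff,
        not_false_eq_true, Nat.lt_one_iff]
      split_ifs <;> simp [e0]
    refine h _ c₀ B2.fwd.env_setR.env_setR ?_ ?_
    · rw [hvx]
      exact hpre
    · rw [hvx]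
      simp only
      rw [if_neg (by omega)]
      exact B2.trace.last

lemma wp_output (hS : S.Valid) (hZ : SizesOK S Z) (hbase : 4 * S.n + 8 ≤ Z.base)
    (hF : Fwd S s (S.n + 1))
    (h : ∀ s', s'.w 0 0 = S.mu (S.n + 1) →
      (∀ j ≤ S.mu (S.n + 1), (s'.r 0 (2 * j), s'.r 0 (2 * j + 1)) = vertex s j) → Q s') :
    wp Z output Q s := by
  have hM := hZ.row_lt
  have hMV := hZ.radix_le
  have hn := hZ.npos
  have hlin := mu_le_linear hS (S.n + 1)
  simp only [output, wp_block_cons]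
  refine wp_loop Z (fun j s' => ∀ j' < j, (s'.r 0 (2 * j'), s'.r 0 (2 * j' + 1)) = vertex s j')
    (S.mu (S.n + 1) + 1) (by simp [hF.links])
    (by rw [hZ.n]; simp; omega) (by omega) rfl ?_ ?_ ?_ ?_
  · intro t' ht'
    change (WE.op .add (.get 27 (.const 0)) (.const 1)).reads t' = true at ht'
    simp [WE.reads] at ht'
    subst ht'
    rfl
  · intro j hj
    omega
  · intro j hj s1 h1 f1 I1
    have r30 : s1.r 30 = s.r 30 := f1.r 30
    have r31 : s1.r 31 = s.r 31 := f1.r 31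
    simp [h1, r30, r31]
    refine ⟨by omega, by omega, fun j' hj' => ?_⟩
    rcases hj'.lt_or_eq with h2 | rfl
    · rw [← I1 j' h2]
      simp only [Mem.setR_r_same]
      rw [if_neg (by omega), if_neg (by omega), if_neg (by omega), if_neg (by omega)]
    · simp only [Mem.setR_r_same, vertex]
      rw [if_neg (by omega)]
      simp
  · intro s1 h1 f1 I1
    have w27 : s1.w 27 = s.w 27 := f1.w 27
    simp [w27, hF.links]
    exact ⟨by omega, h _ (by simp) fun j hj => by simpa using I1 j (by omega)⟩

end
end Algo
end LinkTour

/-! ### Input and output -/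

namespace LinkTour
open RealRAM
namespace Algo

/-- Computes the constants of the program and the description of the scene. -/
def setup : SP := .block [
  .setw 3 (16 * .var 0 * .var 1), .setw 4 (2 * .var 1 + 4),
  .loop 7 (.var 0) 1 1 0 (.block [
    .rset 1 (.var 7) (.get 0 (2 * .var 7 + 4)), .rset 2 (.var 7) (.get 0 (2 * .var 7 + 5))]),
  .loop 7 (.var 1) 1 0 1 (.block [
    .setw 8 (2 * .var 0 + 4 * .var 7 + 4),
    .rset 3 (.var 7 + 1) (2 * .get 0 (.var 8) - .get 0 (.var 8 + 2)),
    .rset 4 (.var 7 + 1) (2 * .get 0 (.var 8 + 1) - .get 0 (.var 8 + 3)),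
    .rset 5 (.var 7 + 1) (.get 0 (.var 8 + 2) - .get 0 (.var 8)),
    .rset 6 (.var 7 + 1) (.get 0 (.var 8 + 3) - .get 0 (.var 8 + 1))]),
  .rset 3 0 (.get 0 0), .rset 4 0 (.get 0 1),
  .rset 3 (.var 1 + 1) (.get 0 2), .rset 4 (.var 1 + 1) (.get 0 3)]

/-- The whole program, apart from the computation of the first cell after the input and output. -/
def program : SP := .block [setup, forward, backtrack, output]

/-- The input is present in memory. -/
structure Input (S : Scene) (s : Mem) : Prop where
  k : s.w 0 0 = S.k
  n : s.w 1 0 = S.n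
  start : (s.r 0 0, s.r 0 1) = S.org 0
  last : (s.r 0 2, s.r 0 3) = S.org (S.n + 1)
  dir : ∀ j < S.k, (s.r 0 (2 * j + 4), s.r 0 (2 * j + 5)) = S.dir j
  org : ∀ i < S.n, (2 * s.r 0 (2 * S.k + 4 * i + 4) - s.r 0 (2 * S.k + 4 * i + 6),
    2 * s.r 0 (2 * S.k + 4 * i + 5) - s.r 0 (2 * S.k + 4 * i + 7)) = S.org (i + 1)
  vec : ∀ i < S.n, (s.r 0 (2 * S.k + 4 * i + 6) - s.r 0 (2 * S.k + 4 * i + 4),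
    s.r 0 (2 * S.k + 4 * i + 7) - s.r 0 (2 * S.k + 4 * i + 5)) = S.vec (i + 1)
  vec_zero : S.vec 0 = 0
  vec_last : S.vec (S.n + 1) = 0
  zero_w : ∀ t, 3 ≤ t → ∀ i, s.w t i = 0
  zero_r : ∀ t, 1 ≤ t → ∀ i, s.r t i = 0

section
variable {S : Scene} {Z : Sizes} {s s' : Mem} {Q : Mem → Prop}

lemma wp_setup (hZ : SizesOK S Z) (hbase : 16 * S.k * S.n ≤ Z.base) (hI : Input S s)
    (h : ∀ s', Frame setup s s' → Env S s' → Q s') : wp Z setup Q s := by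
  refine wp_mono Z (fun s' hs' => h s' hs'.2 hs'.1) (wp_frame Z ?_)
  have hM := hZ.row_lt
  have hMV := hZ.radix_le
  have hk := hZ.k_lt
  have hn := hZ.npos
  have hkn := hZ.kn_pos
  have hk1 := hZ.k_le
  have hn1 := hZ.n_le
  rw [radix_eq] at hbase hM hMV hk
  simp only [setup, wp_block_cons]
  simp [hI.k, hI.n]
  refine ⟨by rwa [radix_eq], by omega, ?_⟩
  obtain ⟨s0, hs0⟩ : ∃ s0, s0 = (s.setW 3 0 (16 * S.k * S.n)).setW 4 0 (2 * S.n + 4) := ⟨_, rfl⟩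
  have k0 : s0.w 0 0 = S.k := by simp [hs0, hI.k]
  have n0 : s0.w 1 0 = S.n := by simp [hs0, hI.n]
  have w3 : s0.w 3 0 = 16 * S.k * S.n := by simp [hs0]
  have w4 : s0.w 4 0 = 2 * S.n + 4 := by simp [hs0]
  have r0 : s0.r = s.r := by simp [hs0]
  rw [← hs0]
  clear hs0
  refine wp_loop Z (fun j s' => ∀ j' < j, (s'.r 1 j', s'.r 2 j') = S.dir j') S.k (by simp [k0])
    (by rw [hZ.k]; simp) (by omega) rfl (by intro t' ht'; simp [WE.reads, WE.var] at ht'; subst ht'; rfl)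
    (by intro j hj; omega) ?_ ?_
  · intro j hj s1 h1 f1 I1
    have e0 : s1.r 0 = s.r 0 := by rw [f1.r 0, r0]
    simp [h1, e0]
    refine ⟨by omega, by omega, fun j' hj' => ?_⟩
    rcases hj'.lt_or_eq with h2 | rfl
    · simp [h2.ne, Mem.setR_r_same, I1 j' h2]
    · simpa [Mem.setR_r_same] using hI.dir j' hj
  intro s1 _ f1 I1
  refine wp_loop Z (fun j s' => (∀ j' < j, (s'.r 3 (j' + 1), s'.r 4 (j' + 1)) = S.org (j' + 1) ∧
      (s'.r 5 (j' + 1), s'.r 6 (j' + 1)) = S.vec (j' + 1)) ∧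
      ∀ i, i = 0 ∨ j < i → s'.r 5 i = 0 ∧ s'.r 6 i = 0) S.n
    (by simp [f1.w 1, n0]) (by rw [hZ.n]; simp) (by omega) rfl
    (by intro t' ht'; simp [WE.reads, WE.var] at ht'; subst ht'; rfl) ?_ ?_ ?_
  · refine ⟨by intro j hj; omega, fun i _ => ?_⟩
    rw [Mem.setW_r, f1.r 5, f1.r 6, r0, hI.zero_r 5 (by omega), hI.zero_r 6 (by omega)]
    exact ⟨rfl, rfl⟩
  · intro j hj s2 h2 f2 I2
    have e0 : s2.r 0 = s.r 0 := by rw [f2.r 0, f1.r 0, r0]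
    have k2 : s2.w 0 0 = S.k := by rw [f2.w 0, f1.w 0, k0]
    simp [h2, e0, k2]
    refine ⟨by omega, by omega, by omega, by omega, by omega, fun j' hj' => ?_, ?_,
      fun i hi => ?_⟩
    · rcases hj'.lt_or_eq with h3 | rfl
      · simp [h3.ne, Mem.setR_r_same, I2.1 j' h3]
      · simp
        exact ⟨hI.org j' hj, hI.vec j' hj⟩
    · simpa [Mem.setR_r_same] using I2.2 0 (by omega)
    · simp [Mem.setR_r_same, show i ≠ j + 1 by omega]
      exact I2.2 i (by omega)
  · intro s2 _ f2 I2
    have e0 : s2.r 0 = s.r 0 := by rw [f2.r 0, f1.r 0, r0]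
    have n2 : s2.w 1 0 = S.n := by rw [f2.w 1, f1.w 1, n0]
    simp [e0, n2]
    refine ⟨by omega, by omega, by omega, by omega, ?_⟩
    have hdir : ∀ j < S.k, (s2.r 1 j, s2.r 2 j) = S.dir j := fun j hj => by
      rw [f2.r 1, f2.r 2, I1 j hj]
    obtain ⟨s3, hs3⟩ : ∃ s3, s3 =
      (((s2.setR 3 0 (s.r 0 0)).setR 4 0 (s.r 0 1)).setR 3 (S.n + 1) (s.r 0 2)).setR 4 (S.n + 1)
        (s.r 0 3) := ⟨_, rfl⟩
    rw [← hs3]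
    have horg : ∀ i ≤ S.n + 1, (s3.r 3 i, s3.r 4 i) = S.org i ∧ (s3.r 5 i, s3.r 6 i) = S.vec i := by
      intro i hi
      rcases Nat.eq_zero_or_pos i with rfl | hpos
      · have := I2.2 0 (by omega)
        rw [hI.vec_zero, ← hI.start, hs3]
        simp [Mem.setR_r_same, this]
      rcases hi.lt_or_eq with hlt | rfl
      · obtain ⟨i, rfl⟩ : ∃ j, i = j + 1 := ⟨i - 1, by omega⟩
        have := I2.1 i (by omega)
        rw [hs3]
        simpa [Mem.setR_r_same, show i ≠ S.n by omega] using this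
      · have := I2.2 (S.n + 1) (by omega)
        rw [hI.vec_last, ← hI.last, hs3]
        simp [this]
    refine ⟨?_, ?_, ?_, ?_, fun j hj => ?_, fun j hj => ?_, fun i hi => ?_, fun i hi => ?_,
      fun i hi => ?_, fun i hi => ?_⟩
    · simp [hs3, f2.w 0, f1.w 0, k0]
    · simp [hs3, n2]
    · simp [hs3, f2.w 3, f1.w 3, w3]
    · simp [hs3, f2.w 4, f1.w 4, w4]
    · rw [← hdir j hj]; simp [hs3]
    · rw [← hdir j hj]; simp [hs3]
    · rw [← (horg i hi).1]
    · rw [← (horg i hi).1]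
    · rw [← (horg i hi).2]
    · rw [← (horg i hi).2]

lemma wp_program (hS : S.Valid) (hZ : SizesOK S Z) (hbase : 16 * S.k * S.n ≤ Z.base)
    (hI : Input S s)
    (h : ∀ s' c v, s'.w 0 0 = S.mu (S.n + 1) →
      (∀ j ≤ S.mu (S.n + 1), (s'.r 0 (2 * j), s'.r 0 (2 * j + 1)) = v j) →
      S.Pre (S.mu (S.n + 1)) (S.n + 1) c (S.pt (S.n + 1) 1) v →
      v (S.mu (S.n + 1)) = S.pt (S.n + 1) 1 → Q s') : wp Z program Q s := by
  have hM := hZ.row_lt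
  simp only [program, wp_block_cons]
  refine wp_setup hZ hbase hI fun s1 f1 E1 => ?_
  refine wp_forward hS hZ E1 (fun j => ?_) (fun j => ?_) (fun j => ?_) (fun j => ?_)
    fun s2 f2 F2 => ?_
  · rw [f1.r 7, hI.zero_r 7 (by omega)]
  · rw [f1.r 8, hI.zero_r 8 (by omega)]
  · rw [f1.w 20, hI.zero_w 20 (by omega)]
  · rw [f1.w 22, hI.zero_w 22 (by omega)]
  refine wp_backtrack hS hZ F2 hI.vec_last fun s3 c F3 h3 h4 => ?_
  exact wp_output hS hZ (by omega) F3 fun s4 h5 h6 => h s4 c _ h5 h6 h3 h4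

end
end Algo
end LinkTour

/-! ### The machine program -/

namespace LinkTour
open RealRAM

/-- Real cell `2 i + b` of the input holds a coordinate of point number `i`. -/
lemma real_inputState {k n : ℕ} (C : Fin k → Plane) (E : Fin n → Plane × Plane) (s t : Plane)
    (i : ℕ) : ((inputState C E s t).real (2 * i), (inputState C E s t).real (2 * i + 1)) =
      (inputPoints C E s t).getD i (0, 0) := by
  have h1 : 2 * i / 2 = i := by omega
  have h2 : (2 * i + 1) / 2 = i := by omega
  have h3 : 2 * i % 2 = 0 := by omega
  have h4 : ¬ (2 * i + 1) % 2 = 0 := by omega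
  simp only [inputState, h1, h2, h3, h4, if_true, if_false]

lemma getD_flatMap_pair {l : List (Plane × Plane)} {i : ℕ} (h : i < l.length) (d : Plane) :
    (l.flatMap fun e => [e.1, e.2]).getD (2 * i) d = l[i].1 ∧
      (l.flatMap fun e => [e.1, e.2]).getD (2 * i + 1) d = l[i].2 := by
  induction l generalizing i with
  | nil => simp at h
  | cons e l ih =>
    rcases i with _ | i
    · simp
    · simpa [Nat.mul_add, add_right_comm] using ih (i := i) (by simpa using h)

section
variable {k n : ℕ} (C : Fin k → Plane) (E : Fin n → Plane × Plane) (s t : Plane)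

lemma getD_inputPoints_orientation (j : Fin k) :
    (inputPoints C E s t).getD (j + 2) (0, 0) = C j := by
  simp [inputPoints, List.getElem?_append, j.2]

lemma getD_inputPoints_segment (i : Fin n) :
    (inputPoints C E s t).getD (k + 2 * i + 2) (0, 0) = (E i).1 ∧
      (inputPoints C E s t).getD (k + 2 * i + 3) (0, 0) = (E i).2 := by
  have h := getD_flatMap_pair (l := List.ofFn E) (i := i) (by simp) (0, 0)
  simp only [List.getElem_ofFn] at h
  have hl : ([s, t] ++ List.ofFn C).length = k + 2 := by simp
  unfold inputPoints
  rw [List.getD_append_right _ _ _ _ (by omega), List.getD_append_right _ _ _ _ (by omega), hl,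
    show k + 2 * (i : ℕ) + 2 - (k + 2) = 2 * i by omega,
    show k + 2 * (i : ℕ) + 3 - (k + 2) = 2 * i + 1 by omega]
  exact h

lemma length_inputPoints : (inputPoints C E s t).length = 2 + k + 2 * n := by
  have : (fun e : Plane × Plane => [e.1, e.2].length) ∘ E = fun _ => 2 := rfl
  simp [inputPoints, List.length_flatMap, List.map_ofFn, Function.comp_def]
  omega

end

lemma IsOrientationSet.two_le {k : ℕ} {C : Fin k → Plane} (hC : IsOrientationSet C) : 2 ≤ k := by
  obtain ⟨i, -⟩ := hC.spans 0 0
  obtain ⟨j, hj⟩ := hC.symmetric i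
  by_contra h
  obtain rfl : j = i := Fin.ext (by omega)
  have h1 := hC.unit j
  have h2 : C j = 0 := self_eq_neg.1 hj
  simp [h2] at h1

namespace Algo

/-- The machine program: it reserves `16 k n` real cells for the input and the output and then runs
the structured program. -/
def machine : Program :=
  .seq (.wset (.const 2) (.op .mul (.op .mul (.const 16) (.cell (.const 0))) (.cell (.const 1))))
    program.compile

/-- The memory represented by a machine state. -/
def memOf (base : ℕ) (σ : State) : Mem where
  w t i := σ.word (t + 64 * i)
  r t i := if t = 0 then σ.real i else σ.real (base + (t + 64 * i))

lemma repr_memOf {Z : Sizes} {σ : State} (hb : ∀ a, σ.word a ≤ Z.V) (h2 : σ.word 2 = Z.base) :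
    Repr Z σ (memOf Z.base σ) :=
  ⟨fun _ _ _ => rfl, fun t _ ht i => by simp [memOf, ht], fun i _ => by simp [memOf], hb, h2⟩

/-- The memory after the reservation of the cells. -/
lemma input_memOf {k n : ℕ} {C : Fin k → Plane} {E : Fin n → Plane × Plane} {s t : Plane}
    (hk : 1 ≤ k) (hn : 1 ≤ n) :
    Input (sceneOf C E s t) (memOf (16 * k * n)
      { inputState C E s t with
        word := Function.update (inputState C E s t).word 2 (16 * k * n) }) := by
  have hreal := real_inputState C E s t
  have hdir := fun j => getD_inputPoints_orientation C E s t j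
  have hseg := fun i => getD_inputPoints_segment C E s t i
  have hlen := length_inputPoints C E s t
  have hk1 : k ≤ k * n := Nat.le_mul_of_pos_right _ hn
  have hn1 : n ≤ k * n := Nat.le_mul_of_pos_left _ hk
  have e0 : (memOf (16 * k * n) { inputState C E s t with
      word := Function.update (inputState C E s t).word 2 (16 * k * n) }).r 0 =
      (inputState C E s t).real := rfl
  have hpt : ∀ i : Fin n, ((inputState C E s t).real (2 * k + 4 * i + 4),
        (inputState C E s t).real (2 * k + 4 * i + 5)) = (E i).1 ∧
      ((inputState C E s t).real (2 * k + 4 * i + 6),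
        (inputState C E s t).real (2 * k + 4 * i + 7)) = (E i).2 := by
    intro i
    have h1 := hreal (k + 2 * i + 2)
    have h2 := hreal (k + 2 * i + 3)
    rw [(hseg i).1] at h1
    rw [(hseg i).2] at h2
    rw [← h1, ← h2]
    refine ⟨?_, ?_⟩ <;> congr 2 <;> omega
  refine ⟨rfl, rfl, ?_, ?_, ?_, ?_, ?_, by simp [sceneOf], by simp [sceneOf], ?_, ?_⟩
  · rw [e0]
    exact (hreal 0).trans (by simp [inputPoints, sceneOf])
  · rw [e0]
    exact (hreal 1).trans (by simp [inputPoints, sceneOf])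
  · intro j hj
    rw [e0, sceneOf_dir C E s t ⟨j, hj⟩, ← hdir ⟨j, hj⟩, ← hreal]
    rfl
  · intro i hi
    change i < n at hi
    obtain ⟨h1, h2⟩ := hpt ⟨i, hi⟩
    rw [e0]
    simp [sceneOf, hi, ← h1, ← h2]
  · intro i hi
    change i < n at hi
    obtain ⟨h1, h2⟩ := hpt ⟨i, hi⟩
    rw [e0]
    simp [sceneOf, hi, ← h1, ← h2]
  · intro t' ht' i
    simp only [memOf, Function.update_apply, inputState]
    rw [if_neg (by omega), if_neg (by omega), if_neg (by omega)]
  · intro t' ht' i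
    simp only [memOf, if_neg (show t' ≠ 0 by omega)]
    have hx : (inputPoints C E s t).getD ((16 * k * n + (t' + 64 * i)) / 2) (0, 0) = (0, 0) := by
      refine List.getD_eq_default _ _ ?_
      rw [hlen, radix_eq]
      omega
    simp only [inputState, hx, ite_self]

/-- The machine program solves all inputs, where `D` bounds the sizes of the expressions of the
program. -/
theorem exec_machine {D : ℕ} (hD1 : 1 ≤ D) (hD : program.ok D = true) {k n : ℕ} {C : Fin k → Plane}
    {E : Fin n → Plane × Plane} {s t : Plane} (hn : 1 ≤ n) (hC : IsOrientationSet C)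
    (hE : ∀ i, ∃ j, HasOrientation (E i).1 (E i).2 (C j))
    (hdisj : ∀ i i', i ≠ i' → Disjoint (points (E i)) (points (E i')))
    (hs : ∀ i, s ∉ points (E i)) (ht : ∀ i, t ∉ points (E i)) :
    ∃ (T : ℕ) (σ : State), Exec ((k * n) ^ (20 * D)) machine (inputState C E s t) T σ ∧
      T ≤ (program.coef + 20) * (k ^ 2 * n ^ 2) ∧
      IsMinLinkTour C E s t (σ.word 0) (outputVertex σ) := by
  obtain ⟨K, hK⟩ : ∃ K, program.coef = K := ⟨_, rfl⟩
  rw [hK]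
  have hk := hC.two_le
  have hkn : 2 ≤ k * n := hk.trans (Nat.le_mul_of_pos_right _ hn)
  have hk1 : k ≤ k * n := Nat.le_mul_of_pos_right _ hn
  have hn1 : n ≤ k * n := Nat.le_mul_of_pos_left _ (by omega)
  have hS := sceneOf_valid hn hC hE hdisj hs ht
  obtain ⟨S, hSdef⟩ : ∃ S, S = sceneOf C E s t := ⟨_, rfl⟩
  have hSk : S.k = k := by rw [hSdef]; rfl
  have hSn : S.n = n := by rw [hSdef]; rfl
  have hlast : S.pt (n + 1) 1 = t := by rw [hSdef]; exact sceneOf_pt_last C E s t 1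
  obtain ⟨Z, hZ⟩ : ∃ Z : Sizes, Z = ⟨k, n, 16 * k * n, (k * n) ^ 20⟩ := ⟨_, rfl⟩
  have Zk : Z.k = k := by rw [hZ]
  have Zn : Z.n = n := by rw [hZ]
  have Zb : Z.base = 16 * k * n := by rw [hZ]
  have ZV : Z.V = (k * n) ^ 20 := by rw [hZ]
  -- as `2 ≤ k * n`, the factor `16` is at most `(k * n) ^ 4`
  have h16 : 16 ≤ (k * n) ^ 4 := by
    calc 16 = 2 ^ 4 := by norm_num
      _ ≤ _ := Nat.pow_le_pow_left hkn 4
  have hV4 : (16 * k * n) ^ 4 ≤ Z.V := by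
    rw [ZV, radix_eq]
    calc (16 * (k * n)) ^ 4 ≤ ((k * n) ^ 4 * (k * n)) ^ 4 :=
          Nat.pow_le_pow_left (Nat.mul_le_mul_right _ h16) 4
      _ = (k * n) ^ 20 := by ring
  have hV1 : 16 * k * n ≤ Z.V := (Nat.le_self_pow (by norm_num) _).trans hV4
  have hV64 : 64 ≤ Z.V := by
    rw [ZV]
    calc 64 ≤ 2 ^ 20 := by norm_num
      _ ≤ _ := Nat.pow_le_pow_left hkn 20
  have hOK : SizesOK S Z := by
    refine ⟨by rw [Zk, hSk], by rw [Zn, hSn], by omega, by omega, by rwa [hSk, hSn]⟩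
  rw [radix_eq] at hV1
  have hI := input_memOf (C := C) (E := E) (s := s) (t := t) (show 1 ≤ k by omega) hn
  rw [← hSdef, ← Zb] at hI
  set σ₀ : State := { inputState C E s t with
    word := Function.update (inputState C E s t).word 2 Z.base } with hσ₀
  have hR : Repr Z σ₀ (memOf Z.base σ₀) := by
    refine repr_memOf (fun a => ?_) (by simp [hσ₀])
    simp only [hσ₀, Function.update_apply, inputState, Zb, radix_eq]
    split_ifs <;> omega
  have hprog := wp_program (hSdef ▸ hS) hOK (by rw [hSk, hSn, Zb]) hI (Q := fun s' => ∃ c v,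
      s'.w 0 0 = S.mu (S.n + 1) ∧
      (∀ j ≤ S.mu (S.n + 1), (s'.r 0 (2 * j), s'.r 0 (2 * j + 1)) = v j) ∧
      S.Pre (S.mu (S.n + 1)) (S.n + 1) c (S.pt (S.n + 1) 1) v ∧
      v (S.mu (S.n + 1)) = S.pt (S.n + 1) 1) fun s' c v h1 h2 h3 h4 => ⟨c, v, h1, h2, h3, h4⟩
  obtain ⟨T, σ, s', hex, hR', ⟨c, v, h1, h2, h3, h4⟩, hT⟩ :=
    exec_compile Z hV64 (by omega) (by omega) hD hR hprog
  rw [ZV, ← pow_mul] at hex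
  have hB : (k * n) ^ 20 ≤ (k * n) ^ (20 * D) := Nat.pow_le_pow_right (by omega) (by omega)
  have hkd : program.kd = 2 := by decide
  have hnd : program.nd = 2 := by decide
  rw [hkd, hnd, hK, Zk, Zn] at hT
  have hpos : 1 ≤ k ^ 2 * n ^ 2 := Nat.mul_pos (Nat.pow_pos (by omega)) (Nat.pow_pos hn)
  have hword : σ.word 0 = S.mu (S.n + 1) := by rw [← h1]; exact hR'.word 0 (by norm_num) 0
  have hmu := mu_le_linear (hSdef ▸ hS) (S.n + 1)
  have hout : ∀ j ≤ S.mu (S.n + 1), outputVertex σ j = v j := by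
    intro j hj
    rw [← h2 j hj, outputVertex, hR'.io _ (by rw [Zb, radix_eq]; omega),
      hR'.io _ (by rw [Zb, radix_eq]; omega)]
  have hstart : (WExp.op .mul (.op .mul (.const 16) (.cell (.const 0)))
      (.cell (.const 1))).eval (inputState C E s t) = Z.base := by
    rw [Zb]; rfl
  refine ⟨_, σ, ⟨Exec.seq (Exec.wset _ _ _ ?_ ?_) (?_ : Exec _ _ _ T σ), ?_, ?_⟩⟩
  · change 2 ≤ _
    omega
  · simp only [WExp.Fits, WExp.eval, WOp.apply, inputState, if_true, Nat.one_ne_zero, if_false]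
    rw [radix_eq]
    omega
  · rw [hstart]
    exact hex
  · simp only [WExp.cost]
    rw [add_mul]
    omega
  · rw [hword]
    refine isMinLinkTour_of_pre (c := c) hn hC hE hdisj hs ht (by rw [hSn, hSdef]) ?_ ?_
    · rw [hout _ le_rfl, h4, hSn, hlast]
    · rw [hSn, hlast, hSdef] at h3
      rw [hSn, hSdef]
      exact h3.congr fun j hj => hout j (by rw [hSn, hSdef]; exact hj.le)

end Algo
end LinkTour

/-- There is one real RAM program that, for every sequence `E` of `n ≥ 1` pairwise disjoint
`C`-oriented segments and all points `s`, `t` on none of them, computes the vertices of a minimum-link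
`C`-oriented tour of `E` from `s` to `t` (its number of links is left in `W[0]`) within
`K · |C|² · n²` steps, on words of `O(log (|C| · n))` bits. -/
theorem mainTheorem1 :
    ∃ (P : RealRAM.Program) (K d : ℕ),
      ∀ (k n : ℕ) (C : Fin k → LinkTour.Plane) (E : Fin n → LinkTour.Plane × LinkTour.Plane)
        (s t : LinkTour.Plane),
        1 ≤ n →
        LinkTour.IsOrientationSet C →
        (∀ i, ∃ j, LinkTour.HasOrientation (E i).1 (E i).2 (C j)) →
        (∀ i i', i ≠ i' → Disjoint (LinkTour.points (E i)) (LinkTour.points (E i'))) →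
        (∀ i, s ∉ LinkTour.points (E i)) →
        (∀ i, t ∉ LinkTour.points (E i)) →
        ∃ (T : ℕ) (σ : RealRAM.State),
          RealRAM.Exec ((k * n) ^ d) P (LinkTour.inputState C E s t) T σ ∧
          T ≤ K * (k ^ 2 * n ^ 2) ∧
          LinkTour.IsMinLinkTour C E s t (σ.word 0) (LinkTour.outputVertex σ) := by
  -- Stored words stay below `V = (k * n) ^ 20`, and intermediate values below `V ^ 100`: the bound
  -- 100 on the cost of every expression in the program is checked by `decide`.
  refine ⟨LinkTour.Algo.machine, LinkTour.Algo.program.coef + 20, 20 * 100,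
    fun k n C E s t hn hC hE hdisj hs ht => ?_⟩
  exact LinkTour.Algo.exec_machine (by norm_num) (by decide) hn hC hE hdisj hs ht
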